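/- Let $\mathbb F=\mathbb Z/2$. The knot surgery algebra $\mathcal K$ is the $\mathbb F$-algebra over the ring of idempotents $\mathbf I=\mathbf I_0\oplus\mathbf I_1$ with $\mathbf I_0\mathcal K\mathbf I_0=\mathbb F[\mathscr U,\mathscr V]$, $\mathbf I_1\mathcal K\mathbf I_1=\mathbb F[\mathscr U,\mathscr V,\mathscr V^{-1}]$, $\mathbf I_0\mathcal K\mathbf I_1=0$, and $\mathbf I_1\mathcal K\mathbf I_0$ the free left $\mathbb F[\mathscr U,\mathscr V,\mathscr V^{-1}]$-module on $\sigma,\tau$, with $\sigma f=I(f)\sigma$ and $\tau f=T(f)\tau$ for $f\in\mathbb F[\mathscr U,\mathscr V]$; here $I$ is the inclusion and $T$ is the algebra map with $T(\mathscr U)=\mathscr V^{-1}$, $T(\mathscr V)=\mathscr U\mathscr V^2$. For $n\in\mathbb N$ let $J_n\subset\mathcal K$ be the span of the elements $\mathscr U^i\mathscr V^j\in\mathbf I_0\mathcal K\mathbf I_0$ and $\mathscr U^i\mathscr V^j\sigma$ with $i\ge n$ or $j\ge n$, of $\mathscr U^i\mathscr V^j\tau$ with $j\le 2i-n$ or $i\ge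 n$, and of $\mathscr U^i\mathscr V^j\in\mathbf I_1\mathcal K\mathbf I_1$ with $i\ge n$. If $X=X_0\oplus X_1$ and $Y=Y_0\oplus Y_1$ are $\mathbb F$-vector spaces with chosen bases of $X_\varepsilon$, $Y_\varepsilon$, a basic neighbourhood of $0$ in $X$ is the span $X_{\mathrm{co}(S)}$ of the basis elements outside a finite set $S$, and one in $Y\otimes_{\mathbf I}\mathcal K$ is $Y_{\mathrm{co}(S)}\otimes\mathcal K+Y\otimes J_m$ with $S$ finite and $m\in\mathbb N$. A morphism $f\colon X\to Y$ is a (uniformly) Cauchy sequence $(f_n)_{n\in\mathbb N}$ of continuous right $\mathbf I$-linear maps $f_n\colon X\to Y\otimes_{\mathbf I}\mathcal K$: for each basic neighbourhood $E$ there is $N$ such that $(f_n-f_{n'})(X)\subset E$ for all $n,n'\ge N$. Write $f\sim g$ (Cauchy equivalent) if for each $E$ one has $(f_n-g_n)(X)\subset E$ for all large $n$. Morphisms are composed term by term, by $g\circ f=(\mathrm{id}\otimes\mu_2)(g\otimes\mathrm{id})f$. An Alexander cobounded type-$D$ module over $\mathcal K$ is such an $X$ with a morphism $\delta^1\colon X\to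 X$ satisfying $\delta^1\circ\delta^1\sim0$; it is finitely generated if $\dim_{\mathbb F}X<\infty$. For a morphism $f$ put $\partial f=\delta^1\circ f+f\circ\delta^1$. Two such modules $X,Y$ are homotopy equivalent, $X\simeq Y$, if there are morphisms $f\colon X\to Y$, $g\colon Y\to X$, $h\colon X\to X$, $k\colon Y\to Y$ with $\partial f\sim0$, $\partial g\sim0$, $g\circ f\sim\mathrm{id}+\partial h$, $f\circ g\sim\mathrm{id}+\partial k$. The following type-$DA$ bimodules over $(\mathcal K\otimes_{\mathbb F}\mathcal K,\mathcal K)$ all have generators $i_0,i_1$, where $i_\varepsilon$ has left idempotent $\mathbf I_\varepsilon\otimes\mathbf I_\varepsilon$ and right idempotent $\mathbf I_\varepsilon$. Write $a|b$ for $a\otimes b$. The merge bimodule $M_2$ has operations $\delta^1_2(a|b,i_\varepsilon)=i_\varepsilon\otimes ab$ for $a,b\in\mathbf I_\varepsilon\mathcal K\mathbf I_\varepsilon$, and $$\delta_3^1(a\sigma|b,\,a'|b'\sigma,\,i_0)=i_1\otimes ab\,I(a')\,b'\sigma,\qquad \delta_3^1(a\tau|b,\,a'|b'\tau,\,i_0)=i_1\otimes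 ab\,T(a')\,b'\tau$$ for $a,b,b'\in\mathbf I_1\mathcal K\mathbf I_1$ and $a'\in\mathbf I_0\mathcal K\mathbf I_0$; the operations vanish on inputs of all other kinds. The pair-of-pants bimodule $W_r$ has the operations of $M_2$ and in addition $$\delta_5^1(a|b,\,a'|b',\,c|d\tau,\,e\tau|f,\,i_0)=i_1\otimes\mathscr V^{-1}\partial_{\mathscr U}(ab)\,a'\,(\mathscr U\partial_{\mathscr U}+\mathscr V\partial_{\mathscr V})(b')\,c\,d\,e\,T(f)\,\tau$$ for $a,b,a',b',c,d,e\in\mathbf I_1\mathcal K\mathbf I_1$ and $f\in\mathbf I_0\mathcal K\mathbf I_0$, and $W_l$ has the operations of $M_2$ and in addition $$\delta_5^1(a|b,\,a'|b',\,c\tau|d,\,e|f\tau,\,i_0)=i_1\otimes\mathscr V^{-1}\partial_{\mathscr U}(ab)\,(\mathscr U\partial_{\mathscr U}+\mathscr V\partial_{\mathscr V})(a')\,b'\,c\,d\,T(e)\,f\,\tau$$ for $a,b,a',b',c,d,f\in\mathbf I_1\mathcal K\mathbf I_1$ and $e\in\mathbf I_0\mathcal K\mathbf I_0$. For Alexander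 cobounded type-$D$ modules $X_1,X_2$ let $X_1\otimes_{\mathbb F}X_2$ be the external tensor product, with the sequence of structure maps $\delta^1_n\otimes1+1\otimes\delta^1_n$ over $\mathcal K\otimes_{\mathbb F}\mathcal K$. For $N\in\{M_2,W_l,W_r\}$ let $(X_1\otimes_{\mathbb F}X_2)\boxtimes N$ have underlying space $(X_1\otimes_{\mathbb F}X_2)\otimes_{\mathbf I\otimes\mathbf I}N$, the product basis, and the sequence of structure maps $\sum_{j}(\mathrm{id}\otimes\delta^1_{j+1})\circ(\delta^{j}\otimes\mathrm{id})$, where $\delta^j$ denotes the $j$-fold iterate of the $n$-th structure map of $X_1\otimes_{\mathbb F}X_2$. **Proposition.** Let $X_1$ and $X_2$ be Alexander cobounded type-$D$ modules over $\mathcal K$, each homotopy equivalent to a finitely generated Alexander cobounded type-$D$ module. Then $(X_1\otimes_{\mathbb F}X_2)\boxtimes M_2$, $(X_1\otimes_{\mathbb F}X_2)\boxtimes W_l$ and $(X_1\otimes_{\mathbb F}X_2)\boxtimes W_r$ are Alexander cobounded type-$D$ modules over $\mathcal K$, and $$(X_1\otimes_{\mathbb F}X_2)\boxtimes W_l\simeq(X_1\otimes_{\mathbb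 F}X_2)\boxtimes M_2,\qquad (X_1\otimes_{\mathbb F}X_2)\boxtimes W_r\simeq(X_1\otimes_{\mathbb F}X_2)\boxtimes M_2 .$$ -/

import Mathlib

open scoped TensorProduct

universe u v w

noncomputable section

namespace KnotSurgery

/-! ### The knot surgery algebra -/

/-- The polynomial ring `𝔽₂[U, V]`; the basis element `(i, j)` is the monomial `U ^ i * V ^ j`. -/
abbrev R0 : Type := AddMonoidAlgebra (ZMod 2) (ℕ × ℕ)

/-- The ring `𝔽₂[U, V, V⁻¹]`; the basis element `(i, j)` is the monomial `U ^ i * V ^ j`. -/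
abbrev R1 : Type := AddMonoidAlgebra (ZMod 2) (ℕ × ℤ)

/-- The monomial `U ^ i * V ^ j` of `𝔽₂[U, V, V⁻¹]`. -/
def mono (i : ℕ) (j : ℤ) : R1 := AddMonoidAlgebra.single (i, j) 1

/-- Exponents of the localization map: `(i, j) ↦ (i, j)`. -/
def expI : ℕ × ℕ →+ ℕ × ℤ where
  toFun p := (p.1, (p.2 : ℤ))
  map_zero' := by simp
  map_add' p q := by simp

/-- Exponents of `T`: `U ^ i * V ^ j ↦ V ^ (-i) * (U * V ^ 2) ^ j = U ^ j * V ^ (2 * j - i)`. -/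
def expT : ℕ × ℕ →+ ℕ × ℤ where
  toFun p := (p.2, 2 * (p.2 : ℤ) - (p.1 : ℤ))
  map_zero' := by simp
  map_add' p q := by
    ext
    · simp
    · simp only [Prod.fst_add, Prod.snd_add, Nat.cast_add]; ring

/-- The localization map `I : 𝔽₂[U, V] → 𝔽₂[U, V, V⁻¹]`. -/
def mapI : R0 →ₐ[ZMod 2] R1 := AddMonoidAlgebra.mapDomainAlgHom (ZMod 2) (ZMod 2) expI

/-- The algebra map `T : 𝔽₂[U, V] → 𝔽₂[U, V, V⁻¹]` with `T U = V⁻¹` and `T V = U * V ^ 2`. -/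
def mapT : R0 →ₐ[ZMod 2] R1 := AddMonoidAlgebra.mapDomainAlgHom (ZMod 2) (ZMod 2) expT

/-- The linear map given by the values on monomials. -/
def onMonomials (φ : ℕ × ℤ → R1) : R1 →ₗ[ZMod 2] R1 :=
  Finsupp.linearCombination (ZMod 2) φ ∘ₗ
    (AddMonoidAlgebra.coeffLinearEquiv (ZMod 2)).toLinearMap

/-- The partial derivative `∂_U` of `𝔽₂[U, V, V⁻¹]`. -/
def partialU : R1 →ₗ[ZMod 2] R1 :=
  onMonomials fun p => (p.1 : ZMod 2) • mono (p.1 - 1) p.2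

/-- The partial derivative `∂_V` of `𝔽₂[U, V, V⁻¹]`. -/
def partialV : R1 →ₗ[ZMod 2] R1 :=
  onMonomials fun p => (p.2 : ZMod 2) • mono p.1 (p.2 - 1)

/-- The operator `V⁻¹ * ∂_U`. -/
def opVinvPartialU : R1 →ₗ[ZMod 2] R1 := LinearMap.mulLeft (ZMod 2) (mono 0 (-1)) ∘ₗ partialU

/-- The operator `U * ∂_U + V * ∂_V`. -/
def opEuler : R1 →ₗ[ZMod 2] R1 :=
  LinearMap.mulLeft (ZMod 2) (mono 1 0) ∘ₗ partialU +
    LinearMap.mulLeft (ZMod 2) (mono 0 1) ∘ₗ partialV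

/-- The knot surgery algebra `𝒦`. The element with components `f, g, s, t` is
`f + g + s * σ + t * τ`, with `f` in `I₀ 𝒦 I₀ = 𝔽₂[U, V]`, with `g` in
`I₁ 𝒦 I₁ = 𝔽₂[U, V, V⁻¹]` and with `s * σ + t * τ` in `I₁ 𝒦 I₀`; there is no component in
`I₀ 𝒦 I₁ = 0`. -/
@[ext]
structure K : Type where
  /-- the component in `I₀ 𝒦 I₀` -/
  f : R0
  /-- the component in `I₁ 𝒦 I₁` -/
  g : R1
  /-- the coefficient of `σ` -/
  s : R1
  /-- the coefficient of `τ` -/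
  t : R1

namespace K

instance : Zero K := ⟨⟨0, 0, 0, 0⟩⟩
instance : One K := ⟨⟨1, 1, 0, 0⟩⟩
instance : Add K := ⟨fun a b => ⟨a.f + b.f, a.g + b.g, a.s + b.s, a.t + b.t⟩⟩
instance : Neg K := ⟨fun a => ⟨-a.f, -a.g, -a.s, -a.t⟩⟩

/-- The product, determined by `σ * f = I f * σ` and `τ * f = T f * τ`. -/
instance : Mul K :=
  ⟨fun a b => ⟨a.f * b.f, a.g * b.g, a.g * b.s + a.s * mapI b.f, a.g * b.t + a.t * mapT b.f⟩⟩

instance : SMul (ZMod 2) K := ⟨fun c a => ⟨c • a.f, c • a.g, c • a.s, c • a.t⟩⟩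

@[simp] theorem zero_f : (0 : K).f = 0 := rfl
@[simp] theorem zero_g : (0 : K).g = 0 := rfl
@[simp] theorem zero_s : (0 : K).s = 0 := rfl
@[simp] theorem zero_t : (0 : K).t = 0 := rfl
@[simp] theorem one_f : (1 : K).f = 1 := rfl
@[simp] theorem one_g : (1 : K).g = 1 := rfl
@[simp] theorem one_s : (1 : K).s = 0 := rfl
@[simp] theorem one_t : (1 : K).t = 0 := rfl
@[simp] theorem add_f (a b : K) : (a + b).f = a.f + b.f := rfl
@[simp] theorem add_g (a b : K) : (a + b).g = a.g + b.g := rfl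
@[simp] theorem add_s (a b : K) : (a + b).s = a.s + b.s := rfl
@[simp] theorem add_t (a b : K) : (a + b).t = a.t + b.t := rfl
@[simp] theorem neg_f (a : K) : (-a).f = -a.f := rfl
@[simp] theorem neg_g (a : K) : (-a).g = -a.g := rfl
@[simp] theorem neg_s (a : K) : (-a).s = -a.s := rfl
@[simp] theorem neg_t (a : K) : (-a).t = -a.t := rfl
@[simp] theorem mul_f (a b : K) : (a * b).f = a.f * b.f := rfl
@[simp] theorem mul_g (a b : K) : (a * b).g = a.g * b.g := rfl
@[simp] theorem mul_s (a b : K) : (a * b).s = a.g * b.s + a.s * mapI b.f := rfl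
@[simp] theorem mul_t (a b : K) : (a * b).t = a.g * b.t + a.t * mapT b.f := rfl
@[simp] theorem smul_f (c : ZMod 2) (a : K) : (c • a).f = c • a.f := rfl
@[simp] theorem smul_g (c : ZMod 2) (a : K) : (c • a).g = c • a.g := rfl
@[simp] theorem smul_s (c : ZMod 2) (a : K) : (c • a).s = c • a.s := rfl
@[simp] theorem smul_t (c : ZMod 2) (a : K) : (c • a).t = c • a.t := rfl

instance : Ring K :=
  Ring.ofMinimalAxioms
    (by intro a b c; ext1 <;> simp [add_assoc])
    (by intro a; ext1 <;> simp)
    (by intro a; ext1 <;> simp)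
    (by intro a b c; ext1 <;> simp <;> ring)
    (by intro a; ext1 <;> simp)
    (by intro a; ext1 <;> simp)
    (by intro a b c; ext1 <;> simp <;> ring)
    (by intro a b c; ext1 <;> simp <;> ring)

instance : Module (ZMod 2) K where
  one_smul a := by ext1 <;> simp
  mul_smul c d a := by ext1 <;> simp [mul_smul]
  smul_zero c := by ext1 <;> simp
  smul_add c a b := by ext1 <;> simp
  add_smul c d a := by ext1 <;> simp [add_smul]
  zero_smul a := by ext1 <;> simp

instance : Algebra (ZMod 2) K :=
  Algebra.ofModule
    (by intro c a b; ext1 <;> simp)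
    (by intro c a b; ext1 <;> simp)

/-- The idempotents `I₀` and `I₁`. -/
def e (ε : Fin 2) : K := if ε = 0 then ⟨1, 0, 0, 0⟩ else ⟨0, 1, 0, 0⟩

/-- The element `σ` of `I₁ 𝒦 I₀`. -/
def sigma : K := ⟨0, 0, 1, 0⟩

/-- The element `τ` of `I₁ 𝒦 I₀`. -/
def tau : K := ⟨0, 0, 0, 1⟩

/-- The component in `I₀ 𝒦 I₀`. -/
def projF : K →ₗ[ZMod 2] R0 where
  toFun := f
  map_add' _ _ := rfl
  map_smul' _ _ := rfl

/-- The component in `I₁ 𝒦 I₁`. -/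
def projG : K →ₗ[ZMod 2] R1 where
  toFun := g
  map_add' _ _ := rfl
  map_smul' _ _ := rfl

/-- The coefficient of `σ`. -/
def projS : K →ₗ[ZMod 2] R1 where
  toFun := s
  map_add' _ _ := rfl
  map_smul' _ _ := rfl

/-- The coefficient of `τ`. -/
def projT : K →ₗ[ZMod 2] R1 where
  toFun := t
  map_add' _ _ := rfl
  map_smul' _ _ := rfl

/-- The subspace `J_n` of the filtration of `𝒦`: the span of
* the monomials `U ^ i * V ^ j` of `I₀ 𝒦 I₀` with `i ≥ n` or `j ≥ n`,
* the elements `U ^ i * V ^ j * σ` with `i ≥ n` or `j ≥ n`,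
* the elements `U ^ i * V ^ j * τ` with `j ≤ 2 * i - n` or `i ≥ n`,
* the monomials `U ^ i * V ^ j` of `I₁ 𝒦 I₁` with `i ≥ n`. -/
def J (n : ℕ) : Submodule (ZMod 2) K where
  carrier := {k |
    (∀ i j : ℕ, ¬ (n ≤ i ∨ n ≤ j) → k.f.coeff (i, j) = 0) ∧
    (∀ (i : ℕ) (j : ℤ), ¬ (n ≤ i ∨ (n : ℤ) ≤ j) → k.s.coeff (i, j) = 0) ∧
    (∀ (i : ℕ) (j : ℤ), ¬ (j ≤ 2 * (i : ℤ) - (n : ℤ) ∨ n ≤ i) → k.t.coeff (i, j) = 0) ∧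
    (∀ (i : ℕ) (j : ℤ), ¬ (n ≤ i) → k.g.coeff (i, j) = 0)}
  zero_mem' := by simp
  add_mem' := by
    rintro a b ⟨ha1, ha2, ha3, ha4⟩ ⟨hb1, hb2, hb3, hb4⟩
    refine ⟨fun i j h => ?_, fun i j h => ?_, fun i j h => ?_, fun i j h => ?_⟩
    · simp [ha1 i j h, hb1 i j h]
    · simp [ha2 i j h, hb2 i j h]
    · simp [ha3 i j h, hb3 i j h]
    · simp [ha4 i j h, hb4 i j h]
  smul_mem' := by
    rintro c a ⟨ha1, ha2, ha3, ha4⟩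
    refine ⟨fun i j h => ?_, fun i j h => ?_, fun i j h => ?_, fun i j h => ?_⟩
    · simp [ha1 i j h]
    · simp [ha2 i j h]
    · simp [ha3 i j h]
    · simp [ha4 i j h]

end K

/-- The algebra `𝒦 ⊗ 𝒦`. -/
abbrev KK : Type := K ⊗[ZMod 2] K

/-! ### Type-D structures given by sequences of structure maps

A vector space with a basis `gen` splitting over the idempotents is recorded by the idempotent of
every basis element. For an algebra `A` with the given idempotents, a linear map from `X` to
`Y ⊗_I A` is recorded by its values on the basis of `X`; an element of `Y ⊗_I A` is
`∑ y, y ⊗ a_y`, a finitely supported family with `a_y` in `I_(idem y) A`. -/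

/-- A vector space over `𝔽₂` with a basis in every idempotent `ι`, and with a sequence of maps
`δ n : X → X ⊗_I A` (no conditions yet). -/
structure TypeDSeq (ι A : Type) [Zero A] where
  /-- the basis -/
  gen : Type u
  /-- the idempotents of the basis elements -/
  idem : gen → ι
  /-- the structure maps -/
  δ : ℕ → gen → gen →₀ A

/-- Sequences of maps `X → Y ⊗_I 𝒦` (no conditions yet). -/
abbrev MapSeq (X : TypeDSeq.{u} (Fin 2) K) (Y : TypeDSeq.{v} (Fin 2) K) :=
  ℕ → X.gen → Y.gen →₀ K

/-- The basic open neighbourhood `Y_{co S} ⊗ 𝒦 + Y ⊗ J_m` of zero in `Y ⊗_I 𝒦`, where `Y` has the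
cofinite basis topology: `Y_{co S}` is the span of the basis elements outside the finite set `S`. -/
def InNhd {β : Type*} (S : Finset β) (m : ℕ) (w : β →₀ K) : Prop :=
  ∀ y ∈ S, w y ∈ K.J m

section Maps

variable {X : TypeDSeq.{u} (Fin 2) K} {Y : TypeDSeq.{v} (Fin 2) K} {Z : TypeDSeq.{w} (Fin 2) K}

/-- Every map in the sequence is a map of right modules over the ring of idempotents, with values
in `Y ⊗_I 𝒦`: all coefficients lie in `I_(idem y) 𝒦 I_(idem x)`. -/
def IsIdempotented (φ : MapSeq X Y) : Prop :=
  ∀ n x y, K.e (Y.idem y) * φ n x y * K.e (X.idem x) = φ n x y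

/-- Every map in the sequence is continuous: the preimage of any basic neighbourhood of zero
contains the span of all but finitely many basis elements. -/
def IsContinuousSeq (φ : MapSeq X Y) : Prop :=
  ∀ n, ∀ (S : Finset Y.gen) (m : ℕ), ∃ F : Finset X.gen, ∀ x ∉ F, InNhd S m (φ n x)

/-- The sequence of maps is Cauchy, in the uniform topology on maps `X → Y ⊗_I 𝒦`. -/
def IsUniformlyCauchy (φ : MapSeq X Y) : Prop :=
  ∀ (S : Finset Y.gen) (m : ℕ), ∃ N, ∀ n ≥ N, ∀ n' ≥ N, ∀ x, InNhd S m (φ n x - φ n' x)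

/-- Cauchy equivalence: the difference of the two sequences tends to zero. -/
def CauchyEquiv (φ ψ : MapSeq X Y) : Prop :=
  ∀ (S : Finset Y.gen) (m : ℕ), ∃ N, ∀ n ≥ N, ∀ x, InNhd S m (φ n x - ψ n x)

/-- Cauchy sequences of continuous maps `X → Y ⊗_I 𝒦`. -/
structure IsMorphism (φ : MapSeq X Y) : Prop where
  idempotented : IsIdempotented φ
  continuous : IsContinuousSeq φ
  cauchy : IsUniformlyCauchy φ

/-- The composition `(id ⊗ μ₂) ∘ (ψ ⊗ id) ∘ φ`, term by term. -/
def compSeq (ψ : MapSeq Y Z) (φ : MapSeq X Y) : MapSeq X Z := fun n x =>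
  (φ n x).sum fun y a => (ψ n y).mapRange (fun b => b * a) (zero_mul a)

/-- The identity morphism `x ↦ x ⊗ 1`. -/
def idSeq (X : TypeDSeq.{u} (Fin 2) K) : MapSeq X X := fun _ x =>
  Finsupp.single x (K.e (X.idem x))

/-- The differential of a morphism: `δ_Y ∘ φ + φ ∘ δ_X`. -/
def dMor (φ : MapSeq X Y) : MapSeq X Y := compSeq Y.δ φ + compSeq φ X.δ

end Maps

/-- Alexander cobounded type-D modules over `𝒦`: the sequence `δ` is a Cauchy sequence of continuous
maps, and `(id ⊗ μ₂) ∘ (δ ⊗ id) ∘ δ` is Cauchy equivalent to zero. -/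
structure IsAlexanderCobounded (X : TypeDSeq.{u} (Fin 2) K) : Prop where
  morphism : IsMorphism (X := X) (Y := X) X.δ
  square : CauchyEquiv (X := X) (Y := X) (compSeq X.δ X.δ) 0

/-- Homotopy equivalence of Alexander cobounded type-D modules. -/
def HomotopyEquivalent (X : TypeDSeq.{u} (Fin 2) K) (Y : TypeDSeq.{v} (Fin 2) K) : Prop :=
  ∃ (φ : MapSeq X Y) (ψ : MapSeq Y X) (h : MapSeq X X) (k : MapSeq Y Y),
    IsMorphism φ ∧ IsMorphism ψ ∧ IsMorphism h ∧ IsMorphism k ∧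
    CauchyEquiv (dMor φ) 0 ∧ CauchyEquiv (dMor ψ) 0 ∧
    CauchyEquiv (compSeq ψ φ) (idSeq X + dMor h) ∧
    CauchyEquiv (compSeq φ ψ) (idSeq Y + dMor k)

/-- The module is homotopy equivalent to an Alexander cobounded one with a finite basis. -/
def IsHomotopyFinite (X : TypeDSeq.{u} (Fin 2) K) : Prop :=
  ∃ Y : TypeDSeq.{u} (Fin 2) K,
    Finite Y.gen ∧ IsAlexanderCobounded Y ∧ HomotopyEquivalent X Y

/-- The external tensor product, over `𝒦 ⊗ 𝒦`, with structure maps `δ ⊗ 1 + 1 ⊗ δ`. -/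
def extTensor (X : TypeDSeq.{u} (Fin 2) K) (Y : TypeDSeq.{v} (Fin 2) K) :
    TypeDSeq.{max u v} (Fin 2 × Fin 2) KK where
  gen := X.gen × Y.gen
  idem p := (X.idem p.1, Y.idem p.2)
  δ n p :=
    ((X.δ n p.1).sum fun x a => Finsupp.single (x, p.2) (a ⊗ₜ[ZMod 2] K.e (Y.idem p.2))) +
    ((Y.δ n p.2).sum fun y b => Finsupp.single (p.1, y) (K.e (X.idem p.1) ⊗ₜ[ZMod 2] b))

/-! ### Type-DA bimodules over `(𝒦 ⊗ 𝒦, 𝒦)` and the box tensor product -/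

/-- The generators and the operations of a type-DA bimodule over `(𝒦 ⊗ 𝒦, 𝒦)`. For a list
`[a_j, …, a_1]` of algebra elements, `op [a_j, …, a_1] m` is `δ_{j+1}^1(a_j, …, a_1, m)`. Only
finitely many of the operations are nonzero. -/
structure DAOperations where
  /-- the generators -/
  gen : Type
  /-- the left idempotents -/
  left : gen → Fin 2 × Fin 2
  /-- the right idempotents -/
  right : gen → Fin 2
  /-- the operations -/
  op : List KK → gen → gen →₀ K
  /-- the largest number of algebra inputs -/
  maxInputs : ℕ
  op_eq_zero : ∀ as m, maxInputs < as.length → op as m = 0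

/-- `iterSum δ c j as x` is the sum of `c y (a_j :: … :: a_1 :: as)` over all terms
`y ⊗ (a_j, …, a_1)` of the `j`-fold iterate of `δ` at `x`; here `a_1` comes from the
first application of `δ`. -/
def iterSum {B A M : Type*} [Zero A] [AddCommMonoid M] (δ : B → B →₀ A) (c : B → List A → M) :
    ℕ → List A → B → M
  | 0, as, x => c x as
  | j + 1, as, x => (δ x).sum fun y a => iterSum δ c j (a :: as) y

/-- The box tensor product, with structure maps `∑ j, (id ⊗ δ_{j+1}^1) ∘ (δ^j ⊗ id)`. The basis
consists of the pairs `x ⊗ m` with matching idempotents. -/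
def box (X : TypeDSeq.{u} (Fin 2 × Fin 2) KK) (M : DAOperations) : TypeDSeq.{u} (Fin 2) K where
  gen := {p : X.gen × M.gen // X.idem p.1 = M.left p.2}
  idem p := M.right p.1.2
  δ n p := ∑ j ∈ Finset.range (M.maxInputs + 1),
    iterSum (X.δ n)
      (fun y as => (M.op as p.1.2).sum fun m a =>
        if h : X.idem y = M.left m then Finsupp.single ⟨(y, m), h⟩ a else 0)
      j [] p.1.1

/-! ### The merge bimodule and the pair-of-pants bimodules -/

/-- The linear map `a ⊗ b ↦ φ a * ψ b`. -/
def tensorMul {R : Type} [CommRing R] [Algebra (ZMod 2) R] (φ ψ : K →ₗ[ZMod 2] R) :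
    KK →ₗ[ZMod 2] R :=
  LinearMap.mul' (ZMod 2) R ∘ₗ TensorProduct.map φ ψ

/-- `a ⊗ b ↦ a * b` on `I₀ 𝒦 I₀ ⊗ I₀ 𝒦 I₀`. -/
def prod0 : KK →ₗ[ZMod 2] R0 := tensorMul K.projF K.projF

/-- `a ⊗ b ↦ a * b` on `I₁ 𝒦 I₁ ⊗ I₁ 𝒦 I₁`. -/
def prod1 : KK →ₗ[ZMod 2] R1 := tensorMul K.projG K.projG

/-- The coefficient of `σ` in `δ_3^1(x, y, i₀)`. It is
`(a σ | b, c | d σ) ↦ a * b * I c * d`, the extension of `(σ | 1, 1 | σ) ↦ 1` forced by the structure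
relations, and zero on inputs in other idempotents. -/
def sigmaPair (x y : KK) : R1 :=
  tensorMul K.projS K.projG x * tensorMul (mapI.toLinearMap ∘ₗ K.projF) K.projS y

/-- The coefficient of `τ` in `δ_3^1(x, y, i₀)`. It is
`(a τ | b, c | d τ) ↦ a * b * T c * d`, the extension of `(τ | 1, 1 | τ) ↦ 1` forced by the structure
relations, and zero on inputs in other idempotents. -/
def tauPair (x y : KK) : R1 :=
  tensorMul K.projT K.projG x * tensorMul (mapT.toLinearMap ∘ₗ K.projF) K.projT y

/-- The same with the two tensor factors exchanged: `(a | b τ, c τ | d) ↦ a * b * c * T d`, the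
extension of `(1 | τ, τ | 1) ↦ 1`. -/
def tauPairSwap (x y : KK) : R1 :=
  tensorMul K.projG K.projT x * tensorMul K.projT (mapT.toLinearMap ∘ₗ K.projF) y

/-- `a' ⊗ b' ↦ a' * (U ∂_U + V ∂_V) b'`. -/
def eulerRight : KK →ₗ[ZMod 2] R1 := tensorMul K.projG (opEuler ∘ₗ K.projG)

/-- `a' ⊗ b' ↦ (U ∂_U + V ∂_V) a' * b'`. -/
def eulerLeft : KK →ₗ[ZMod 2] R1 := tensorMul (opEuler ∘ₗ K.projG) K.projG

/-- The operations `δ_2^1` and `δ_3^1` of the merge bimodule. -/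
def mergeOp : List KK → Fin 2 → Fin 2 →₀ K
  | [x], m => if m = 0 then Finsupp.single 0 ⟨prod0 x, 0, 0, 0⟩
      else Finsupp.single 1 ⟨0, prod1 x, 0, 0⟩
  | [x, y], m => if m = 0 then Finsupp.single 1 ⟨0, 0, sigmaPair x y, tauPair x y⟩ else 0
  | _, _ => 0

/-- The operation `δ_5^1` of `W_r`:
`(a | b, a' | b', 1 | τ, τ | 1, i₀) ↦ i₁ ⊗ V⁻¹ ∂_U (a b) * a' * (U ∂_U + V ∂_V) b' * τ`. -/
def pantsOpR : List KK → Fin 2 → Fin 2 →₀ K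
  | [x, y, z, w], m => if m = 0 then
      Finsupp.single 1 ⟨0, 0, 0, opVinvPartialU (prod1 x) * eulerRight y * tauPairSwap z w⟩ else 0
  | _, _ => 0

/-- The operation `δ_5^1` of `W_l`:
`(a | b, a' | b', τ | 1, 1 | τ, i₀) ↦ i₁ ⊗ V⁻¹ ∂_U (a b) * (U ∂_U + V ∂_V) a' * b' * τ`. -/
def pantsOpL : List KK → Fin 2 → Fin 2 →₀ K
  | [x, y, z, w], m => if m = 0 then
      Finsupp.single 1 ⟨0, 0, 0, opVinvPartialU (prod1 x) * eulerLeft y * tauPair z w⟩ else 0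
  | _, _ => 0

theorem mergeOp_eq_zero (as : List KK) (m : Fin 2) (h : 2 < as.length) : mergeOp as m = 0 := by
  match as, h with
  | _ :: _ :: _ :: _, _ => rfl

theorem pantsOpR_eq_zero (as : List KK) (m : Fin 2) (h : 4 < as.length) : pantsOpR as m = 0 := by
  match as, h with
  | _ :: _ :: _ :: _ :: _ :: _, _ => rfl

theorem pantsOpL_eq_zero (as : List KK) (m : Fin 2) (h : 4 < as.length) : pantsOpL as m = 0 := by
  match as, h with
  | _ :: _ :: _ :: _ :: _ :: _, _ => rfl

/-- The merge bimodule `M₂`, with generators `i₀`, `i₁`. -/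
def mergeM2 : DAOperations where
  gen := Fin 2
  left m := (m, m)
  right m := m
  op := mergeOp
  maxInputs := 2
  op_eq_zero := mergeOp_eq_zero

/-- The pair-of-pants bimodule `W_r`. -/
def pantsWr : DAOperations where
  gen := Fin 2
  left m := (m, m)
  right m := m
  op as m := mergeOp as m + pantsOpR as m
  maxInputs := 4
  op_eq_zero as m h := by
    rw [mergeOp_eq_zero as m (by omega), pantsOpR_eq_zero as m h, add_zero]

/-- The pair-of-pants bimodule `W_l`. -/
def pantsWl : DAOperations where
  gen := Fin 2
  left m := (m, m)
  right m := m
  op as m := mergeOp as m + pantsOpL as m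
  maxInputs := 4
  op_eq_zero as m h := by
    rw [mergeOp_eq_zero as m (by omega), pantsOpL_eq_zero as m h, add_zero]

end KnotSurgery

end

noncomputable section

namespace KnotSurgery

/-! ### Column-finite matrices -/

section Matrices

variable {α β γ ε : Type*}

/-! Split by idempotents, a structure map over `K` consists of four matrices: F with entries in
I₀𝒦I₀, G with entries in I₁𝒦I₁, and the coefficient matrices S of σ and T of τ. The condition δ² ~ 0
says that F², G², GS + S·I(F) and GT + T·T(F) tend to zero, each in its own topology. For the tensor
product, F = F₁⊗1 + 1⊗F₂, G = G₁⊗1 + 1⊗G₂, S = S₁⊗S₂ and T = T₁⊗T₂, restricted to pairs of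
generators in equal idempotents. The three box tensor products share F, G, S. With D = V⁻¹∂_U and E
= U∂_U + V∂_V, the bimodule W_r only adds D(G)·Y to T, where Y = T₁ ⊗ E(G₂)T₂, and W_l does the same
with the factors exchanged (`box_mergeM2`, `box_pantsWr`, `box_pantsWl`).

Write [a] = Ga + a·T(F). Applying the derivation D to G² ~ 0 shows that D(G) commutes with G up to a
null sequence, so [D(G)a] ~ D(G)[a]. If [Θ] ~ Y, then η = D(G)Θ satisfies [η] ~ D(G)Y, so 1 + ητ is
a chain map between the two modules. In characteristic two it is its own inverse (`cmul_shear`,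
`shear_cmul_shear`, `homotopyEquivalent_shear`). By the Leibniz rule for Kronecker products one may
take Θ = T₁⊗θ, once a θ with [θ] ~ E(G₂)T₂ is known (`exists_theta`).

This θ is where homotopy finiteness enters. For a finite basis, embed 𝔽₂[U,V,V⁻¹] in 𝔽₂((B))[[U]] by
UⁱVʲ ↦ UⁱB²ⁱ⁻ʲ. The target is a power series ring over a field, and E multiplies UⁱBˡ by i + l, so E
does not lower the order in U and x ∣ E(x) for every x. Smith normal form then yields a connection
commuting with the limit differential, hence a matrix h with E(G) = [G, h]
(`exists_connection_comm`, `exists_commutator_eq_map`). The entries of h are Laurent series in B,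
which are approximated by elements of 𝔽₂[U,V,V⁻¹] only in the weak topology of the coefficients of
τ. This is why E(G)T is contracted, and not E(G) itself.

For general X, a homotopy equivalence Φ, Ψ with a finite module with differential H, and ΨΦ ~ 1 +
[G, k], transports h to θ = ΨhΦT + E(Ψ)ΦT + E(G)kT. The second term corrects the difference between
ΨE(H) and E(G)Ψ, the third the difference between ΨΦ and 1 (`com_theta`). -/

/-- The action of a column-finite matrix on a column vector. -/
def act {A : Type*} [NonUnitalNonAssocSemiring A] (ψ : β → γ →₀ A) (v : β →₀ A) : γ →₀ A :=
  v.sum fun y a => (ψ y).mapRange (fun b => b * a) (zero_mul a)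

/-- The product of column-finite matrices. -/
def cmul {A : Type*} [NonUnitalNonAssocSemiring A] (ψ : β → γ →₀ A) (φ : α → β →₀ A) :
    α → γ →₀ A := fun x => act ψ (φ x)

/-- Entrywise application of an additive map. -/
def mmap {A B : Type*} [AddZeroClass A] [AddZeroClass B] (f : A →+ B) (φ : α → β →₀ A) :
    α → β →₀ B := fun x => (φ x).mapRange f f.map_zero

/-- A diagonal matrix. -/
def diag {A : Type*} [Zero A] (d : α → A) : α → α →₀ A := fun x => Finsupp.single x (d x)

@[simp] theorem mmap_apply {A B : Type*} [AddZeroClass A] [AddZeroClass B] (f : A →+ B)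
    (φ : α → β →₀ A) (x : α) (y : β) : mmap f φ x y = f (φ x y) := rfl

section Semi

variable {A : Type*} [NonUnitalNonAssocSemiring A]

theorem act_apply (ψ : β → γ →₀ A) (v : β →₀ A) (z : γ) :
    act ψ v z = v.sum fun y a => ψ y z * a := by
  simp [act, Finsupp.sum_apply]

theorem act_apply_of_subset (ψ : β → γ →₀ A) (v : β →₀ A) (z : γ) {s : Finset β}
    (hs : v.support ⊆ s) : act ψ v z = ∑ y ∈ s, ψ y z * v y := by
  rw [act_apply, Finsupp.sum_of_support_subset v hs]
  simp

theorem act_single (ψ : β → γ →₀ A) (y : β) (a : A) :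
    act ψ (Finsupp.single y a) = (ψ y).mapRange (fun b => b * a) (zero_mul a) := by
  ext z
  simp [act_apply]

@[simp] theorem act_zero (ψ : β → γ →₀ A) : act ψ 0 = 0 := by simp [act]

theorem act_add (ψ : β → γ →₀ A) (v w : β →₀ A) : act ψ (v + w) = act ψ v + act ψ w := by
  ext z
  simp only [act_apply, Finsupp.add_apply]
  exact Finsupp.sum_add_index' (by simp) (by simp [mul_add])

theorem add_act (ψ ψ' : β → γ →₀ A) (v : β →₀ A) : act (ψ + ψ') v = act ψ v + act ψ' v := by
  ext z
  simp [act_apply, add_mul, Finsupp.sum_add]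

theorem cmul_apply (ψ : β → γ →₀ A) (φ : α → β →₀ A) (x : α) (z : γ) :
    cmul ψ φ x z = (φ x).sum fun y a => ψ y z * a := act_apply ..

theorem cmul_add (ψ : β → γ →₀ A) (φ φ' : α → β →₀ A) :
    cmul ψ (φ + φ') = cmul ψ φ + cmul ψ φ' := by
  funext x; exact act_add ..

theorem add_cmul (ψ ψ' : β → γ →₀ A) (φ : α → β →₀ A) :
    cmul (ψ + ψ') φ = cmul ψ φ + cmul ψ' φ := by
  funext x; exact add_act ..

@[simp] theorem cmul_zero (ψ : β → γ →₀ A) : cmul ψ (0 : α → β →₀ A) = 0 := by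
  funext x; exact act_zero ψ

@[simp] theorem zero_cmul (φ : α → β →₀ A) : cmul (0 : β → γ →₀ A) φ = 0 := by
  funext x; ext z; simp [cmul_apply]

theorem cmul_diag (ψ : α → γ →₀ A) (d : α → A) (x : α) (z : γ) :
    cmul ψ (diag d) x z = ψ x z * d x := by
  simp [cmul_apply, diag]

theorem diag_cmul (d : β → A) (φ : α → β →₀ A) (x : α) (z : β) :
    cmul (diag d) φ x z = d z * φ x z := by
  classical
  change act (diag d) (φ x) z = _
  rw [act_apply_of_subset _ _ _ (s := insert z (φ x).support) (by simp)]
  rw [Finset.sum_eq_single z]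
  · simp [diag]
  · intro y _ hy; simp [diag, hy]
  · simp

end Semi

theorem act_act {A : Type*} [NonUnitalSemiring A] (χ : γ → ε →₀ A) (ψ : β → γ →₀ A)
    (v : β →₀ A) : act χ (act ψ v) = act (cmul χ ψ) v := by
  induction v using Finsupp.induction_linear with
  | zero => simp
  | add v w hv hw => simp [act_add, hv, hw]
  | single y a =>
    rw [act_single, act_single]
    change _ = (act χ (ψ y)).mapRange _ _
    induction ψ y using Finsupp.induction_linear with
    | zero => simp
    | add v w hv hw =>
      rw [Finsupp.mapRange_add (by simp [add_mul]), act_add, act_add, hv, hw,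
        Finsupp.mapRange_add (by simp [add_mul])]
    | single z b =>
      ext t
      rw [Finsupp.mapRange_single, act_single, act_single]
      simp

theorem cmul_assoc {A : Type*} [NonUnitalSemiring A] (χ : γ → ε →₀ A) (ψ : β → γ →₀ A)
    (φ : α → β →₀ A) : cmul (cmul χ ψ) φ = cmul χ (cmul ψ φ) := by
  funext x; exact (act_act ..).symm

section Map

variable {A B : Type*}

theorem mmap_cmul [NonAssocSemiring A] [NonAssocSemiring B] (f : A →+ B)
    (hf : ∀ a b, f (a * b) = f a * f b) (ψ : β → γ →₀ A) (φ : α → β →₀ A) :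
    mmap f (cmul ψ φ) = cmul (mmap f ψ) (mmap f φ) := by
  funext x; ext z
  change f (act ψ (φ x) z) = act (mmap f ψ) (mmap f φ x) z
  rw [act_apply_of_subset _ _ _ (subset_refl _),
    act_apply_of_subset _ (mmap f φ x) _ (s := (φ x).support) Finsupp.support_mapRange]
  simp [hf]

/-- Used for E and D: it allows relations such as G² ~ 0 to be differentiated as matrix identities.
-/
theorem mmap_cmul_deriv [NonAssocSemiring A] (d : A →+ A)
    (hd : ∀ a b, d (a * b) = d a * b + a * d b) (ψ : β → γ →₀ A) (φ : α → β →₀ A) :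
    mmap d (cmul ψ φ) = cmul (mmap d ψ) φ + cmul ψ (mmap d φ) := by
  funext x; ext z
  change d (act ψ (φ x) z) = act (mmap d ψ) (φ x) z + act ψ (mmap d φ x) z
  rw [act_apply_of_subset ψ (φ x) z (subset_refl _),
    act_apply_of_subset (mmap d ψ) (φ x) z (subset_refl _),
    act_apply_of_subset _ (mmap d φ x) _ (s := (φ x).support) Finsupp.support_mapRange]
  simp [hd, Finset.sum_add_distrib]

theorem mmap_add [AddZeroClass A] [AddCommMonoid B] (f : A →+ B) (φ ψ : α → β →₀ A) :
    mmap f (φ + ψ) = mmap f φ + mmap f ψ := by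
  funext x; ext y; simp

theorem mmap_diag [AddCommMonoid A] [AddCommMonoid B] (f : A →+ B) (d : α → A) :
    mmap f (diag d) = diag (fun x => f (d x)) := by
  funext x; simp [diag, mmap]

end Map

/-- The commutator in characteristic two. -/
def com {A : Type*} [NonUnitalNonAssocSemiring A] (G : β → β →₀ A) (F : α → α →₀ A)
    (a : α → β →₀ A) : α → β →₀ A := cmul G a + cmul a F

theorem com_add {A : Type*} [NonUnitalNonAssocSemiring A] (G : β → β →₀ A) (F : α → α →₀ A)
    (a b : α → β →₀ A) : com G F (a + b) = com G F a + com G F b := by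
  simp only [com, cmul_add, add_cmul]; abel

theorem add_self_matrix {A : Type*} [Semiring A] [CharP A 2] (a : α → β →₀ A) : a + a = 0 := by
  funext x; ext y; exact CharTwo.add_self_eq_zero _

/-- The Leibniz rule: the inner differential `H` contributes the term `a H b` twice, and the two
copies cancel in characteristic two. -/
theorem com_cmul {A : Type*} [Semiring A] [CharP A 2] (G : γ → γ →₀ A) (H : β → β →₀ A)
    (F : α → α →₀ A) (a : β → γ →₀ A) (b : α → β →₀ A) :
    com G F (cmul a b) = cmul (com G H a) b + cmul a (com H F b) := by
  simp only [com, cmul_add, add_cmul, cmul_assoc]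
  have := add_self_matrix (cmul a (cmul H b))
  calc _ = cmul G (cmul a b) + (cmul a (cmul H b) + cmul a (cmul H b)) + cmul a (cmul b F) := by
        rw [this, add_zero]
    _ = _ := by abel

/-! ### Kronecker products -/

section Tens

variable {α' β' γ' : Type*} {R : Type*} [CommSemiring R]

/-- The Kronecker product of column vectors. -/
def vtens (v : β →₀ R) (w : β' →₀ R) : β × β' →₀ R :=
  finsuppTensorFinsupp' R β β' (v ⊗ₜ[R] w)

/-- The Kronecker product of column-finite matrices. -/
def tens (φ : α → β →₀ R) (ψ : α' → β' →₀ R) : α × α' → β × β' →₀ R := fun p =>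
  vtens (φ p.1) (ψ p.2)

@[simp] theorem vtens_apply (v : β →₀ R) (w : β' →₀ R) (q : β × β') :
    vtens v w q = v q.1 * w q.2 := by
  obtain ⟨a, b⟩ := q
  exact finsuppTensorFinsupp'_apply_apply ..

@[simp] theorem tens_apply (φ : α → β →₀ R) (ψ : α' → β' →₀ R) (p : α × α') (q : β × β') :
    tens φ ψ p q = φ p.1 q.1 * ψ p.2 q.2 := vtens_apply ..

theorem vtens_add (v : β →₀ R) (w w' : β' →₀ R) : vtens v (w + w') = vtens v w + vtens v w' := by
  ext q; simp [mul_add]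

theorem add_vtens (v v' : β →₀ R) (w : β' →₀ R) : vtens (v + v') w = vtens v w + vtens v' w := by
  ext q; simp [add_mul]

theorem tens_add (φ : α → β →₀ R) (ψ ψ' : α' → β' →₀ R) :
    tens φ (ψ + ψ') = tens φ ψ + tens φ ψ' := by
  funext p; ext q; simp [mul_add]

theorem add_tens (φ φ' : α → β →₀ R) (ψ : α' → β' →₀ R) :
    tens (φ + φ') ψ = tens φ ψ + tens φ' ψ := by
  funext p; ext q; simp [add_mul]

/-- Both sides are additive in each vector, so basis vectors suffice; there the identity is
commutativity of the coefficients. -/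
theorem act_tens (φ : β → γ →₀ R) (ψ : β' → γ' →₀ R) (v : β →₀ R) (w : β' →₀ R) :
    act (tens φ ψ) (vtens v w) = vtens (act φ v) (act ψ w) := by
  induction v using Finsupp.induction_linear with
  | zero => ext; simp [vtens]
  | add v v' hv hv' => simp only [add_vtens, act_add, hv, hv']
  | single y a =>
    induction w using Finsupp.induction_linear with
    | zero => ext; simp [vtens]
    | add w w' hw hw' => simp only [vtens_add, act_add, hw, hw']
    | single y' a' =>
      have : vtens (Finsupp.single y a) (Finsupp.single y' a') =
          Finsupp.single (y, y') (a * a') := finsuppTensorFinsupp'_single_tmul_single ..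
      rw [this]
      ext q
      rw [act_single, act_single, act_single, vtens_apply]
      simp only [Finsupp.mapRange_apply, tens_apply]
      ring

theorem cmul_tens (φ : β → γ →₀ R) (ψ : β' → γ' →₀ R) (φ' : α → β →₀ R) (ψ' : α' → β' →₀ R) :
    cmul (tens φ ψ) (tens φ' ψ') = tens (cmul φ φ') (cmul ψ ψ') := by
  funext p; exact act_tens ..

theorem mmap_tens {R' : Type*} [CommSemiring R'] (f : R →+ R') (hf : ∀ a b, f (a * b) = f a * f b)
    (φ : α → β →₀ R) (ψ : α' → β' →₀ R) :
    mmap f (tens φ ψ) = tens (mmap f φ) (mmap f ψ) := by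
  funext p; ext q; simp [hf]

end Tens

/-! ### Restriction to a subset of the indices -/

/-- The submatrix on the indices in the image of an injective map. -/
def res {A : Type*} [Zero A] (π : α ↪ β) (φ : β → β →₀ A) : α → α →₀ A := fun p =>
  (φ (π p)).comapDomain π π.injective.injOn

@[simp] theorem res_apply {A : Type*} [Zero A] (π : α ↪ β) (φ : β → β →₀ A) (p q : α) :
    res π φ p q = φ (π p) (π q) := rfl

/-- The sum over intermediate indices loses nothing under restriction, since `φ` maps an index of
the subset only to indices of the subset. -/
theorem cmul_res {A : Type*} [NonUnitalNonAssocSemiring A] (π : α ↪ β) (ψ φ : β → β →₀ A)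
    (h : ∀ p y, φ (π p) y ≠ 0 → y ∈ Set.range π) :
    cmul (res π ψ) (res π φ) = res π (cmul ψ φ) := by
  classical
  funext p; ext q
  change act (res π ψ) (res π φ p) q = act ψ (φ (π p)) (π q)
  rw [act_apply_of_subset _ _ _ (subset_refl _),
    act_apply_of_subset ψ _ _ (s := (res π φ p).support.map π)]
  · simp
  · intro y hy
    obtain ⟨r, rfl⟩ := h p y (by simpa using hy)
    simpa using hy

theorem mmap_res {A B : Type*} [AddZeroClass A] [AddZeroClass B] (f : A →+ B) (π : α ↪ β)
    (φ : β → β →₀ A) : mmap f (res π φ) = res π (mmap f φ) := by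
  funext p; ext q; simp

theorem res_add {A : Type*} [AddZeroClass A] (π : α ↪ β) (φ ψ : β → β →₀ A) :
    res π (φ + ψ) = res π φ + res π ψ := by
  funext p; ext q; simp

end Matrices

/-! ### Cauchy sequences of continuous matrices -/

section Topology

variable {α β γ ι : Type*} {A : Type*} [Ring A]

/-- A uniformly Cauchy sequence of continuous matrices, for the linear topology given by the
neighbourhoods `J m` of zero in the coefficients. -/
structure Good (J : ℕ → AddSubgroup A) (φ : ℕ → α → β →₀ A) : Prop where
  finite : ∀ n y m, {x | φ n x y ∉ J m}.Finite
  cauchy : ∀ y m, ∃ N, ∀ n ≥ N, ∀ n' ≥ N, ∀ x, φ n x y - φ n' x y ∈ J m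

/-- A sequence of matrices tending to zero uniformly. -/
def Null (J : ℕ → AddSubgroup A) (φ : ℕ → α → β →₀ A) : Prop :=
  ∀ y m, ∃ N, ∀ n ≥ N, ∀ x, φ n x y ∈ J m

variable {J JA JB JC : ℕ → AddSubgroup A}

theorem Null.zero : Null J (0 : ℕ → α → β →₀ A) := fun _ m => ⟨0, fun _ _ _ => (J m).zero_mem⟩

theorem Null.add {φ ψ : ℕ → α → β →₀ A} (h : Null J φ) (h' : Null J ψ) : Null J (φ + ψ) := by
  intro y m
  obtain ⟨N, hN⟩ := h y m
  obtain ⟨N', hN'⟩ := h' y m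
  exact ⟨max N N', fun n hn x =>
    (J m).add_mem (hN n (le_of_max_le_left hn) x) (hN' n (le_of_max_le_right hn) x)⟩

theorem Good.add {φ ψ : ℕ → α → β →₀ A} (h : Good J φ) (h' : Good J ψ) : Good J (φ + ψ) := by
  refine ⟨fun n y m => ((h.finite n y m).union (h'.finite n y m)).subset fun x hx => ?_, ?_⟩
  · by_contra hc
    simp only [Set.mem_union, Set.mem_ofPred_eq, not_or, not_not] at hc
    exact hx ((J m).add_mem hc.1 hc.2)
  · intro y m
    obtain ⟨N, hN⟩ := h.cauchy y m
    obtain ⟨N', hN'⟩ := h'.cauchy y m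
    refine ⟨max N N', fun n hn n' hn' x => ?_⟩
    have := (J m).add_mem (hN n (le_of_max_le_left hn) n' (le_of_max_le_left hn') x)
      (hN' n (le_of_max_le_right hn) n' (le_of_max_le_right hn') x)
    simpa [add_sub_add_comm] using this

theorem Good.zero : Good J (0 : ℕ → α → β →₀ A) :=
  ⟨fun n y m => by simp [(J m).zero_mem], fun y m => ⟨0, by simp [(J m).zero_mem]⟩⟩

theorem Good.map {B : Type*} [Ring B] {JB : ℕ → AddSubgroup B} (f : A →+ B)
    (hf : ∀ m, ∃ k, ∀ a ∈ J k, f a ∈ JB m) {φ : ℕ → α → β →₀ A} (h : Good J φ) :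
    Good JB (fun n => mmap f (φ n)) := by
  refine ⟨fun n y m => ?_, fun y m => ?_⟩ <;> obtain ⟨k, hk⟩ := hf m
  · exact (h.finite n y k).subset fun x hx hx' => hx (hk _ hx')
  · refine (h.cauchy y k).imp fun N hN n hn n' hn' x => ?_
    simpa using hk _ (hN n hn n' hn' x)

theorem Null.map {B : Type*} [Ring B] {JB : ℕ → AddSubgroup B} (f : A →+ B)
    (hf : ∀ m, ∃ k, ∀ a ∈ J k, f a ∈ JB m) {φ : ℕ → α → β →₀ A} (h : Null J φ) :
    Null JB (fun n => mmap f (φ n)) := by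
  intro y m
  obtain ⟨k, hk⟩ := hf m
  exact (h y k).imp fun N hN n hn x => hk _ (hN n hn x)

theorem Good.diag (d : α → A) : Good J (fun _ => diag d) := by
  classical
  refine ⟨fun n y m => (Set.finite_singleton y).subset fun x hx => ?_, fun y m => ⟨0, ?_⟩⟩
  · by_contra hne
    exact hx (by simp [KnotSurgery.diag,
      show x ≠ y from hne, (J m).zero_mem])
  · simp [(J m).zero_mem]

/-- Compatibility of three filtrations with the product: the coefficients `JA` of the left factor
are absorbed by the coefficients `B` of the right factor, and the multiplication from the left by
a fixed element is continuous. -/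
structure Compat (JA : ℕ → AddSubgroup A) (B : AddSubgroup A) (JB JC : ℕ → AddSubgroup A) :
    Prop where
  anti : Antitone JB
  left : ∀ m, ∀ a ∈ JA m, ∀ b ∈ B, a * b ∈ JC m
  right : ∀ (a : A) (m : ℕ), ∃ k, ∀ b ∈ JB k, a * b ∈ JC m

theorem act_mem {ψ : β → γ →₀ A} {v : β →₀ A} {z : γ} {H : AddSubgroup A}
    (h : ∀ y, ψ y z * v y ∈ H) : act ψ v z ∈ H := by
  rw [act_apply]
  exact H.sum_mem fun y _ => h y

/-- Only finitely many left factors matter, so the largest of their moduli of continuity serves all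
of them. -/
theorem exists_forall_mul_mem {f : β → A} {B : AddSubgroup A}
    (hc : Compat JA B JB JC) {m : ℕ} (hf : {y | f y ∉ JA m}.Finite) :
    ∃ k, ∀ y ∈ {y | f y ∉ JA m}, ∀ b ∈ JB k, f y * b ∈ JC m := by
  choose k hk using fun y => hc.right (f y) m
  obtain ⟨K, hK⟩ := (hf.image k).bddAbove
  exact ⟨K, fun y hy b hb => hk y b (hc.anti (hK ⟨y, hy, rfl⟩) hb)⟩

theorem Null.cmul_left {B : AddSubgroup A} (hc : Compat JA B JB JC) {ψ : ℕ → β → γ →₀ A}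
    {φ : ℕ → α → β →₀ A} (hψ : Null JA ψ) (hB : ∀ n x y, φ n x y ∈ B) :
    Null JC (fun n => cmul (ψ n) (φ n)) := fun z m =>
  (hψ z m).imp fun _ hN n hn x => act_mem fun y => hc.left m _ (hN n hn y) _ (hB n x y)

/-- A convergent sequence of matrices is equicontinuous. -/
theorem Good.exists_forall_act_mem {B : AddSubgroup A} (hc : Compat JA B JB JC)
    {ψ : ℕ → β → γ →₀ A} (hψ : Good JA ψ) (z : γ) (m : ℕ) :
    ∃ (N : ℕ) (F : Set β) (k : ℕ), F.Finite ∧ ∀ n ≥ N, ∀ v : β →₀ A, (∀ y, v y ∈ B) →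
      (∀ y ∈ F, v y ∈ JB k) → act (ψ n) v z ∈ JC m := by
  obtain ⟨N, hN⟩ := hψ.cauchy z m
  obtain ⟨k, hk⟩ := exists_forall_mul_mem hc (hψ.finite N z m)
  refine ⟨N, _, k, hψ.finite N z m, fun n hn v hv hvF => act_mem fun y => ?_⟩
  have h1 := hc.left m _ (hN n hn N le_rfl y) _ (hv y)
  have h2 : ψ N y z * v y ∈ JC m := by
    by_cases hy : ψ N y z ∈ JA m
    · exact hc.left m _ hy _ (hv y)
    · exact hk y hy _ (hvF y hy)
  simpa [sub_mul] using (JC m).add_mem h1 h2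

/-- By equicontinuity of `ψ`, only finitely many rows of `φ n` have to be small, and these become
small simultaneously. -/
theorem Good.cmul_null {B : AddSubgroup A} (hc : Compat JA B JB JC) {ψ : ℕ → β → γ →₀ A}
    {φ : ℕ → α → β →₀ A} (hψ : Good JA ψ) (hφ : Null JB φ) (hB : ∀ n x y, φ n x y ∈ B) :
    Null JC (fun n => cmul (ψ n) (φ n)) := by
  intro z m
  obtain ⟨N, F, k, hF, h⟩ := hψ.exists_forall_act_mem hc z m
  choose N' hN' using fun y => hφ y k
  obtain ⟨M, hM⟩ := (hF.image N').bddAbove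
  exact ⟨max N M, fun n hn x => h n (le_of_max_le_left hn) _ (hB n x) fun y hy =>
    hN' y n ((hM ⟨y, hy, rfl⟩).trans (le_of_max_le_right hn)) x⟩

theorem act_sub (ψ : β → γ →₀ A) (v w : β →₀ A) : act ψ (v - w) = act ψ v - act ψ w := by
  rw [eq_sub_iff_add_eq, ← act_add, sub_add_cancel]

/-- The Cauchy condition comes from ψφ − ψ'φ' = (ψ − ψ')φ + ψ'(φ − φ'): the first term is absorbed
on the left, the second is controlled by equicontinuity of `ψ`. -/
theorem Good.cmul {B : AddSubgroup A} (hc : Compat JA B JB JC) {ψ : ℕ → β → γ →₀ A}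
    {φ : ℕ → α → β →₀ A} (hψ : Good JA ψ) (hφ : Good JB φ) (hB : ∀ n x y, φ n x y ∈ B) :
    Good JC (fun n => cmul (ψ n) (φ n)) := by
  refine ⟨fun n z m => ?_, fun z m => ?_⟩
  · have hF := hψ.finite n z m
    obtain ⟨k, hk⟩ := exists_forall_mul_mem hc hF
    refine (hF.biUnion fun y _ => hφ.finite n y k).subset fun x hx => ?_
    by_contra hcon
    simp only [Set.mem_iUnion, Set.mem_ofPred_eq, not_exists, not_not] at hcon
    refine hx (act_mem fun y => ?_)
    by_cases hy : ψ n y z ∈ JA m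
    · exact hc.left m _ hy _ (hB n x y)
    · exact hk y hy _ (hcon y hy)
  · obtain ⟨N, F, k, hF, h⟩ := hψ.exists_forall_act_mem hc z m
    obtain ⟨N₁, hN₁⟩ := hψ.cauchy z m
    choose N' hN' using fun y => hφ.cauchy y k
    obtain ⟨M, hM⟩ := (hF.image N').bddAbove
    refine ⟨max (max N N₁) M, fun n hn n' hn' x => ?_⟩
    simp only [ge_iff_le, max_le_iff] at hn hn'
    have h1 : act (ψ n) (φ n x) z - act (ψ n') (φ n x) z ∈ JC m := by
      rw [act_apply, act_apply, ← Finsupp.sum_sub]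
      refine (JC m).sum_mem fun y _ => ?_
      change ψ n y z * φ n x y - ψ n' y z * φ n x y ∈ JC m
      rw [← sub_mul]
      exact hc.left m _ (hN₁ n hn.1.2 n' hn'.1.2 y) _ (hB n x y)
    have h2 : act (ψ n') (φ n x - φ n' x) z ∈ JC m :=
      h n' hn'.1.1 _ (fun y => B.sub_mem (hB n x y) (hB n' x y)) fun y hy =>
        hN' y n ((hM ⟨y, hy, rfl⟩).trans hn.2) n' ((hM ⟨y, hy, rfl⟩).trans hn'.2) x
    have := (JC m).add_mem h1 h2
    rw [act_sub] at this
    simpa [KnotSurgery.cmul] using this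

end Topology

/-! ### Cauchy sequences of Kronecker products. -/

section Tensor

variable {α β α' β' γ : Type*} {R : Type*} [CommRing R]

/-- A filtration of a commutative ring whose terms are closed under products, and for which
multiplication by a fixed element is continuous. -/
structure IsFiltration (J : ℕ → AddSubgroup R) : Prop where
  anti : Antitone J
  mul_mem : ∀ m, ∀ a ∈ J m, ∀ b ∈ J m, a * b ∈ J m
  continuous : ∀ (a : R) (m : ℕ), ∃ k, ∀ b ∈ J k, a * b ∈ J m

variable {J : ℕ → AddSubgroup R}

/-- Outside a finite set `f x` already lies in `J m`, which is closed under products; on the finite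
set continuity of multiplication gives a common `k`. Changing `f x` by an element of `J m` is
harmless for the same reason. -/
theorem IsFiltration.exists_mul_mem (hJ : IsFiltration J) {f : α → R} {m : ℕ}
    (hf : {x | f x ∉ J m}.Finite) :
    ∃ k, m ≤ k ∧ ∀ g : R, ∀ x, g - f x ∈ J m → ∀ a ∈ J k, a * g ∈ J m := by
  choose k hk using fun x => hJ.continuous (f x) m
  obtain ⟨K, hK⟩ := (hf.image k).bddAbove
  refine ⟨max m K, le_max_left _ _, fun g x hg a ha => ?_⟩
  have ham : a ∈ J m := hJ.anti (le_max_left _ _) ha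
  have h2 : a * f x ∈ J m := by
    by_cases hx : f x ∈ J m
    · exact hJ.mul_mem m _ ham _ hx
    · rw [mul_comm]
      exact hk x a (hJ.anti ((hK ⟨x, hx, rfl⟩).trans (le_max_right _ _)) ha)
  simpa [mul_sub] using (J m).add_mem (hJ.mul_mem m _ ham _ hg) h2

/-- A convergent sequence of matrices is bounded. -/
theorem Good.bounded (hJ : IsFiltration J) {φ : ℕ → α → β →₀ R} (hφ : Good J φ) (y : β) (m : ℕ) :
    ∃ N k, ∀ n ≥ N, ∀ x, ∀ a ∈ J k, a * φ n x y ∈ J m := by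
  obtain ⟨N, hN⟩ := hφ.cauchy y m
  obtain ⟨k, -, hk⟩ := hJ.exists_mul_mem (hφ.finite N y m)
  exact ⟨N, k, fun n hn x a ha => hk _ x (hN n hn N le_rfl x) a ha⟩

theorem Null.tens_good (hJ : IsFiltration J) {φ : ℕ → α → β →₀ R} {ψ : ℕ → α' → β' →₀ R}
    (hφ : Null J φ) (hψ : Good J ψ) : Null J (fun n => tens (φ n) (ψ n)) := by
  rintro ⟨y, y'⟩ m
  obtain ⟨N, k, h⟩ := hψ.bounded hJ y' m
  obtain ⟨N', hN'⟩ := hφ y k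
  exact ⟨max N N', fun n hn x => by
    simpa using h n (le_of_max_le_left hn) x.2 _ (hN' n (le_of_max_le_right hn) x.1)⟩

theorem Good.tens_null (hJ : IsFiltration J) {φ : ℕ → α → β →₀ R} {ψ : ℕ → α' → β' →₀ R}
    (hφ : Good J φ) (hψ : Null J ψ) : Null J (fun n => tens (φ n) (ψ n)) := by
  rintro ⟨y, y'⟩ m
  obtain ⟨N, hN⟩ := hψ.tens_good hJ hφ (y', y) m
  exact ⟨N, fun n hn x => by simpa [mul_comm] using hN n hn (x.2, x.1)⟩

/-- A product of entries can be large only if both entries are, which leaves a product of two finite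
sets. The Cauchy condition uses ab − a'b' = (a − a')b + a'(b − b') and the boundedness of both
sequences. -/
theorem Good.tens (hJ : IsFiltration J) {φ : ℕ → α → β →₀ R} {ψ : ℕ → α' → β' →₀ R}
    (hφ : Good J φ) (hψ : Good J ψ) : Good J (fun n => tens (φ n) (ψ n)) := by
  constructor
  · rintro n ⟨y, y'⟩ m
    obtain ⟨k, hmk, hk⟩ := hJ.exists_mul_mem (hψ.finite n y' m)
    obtain ⟨k', hmk', hk'⟩ := hJ.exists_mul_mem (hφ.finite n y m)
    refine ((hφ.finite n y k).prod (hψ.finite n y' k')).subset fun x hx => ?_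
    simp only [Set.mem_prod, Set.mem_ofPred_eq]
    constructor <;> intro hmem <;> apply hx <;> rw [tens_apply]
    · exact hk _ x.2 (by simp [(J m).zero_mem]) _ hmem
    · rw [mul_comm]
      exact hk' _ x.1 (by simp [(J m).zero_mem]) _ hmem
  · rintro ⟨y, y'⟩ m
    obtain ⟨N, k, h⟩ := hψ.bounded hJ y' m
    obtain ⟨N', k', h'⟩ := hφ.bounded hJ y m
    obtain ⟨M, hM⟩ := hφ.cauchy y k
    obtain ⟨M', hM'⟩ := hψ.cauchy y' k'
    refine ⟨max (max N N') (max M M'), fun n hn n' hn' x => ?_⟩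
    simp only [ge_iff_le, max_le_iff] at hn hn'
    have h1 := h n hn.1.1 x.2 _ (hM n hn.2.1 n' hn'.2.1 x.1)
    have h2 := h' n' hn'.1.2 x.1 _ (hM' n hn.2.2 n' hn'.2.2 x.2)
    simp only [tens_apply]
    convert (J m).add_mem h1 h2 using 1
    ring

/-- Over a finite intermediate index, a matrix product is a finite sum of entries of a Kronecker
product. Convergence of such products therefore needs only a filtration closed under products, with
no absorbing left factor. -/
theorem cmul_apply_eq_sum_tens [Fintype β] (ψ : β → γ →₀ R) (φ : α → β →₀ R) (x : α) (z : γ) :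
    cmul ψ φ x z = ∑ y, tens φ ψ (x, y) (y, z) := by
  change act ψ (φ x) z = _
  rw [act_apply_of_subset _ _ _ (Finset.subset_univ _)]
  simp [mul_comm]

theorem Null.cmul_of_tens [Finite β] {ψ : ℕ → β → γ →₀ R} {φ : ℕ → α → β →₀ R}
    (h : Null J (fun n => tens (φ n) (ψ n))) : Null J (fun n => cmul (ψ n) (φ n)) := by
  have := Fintype.ofFinite β
  intro z m
  choose N hN using fun y => h (y, z) m
  refine ⟨Finset.univ.sup N, fun n hn x => ?_⟩
  rw [cmul_apply_eq_sum_tens]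
  exact (J m).sum_mem fun y _ => hN y n ((Finset.le_sup (Finset.mem_univ y)).trans hn) (x, y)

theorem Good.cmul_of_tens [Finite β] {ψ : ℕ → β → γ →₀ R} {φ : ℕ → α → β →₀ R}
    (h : Good J (fun n => KnotSurgery.tens (φ n) (ψ n))) :
    Good J (fun n => KnotSurgery.cmul (ψ n) (φ n)) := by
  have := Fintype.ofFinite β
  refine ⟨fun n z m => ?_, fun z m => ?_⟩
  · refine (Set.finite_iUnion fun y => (h.finite n (y, z) m).image Prod.fst).subset fun x hx => ?_
    by_contra hcon
    simp only [Set.mem_iUnion, Set.mem_image, Set.mem_ofPred_eq, not_exists, not_and] at hcon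
    refine hx ?_
    change KnotSurgery.cmul (ψ n) (φ n) x z ∈ J m
    rw [cmul_apply_eq_sum_tens]
    refine (J m).sum_mem fun y _ => ?_
    by_contra hy
    exact hcon y (x, y) hy rfl
  · choose N hN using fun y => h.cauchy (y, z) m
    refine ⟨Finset.univ.sup N, fun n hn n' hn' x => ?_⟩
    simp only [cmul_apply_eq_sum_tens, ← Finset.sum_sub_distrib]
    exact (J m).sum_mem fun y _ => hN y n ((Finset.le_sup (Finset.mem_univ y)).trans hn) n'
      ((Finset.le_sup (Finset.mem_univ y)).trans hn') (x, y)

end Tensor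

/-! ### Restriction of Cauchy sequences to submatrices. -/

section Restriction

variable {α β : Type*} {A : Type*} [Ring A] {J : ℕ → AddSubgroup A}

theorem Null.res (π : α ↪ β) {φ : ℕ → β → β →₀ A} (h : Null J φ) :
    Null J (fun n => res π (φ n)) := fun y m =>
  (h (π y) m).imp fun _ hN n hn x => hN n hn (π x)

theorem Good.res (π : α ↪ β) {φ : ℕ → β → β →₀ A} (h : Good J φ) :
    Good J (fun n => res π (φ n)) :=
  ⟨fun n y m => (h.finite n (π y) m).preimage π.injective.injOn, fun y m =>
    (h.cauchy (π y) m).imp fun _ hN n hn n' hn' x => hN n hn n' hn' (π x)⟩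

end Restriction

/-! ### The filtrations of the polynomial rings -/

section Filtration

variable {ι κ : Type*}

/-- The elements all of whose exponents satisfy `P`. -/
def suppIn (P : ι → Prop) : AddSubgroup (AddMonoidAlgebra (ZMod 2) ι) where
  carrier := {a | ∀ p, ¬ P p → a.coeff p = 0}
  zero_mem' := by simp
  add_mem' ha hb p hp := by simp [ha p hp, hb p hp]
  neg_mem' ha p hp := by simp [ha p hp]

theorem mem_suppIn {P : ι → Prop} {a : AddMonoidAlgebra (ZMod 2) ι} :
    a ∈ suppIn P ↔ ∀ p, ¬ P p → a.coeff p = 0 := Iff.rfl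

/-- An element is the sum of its monomials, so an additive map may be tested on monomials with
exponents in `P`. -/
theorem mem_of_suppIn {M : Type*} [AddCommMonoid M] {P : ι → Prop}
    (f : AddMonoidAlgebra (ZMod 2) ι →+ M) (H : AddSubmonoid M)
    (h : ∀ p, P p → ∀ c, f (.single p c) ∈ H) {a : AddMonoidAlgebra (ZMod 2) ι}
    (ha : a ∈ suppIn P) : f a ∈ H := by
  rw [← AddMonoidAlgebra.sum_coeff_single a, Finsupp.sum, map_sum]
  refine H.sum_mem fun p hp => h p ?_ _
  by_contra hP
  exact Finsupp.mem_support_iff.1 hp (ha p hP)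

theorem single_mem_suppIn {P : ι → Prop} {p : ι} (hp : P p) (c : ZMod 2) :
    AddMonoidAlgebra.single p c ∈ suppIn P := by
  classical
  intro q hq
  rw [AddMonoidAlgebra.coeff_single, Finsupp.single_apply, if_neg]
  rintro rfl
  exact hq hp

theorem suppIn_mono {P Q : ι → Prop} (h : ∀ p, P p → Q p) : suppIn P ≤ suppIn Q :=
  fun _ ha p hp => ha p fun hP => hp (h p hP)

theorem mul_mem_suppIn [AddMonoid ι] {P Q W : ι → Prop} (h : ∀ p q, P p → Q q → W (p + q))
    {a b : AddMonoidAlgebra (ZMod 2) ι} (ha : a ∈ suppIn P) (hb : b ∈ suppIn Q) :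
    a * b ∈ suppIn W := by
  refine mem_of_suppIn (AddMonoidHom.mulRight b) (suppIn W).toAddSubmonoid (fun p hp c => ?_) ha
  refine mem_of_suppIn (AddMonoidHom.mulLeft (.single p c)) (suppIn W).toAddSubmonoid
    (fun q hq d => ?_) hb
  simpa [AddMonoidAlgebra.single_mul_single] using single_mem_suppIn (h p q hp hq) _

theorem exists_mem_suppIn_bounded (f : ι → ℕ) (a : AddMonoidAlgebra (ZMod 2) ι) :
    ∃ B, a ∈ suppIn fun p => f p ≤ B :=
  ⟨a.coeff.support.sup f, fun p hp => by
    by_contra h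
    exact hp (Finset.le_sup (Finsupp.mem_support_iff.2 h))⟩

/-- The fixed element `a` has finitely many monomials, so the size `f` of its exponents has a bound
`B`; multiplication by `a` can shift the filtration only by an amount depending on `B`. -/
theorem suppIn_continuous [AddMonoid ι] {P Q : ℕ → ι → Prop} (f : ι → ℕ)
    (h : ∀ B m, ∃ k, ∀ p q, f p ≤ B → P k q → Q m (p + q)) (a : AddMonoidAlgebra (ZMod 2) ι)
    (m : ℕ) : ∃ k, ∀ b ∈ suppIn (P k), a * b ∈ suppIn (Q m) := by
  obtain ⟨B, hB⟩ := exists_mem_suppIn_bounded f a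
  obtain ⟨k, hk⟩ := h B m
  exact ⟨k, fun b hb => mul_mem_suppIn hk hB hb⟩

/-- The filtration of `I₀ 𝒦 I₀`. -/
def filF (m : ℕ) : AddSubgroup R0 := suppIn fun p => m ≤ p.1 ∨ m ≤ p.2

/-- The filtration of `I₁ 𝒦 I₁`. -/
def filG (m : ℕ) : AddSubgroup R1 := suppIn fun p => m ≤ p.1

/-- The filtration of the coefficients of `σ`. -/
def filS (m : ℕ) : AddSubgroup R1 := suppIn fun p => m ≤ p.1 ∨ (m : ℤ) ≤ p.2

/-- The filtration of the coefficients of `τ`. -/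
def filT (m : ℕ) : AddSubgroup R1 := suppIn fun p => p.2 ≤ 2 * (p.1 : ℤ) - m ∨ m ≤ p.1

theorem K.mem_J {m : ℕ} {k : K} :
    k ∈ K.J m ↔ k.f ∈ filF m ∧ k.s ∈ filS m ∧ k.t ∈ filT m ∧ k.g ∈ filG m := by
  simp only [filF, filS, filT, filG, mem_suppIn, Prod.forall]
  exact Iff.rfl

theorem isFiltration_filF : IsFiltration filF where
  anti m m' h := suppIn_mono fun p hp => by omega
  mul_mem m a ha b hb := mul_mem_suppIn (fun p q hp hq => by simp; omega) ha hb
  continuous := suppIn_continuous (fun _ => 0) fun B m => ⟨m, fun p q _ hq => by simp; omega⟩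

theorem isFiltration_filG : IsFiltration filG where
  anti m m' h := suppIn_mono fun p hp => by omega
  mul_mem m a ha b hb := mul_mem_suppIn (fun p q hp hq => by simp; omega) ha hb
  continuous := suppIn_continuous (fun _ => 0) fun B m => ⟨m, fun p q _ hq => by simp; omega⟩

theorem isFiltration_filS : IsFiltration filS where
  anti m m' h := suppIn_mono fun p hp => by omega
  mul_mem m a ha b hb := mul_mem_suppIn (fun p q hp hq => by simp; omega) ha hb
  -- Multiplication by monomials with V-exponent at least −B lowers the V-exponent by at most `B`;
  -- the U-exponent never drops.
  continuous := suppIn_continuous (fun p => p.2.natAbs) fun B m =>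
    ⟨m + B, fun p q _ hq => by simp; omega⟩

theorem isFiltration_filT : IsFiltration filT where
  anti m m' h := suppIn_mono fun p hp => by omega
  mul_mem m a ha b hb := mul_mem_suppIn (fun p q hp hq => by simp; omega) ha hb
  -- The quantity 2i − j drops by at most `B` when V-exponents up to `B` are added.
  continuous := suppIn_continuous (fun p => p.2.natAbs) fun B m =>
    ⟨m + B, fun p q _ hq => by simp; omega⟩

theorem filG_le_filT (m : ℕ) : filG m ≤ filT m := suppIn_mono fun _ => Or.inr

/-- Each `filG m` is an ideal, so it absorbs arbitrary right factors. -/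
theorem compat_filG : Compat filG ⊤ filG filG where
  anti := isFiltration_filG.anti
  left m a ha b _ := mul_mem_suppIn (Q := fun _ => True) (fun p q hp _ => by simp; omega) ha
    (by simp [mem_suppIn])
  right := isFiltration_filG.continuous

/-- The subgroups `filT m` are not ideals, since multiplication by V leaves them. A product
therefore converges in this topology when its left factor converges in the stronger topology of
`filG`. -/
theorem compat_filT : Compat filG ⊤ filT filT where
  anti := isFiltration_filT.anti
  left m a ha b hb := filG_le_filT m (compat_filG.left m a ha b hb)
  right := isFiltration_filT.continuous

end Filtration

/-! ### The derivations -/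

instance : CharP R1 2 := charP_of_injective_algebraMap (algebraMap (ZMod 2) R1).injective 2

instance : CharP R0 2 := charP_of_injective_algebraMap (algebraMap (ZMod 2) R0).injective 2

theorem onMonomials_single (φ : ℕ × ℤ → R1) (p : ℕ × ℤ) (c : ZMod 2) :
    onMonomials φ (.single p c) = c • φ p := by
  simp [onMonomials, AddMonoidAlgebra.coeffLinearEquiv]

/-- Both sides are bilinear, so monomials with coefficient one decide. -/
theorem leibniz_of_single (d : R1 →ₗ[ZMod 2] R1)
    (h : ∀ p q, d (.single (p + q) 1) =
      d (.single p 1) * .single q 1 + .single p 1 * d (.single q 1))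
    (a b : R1) : d (a * b) = d a * b + a * d b := by
  have hs : ∀ (p : ℕ × ℤ) (c : ZMod 2), (.single p c : R1) = c • .single p 1 := by simp
  induction a using AddMonoidAlgebra.induction_linear with
  | zero => simp
  | add x y hx hy => simp only [add_mul, map_add, hx, hy]; abel
  | single p c =>
    induction b using AddMonoidAlgebra.induction_linear with
    | zero => simp
    | add x y hx hy => simp only [mul_add, map_add, hx, hy]; abel
    | single q c' =>
      rw [hs p, hs q]
      simp only [smul_mul_assoc, mul_smul_comm, map_smul, ← smul_add, ← h,
        AddMonoidAlgebra.single_mul_single, mul_one]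

/-- The truncated exponent `p.1 - 1` is harmless: for `p.1 = 0` the coefficient vanishes. -/
theorem opVinvPartialU_single (p : ℕ × ℤ) (c : ZMod 2) :
    opVinvPartialU (.single p c) = .single (p.1 - 1, p.2 - 1) (c * p.1) := by
  simp [opVinvPartialU, partialU, onMonomials_single, mono, AddMonoidAlgebra.single_mul_single]
  ring_nf

theorem opEuler_single (p : ℕ × ℤ) (c : ZMod 2) :
    opEuler (.single p c) = .single p (c * (p.1 + p.2)) := by
  obtain ⟨i, j⟩ := p
  simp only [opEuler, partialU, partialV, mono, LinearMap.add_apply, LinearMap.comp_apply,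
    onMonomials_single, LinearMap.mulLeft_apply, AddMonoidAlgebra.smul_single,
    AddMonoidAlgebra.single_mul_single, smul_eq_mul, mul_one, one_mul]
  rw [mul_add, AddMonoidAlgebra.single_add]
  congr 1
  · rcases i with _ | i
    · simp
    · simp [add_comm]
  · simp

theorem opVinvPartialU_mul (a b : R1) :
    opVinvPartialU (a * b) = opVinvPartialU a * b + a * opVinvPartialU b := by
  refine leibniz_of_single _ (fun p q => ?_) a b
  obtain ⟨i, j⟩ := p
  obtain ⟨k, l⟩ := q
  simp only [opVinvPartialU_single, AddMonoidAlgebra.single_mul_single, one_mul, mul_one]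
  -- The exponents zero are treated apart because subtraction of natural numbers is truncated there.
  rcases i with _ | i <;> rcases k with _ | k
  · simp
  · simp; ring_nf
  · simp; ring_nf
  · have e1 : (i + 1 + (k + 1) - 1, j + l - 1) = (i + 1 - 1 + (k + 1), j - 1 + l) := by
      ext <;> simp <;> omega
    have e2 : (i + 1 + (k + 1) - 1, j + l - 1) = (i + 1 + (k + 1 - 1), j + (l - 1)) := by
      ext <;> simp
      omega
    simp only [Prod.mk_add_mk]
    rw [← e1, ← e2, ← AddMonoidAlgebra.single_add, Nat.cast_add]

theorem opEuler_mul (a b : R1) : opEuler (a * b) = opEuler a * b + a * opEuler b := by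
  refine leibniz_of_single _ (fun p q => ?_) a b
  simp only [opEuler_single, AddMonoidAlgebra.single_mul_single, one_mul, mul_one,
    ← AddMonoidAlgebra.single_add]
  congr 1
  push_cast [Prod.fst_add, Prod.snd_add]
  ring

@[simp] theorem opEuler_one : opEuler 1 = 0 := by
  have := opEuler_mul 1 1
  simpa using this

/-- The operator lowers the U-exponent by one, hence the index `m + 1`. -/
theorem opVinvPartialU_mem {m : ℕ} {a : R1} (ha : a ∈ filG (m + 1)) : opVinvPartialU a ∈ filG m :=
  mem_of_suppIn (opVinvPartialU : R1 →+ R1) (filG m).toAddSubmonoid (fun p hp c => by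
    simpa [opVinvPartialU_single, filG] using single_mem_suppIn (by simp; omega) _) ha

theorem opEuler_mem {P : ℕ × ℤ → Prop} {a : R1} (ha : a ∈ suppIn P) : opEuler a ∈ suppIn P :=
  mem_of_suppIn (opEuler : R1 →+ R1) (suppIn P).toAddSubmonoid (fun p hp c => by
    simpa [opEuler_single] using single_mem_suppIn hp _) ha

/-! ### Differentiating a differential over a principal ideal domain -/

section Connection

variable {R : Type*} [CommRing R] (E : R →+ R) (hE : ∀ a b, E (a * b) = E a * b + a * E b)

/-- The flat connection for which the elements of a basis are constant. -/
def flatConnection {M ι : Type*} [AddCommGroup M] [Module R M] [Fintype ι]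
    (b : Module.Basis ι R M) : M →+ M where
  toFun x := ∑ j, E (b.repr x j) • b j
  map_zero' := by simp
  map_add' x y := by simp [add_smul, Finset.sum_add_distrib]

include hE in
theorem flatConnection_smul {M ι : Type*} [AddCommGroup M] [Module R M] [Fintype ι]
    (b : Module.Basis ι R M) (r : R) (x : M) :
    flatConnection E b (r • x) = E r • x + r • flatConnection E b x := by
  have : E r • x = ∑ j, E r • b.repr x j • b j := by rw [← Finset.smul_sum, b.sum_repr]
  rw [this]
  simp [flatConnection, hE, add_smul, Finset.sum_add_distrib, Finset.smul_sum, mul_smul]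

include hE in
theorem flatConnection_smul_basis {M ι : Type*} [AddCommGroup M] [Module R M] [Fintype ι]
    (b : Module.Basis ι R M) (r : R) (j : ι) :
    flatConnection E b (r • b j) = E r • b j := by
  classical
  have h1 : E 1 = 0 := by simpa using hE 1 1
  have : flatConnection E b (b j) = 0 := by
    simp [flatConnection, Finsupp.single_apply, apply_ite E, h1]
  rw [flatConnection_smul E hE, this, smul_zero, add_zero]

include hE in
/-- A differential on a finitely generated free module over a principal ideal domain commutes
with a connection, if the derivation preserves all ideals. -/
theorem exists_connection_comm [IsDomain R] [IsPrincipalIdealRing R] (hdvd : ∀ a, a ∣ E a)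
    {M n : Type*} [AddCommGroup M] [Module R M] [Fintype n] (b : Module.Basis n R M)
    (D : M →ₗ[R] M) (hD : ∀ x, D (D x) = 0) :
    ∃ N : M →+ M, (∀ (r : R) (x : M), N (r • x) = E r • x + r • N x) ∧ ∀ x, D (N x) = N (D x) := by
  classical
  -- The image of `D` has a basis aᵢeᵢ for part of a basis e of `M`; the `l i` chosen next are
  -- preimages of the aᵢeᵢ under `D`, and E(aᵢ) = gᵢaᵢ.
  obtain ⟨r, snf⟩ := Submodule.smithNormalForm b (LinearMap.range D)
  choose l hl using fun i => (snf.bN i).2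
  choose g hg using fun i => hdvd (snf.a i)
  let c : M →ₗ[R] (Fin r → R) := snf.bN.equivFun.toLinearMap ∘ₗ D.rangeRestrict
  let L : (Fin r → R) →ₗ[R] M := Fintype.linearCombination R l
  have hDL : ∀ v, D (L v) = ∑ i, (v i * snf.a i) • snf.bM (snf.f i) := fun v => by
    simp [L, Fintype.linearCombination_apply, hl, snf.snf, mul_smul]
  have hDc : ∀ x, D x = ∑ i, (c x i * snf.a i) • snf.bM (snf.f i) := fun x => by
    have h := congrArg Subtype.val (snf.bN.sum_equivFun (D.rangeRestrict x))
    rw [Submodule.coe_sum] at h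
    simp only [Submodule.coe_smul, snf.snf, smul_smul] at h
    exact h.symm
  have hc0 : ∀ x, D x = 0 → c x = 0 := fun x hx => by
    have : D.rangeRestrict x = 0 := Subtype.ext hx
    simp [c, this]
  -- Here `c` takes the coordinates of D(x) and `L` lifts them along `D`, so `L ∘ c` is a projection
  -- with kernel ker D: `M` splits as im L ⊕ ker D.
  have hDp : ∀ x, D (L (c x)) = D x := fun x => by rw [hDL, hDc]
  have hcL : ∀ x, c (L (c x)) = c x := fun x => by
    rw [← sub_eq_zero, ← map_sub]
    exact hc0 _ (by rw [map_sub, hDp, sub_self])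
  -- The vectors eᵢ lie in ker D: aᵢD(eᵢ) = D(D(lᵢ)) = 0, and aᵢ ≠ 0 in a torsion-free module.
  have hk : ∀ i, c (snf.bM (snf.f i)) = 0 := fun i => by
    refine hc0 _ ?_
    have h0 : snf.a i • D (snf.bM (snf.f i)) = 0 := by
      rw [← map_smul, ← snf.snf, ← hl, hD]
    have ha : snf.a i ≠ 0 := fun ha => snf.bN.ne_zero i (by
      ext
      rw [snf.snf, ha, zero_smul, Submodule.coe_zero])
    refine b.ext_elem fun j => ?_
    have h1 : snf.a i * b.repr (D (snf.bM (snf.f i))) j = 0 := by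
      simpa using congrArg (fun v => b.repr v j) h0
    simpa using (mul_eq_zero.1 h1).resolve_left ha
  have hcD : ∀ x, c (D x) = 0 := fun x => hc0 _ (hD x)
  -- On im L differentiate coordinates, with the correction gᵢ chosen so that D(Σ(E(cᵢ) + gᵢcᵢ)lᵢ) =
  -- Σ E(cᵢaᵢ)eᵢ.
  let A : M →+ M := AddMonoidHom.mk' (fun x => L fun i => E (c x i) + g i * c x i) fun x y => by
    rw [← map_add]; congr 1; funext i
    simp only [map_add, Pi.add_apply]; ring
  -- On ker D use the flat connection of the basis e, projected back to ker D along im L. On D(x) =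
  -- Σ cᵢaᵢeᵢ the projection changes nothing, and the result is again Σ E(cᵢaᵢ)eᵢ.
  let B : M →+ M := AddMonoidHom.mk' (fun x => flatConnection E snf.bM (x - L (c x)) -
      L (c (flatConnection E snf.bM (x - L (c x))))) fun x y => by
    simp only [map_add, map_sub]; abel
  refine ⟨A + B, fun s x => ?_, fun x => ?_⟩
  · have hA : A (s • x) = E s • L (c x) + s • A x := by
      change L _ = _ + s • L _
      rw [← L.map_smul, ← c.map_smul, ← L.map_smul, ← L.map_add]; congr 1; funext i
      simp only [map_smul, Pi.smul_apply, smul_eq_mul, hE, Pi.add_apply]; ring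
    have hB : B (s • x) = E s • (x - L (c x)) + s • B x := by
      change flatConnection E snf.bM (s • x - L (c (s • x))) -
        L (c (flatConnection E snf.bM (s • x - L (c (s • x))))) = _ + s • (_ - _)
      have : s • x - L (c (s • x)) = s • (x - L (c x)) := by simp [smul_sub]
      rw [this, flatConnection_smul E hE]
      simp only [map_add, map_smul, map_sub, hcL, sub_self, zero_add, smul_sub]
      abel
    rw [AddMonoidHom.add_apply, AddMonoidHom.add_apply, hA, hB, smul_add, smul_sub]
    abel
  · have hDB : D (B x) = 0 := by
      change D (_ - L (c _)) = 0
      rw [map_sub, hDp, sub_self]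
    have hAD : A (D x) = 0 := by
      change L _ = 0
      rw [hcD]
      convert map_zero L
      simp
    have hflat : flatConnection E snf.bM (D x) =
        ∑ i, E (c x i * snf.a i) • snf.bM (snf.f i) := by
      rw [hDc, map_sum]
      exact Finset.sum_congr rfl fun i _ => flatConnection_smul_basis E hE ..
    have hBD : B (D x) = ∑ i, E (c x i * snf.a i) • snf.bM (snf.f i) := by
      change flatConnection E snf.bM (D x - L (c (D x))) -
        L (c (flatConnection E snf.bM (D x - L (c (D x))))) = _
      rw [hcD, map_zero, sub_zero, hflat]
      simp [hk]
    rw [AddMonoidHom.add_apply, AddMonoidHom.add_apply, map_add, hDB, hAD, hBD, add_zero, zero_add]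
    change D (L _) = _
    rw [hDL]
    refine Finset.sum_congr rfl fun i _ => ?_
    rw [hE, hg]
    congr 1
    ring

include hE in
/-- The derivative of a differential is homotopic to zero, over a principal ideal domain with a
derivation that preserves all ideals. -/
theorem exists_commutator_eq_map [IsDomain R] [IsPrincipalIdealRing R] (hdvd : ∀ a, a ∣ E a)
    {n : Type*} [Fintype n] [DecidableEq n] (D : Matrix n n R) (hD : D * D = 0) :
    ∃ h : Matrix n n R, D.map E = D * h - h * D := by
  obtain ⟨N, hN, hND⟩ := exists_connection_comm E hE hdvd (Pi.basisFun R n) D.mulVecLin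
    fun x => by simp [hD]
  have hEx : ∀ (s : R) (x : n → R), (fun i => E ((s • x) i)) = E s • x + s • fun i => E (x i) :=
    fun s x => by funext i; simp [hE]
  -- The difference of two connections is linear. Since N commutes with D, the commutator of D with
  -- N − E reduces to E∘D − D∘E, which is the matrix of derivatives.
  let h : (n → R) →ₗ[R] (n → R) :=
    { toFun x := N x - fun i => E (x i)
      map_add' x y := by
        rw [map_add]; funext i; simp; ring
      map_smul' s x := by
        rw [hN, hEx, RingHom.id_apply, smul_sub]; abel }
  have hmul : ∀ x, (fun i => E (D.mulVec x i)) = (D.map E).mulVec x + D.mulVec fun i => E (x i) :=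
    fun x => by
      funext i
      simp [Matrix.mulVec, dotProduct, hE, Finset.sum_add_distrib]
  refine ⟨LinearMap.toMatrix' h, Matrix.toLin'.injective ?_⟩
  refine LinearMap.ext fun x => ?_
  rw [map_sub, Matrix.toLin'_mul, Matrix.toLin'_mul, Matrix.toLin'_toMatrix']
  simp only [LinearMap.sub_apply, LinearMap.comp_apply, Matrix.toLin'_apply]
  change _ = D.mulVec (N x - fun i => E (x i)) - (N (D.mulVec x) - fun i => E (D.mulVec x i))
  have := hND x
  simp only [Matrix.mulVecLin_apply] at this
  rw [hmul, Matrix.mulVec_sub, this]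
  abel

end Connection

/-! ### The completion of `𝔽₂[U, V, V⁻¹]` on which `τ` acts -/

/-- The ring `𝔽₂((B))[[U]]`. The ring `R1` embeds by `U ^ i * V ^ j ↦ U ^ i * B ^ (2 * i - j)`. -/
abbrev RHat : Type := PowerSeries (LaurentSeries (ZMod 2))

/-- The coefficient of `U ^ i * B ^ l`. -/
def hcoeff (x : RHat) (i : ℕ) (l : ℤ) : ZMod 2 := (PowerSeries.coeff i x).coeff l

theorem hcoeff_ext {x y : RHat} (h : ∀ i l, hcoeff x i l = hcoeff y i l) : x = y := by
  ext i l; exact h i l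

@[simp] theorem hcoeff_add (x y : RHat) (i : ℕ) (l : ℤ) :
    hcoeff (x + y) i l = hcoeff x i l + hcoeff y i l := by simp [hcoeff]

@[simp] theorem hcoeff_sub (x y : RHat) (i : ℕ) (l : ℤ) :
    hcoeff (x - y) i l = hcoeff x i l - hcoeff y i l := by simp [hcoeff]

/-- The embedding of `R1` in its completion. -/
def hat : R1 →+* RHat :=
  RingHomClass.toRingHom <| AddMonoidAlgebra.lift (ZMod 2) RHat (ℕ × ℤ)
    { toFun p := PowerSeries.monomial p.toAdd.1 (HahnSeries.single (2 * p.toAdd.1 - p.toAdd.2) 1)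
      map_one' := by simp
      map_mul' p q := by
        rw [PowerSeries.monomial_mul_monomial, HahnSeries.single_mul_single, mul_one]
        congr 3
        simp
        ring }

theorem hcoeff_hat (a : R1) (i : ℕ) (l : ℤ) : hcoeff (hat a) i l = a.coeff (i, 2 * i - l) := by
  induction a using AddMonoidAlgebra.induction_linear with
  | zero => simp [hcoeff]
  | add x y hx hy => simp [hx, hy]
  | single p c =>
    obtain ⟨k, j⟩ := p
    have h : hat (.single (k, j) 1) =
        PowerSeries.monomial k (HahnSeries.single (2 * (k : ℤ) - j) (1 : ZMod 2)) :=
      AddMonoidAlgebra.lift_of _ (Multiplicative.ofAdd (k, j))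
    have hc : c = 0 ∨ c = 1 := by revert c; decide
    rcases hc with rfl | rfl
    · simp [hcoeff]
    rw [h, hcoeff, PowerSeries.coeff_monomial]
    by_cases hik : i = k
    · subst hik
      by_cases hl : l = 2 * i - j
      · subst hl; simp
      · have : j ≠ 2 * i - l := by omega
        simp [HahnSeries.coeff_single_of_ne hl, this]
    · simp [hik]

/-- The operator multiplying `B ^ l` by `c + l`. -/
def laurentWeight (c : ZMod 2) : LaurentSeries (ZMod 2) →+ LaurentSeries (ZMod 2) where
  toFun x :=
    { coeff l := (c + l) * x.coeff l
      isPWO_support' := x.isPWO_support.mono fun l hl => right_ne_zero_of_mul hl }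
  map_zero' := by ext; simp
  map_add' x y := by ext; simp [mul_add]

@[simp] theorem coeff_laurentWeight (c : ZMod 2) (x : LaurentSeries (ZMod 2)) (l : ℤ) :
    (laurentWeight c x).coeff l = (c + l) * x.coeff l := rfl

theorem support_laurentWeight (c : ZMod 2) (x : LaurentSeries (ZMod 2)) :
    (laurentWeight c x).support ⊆ x.support := fun l hl =>
  right_ne_zero_of_mul (a := (c + l : ZMod 2)) hl

/-- For l = l₁ + l₂ the weight c + d + l splits as (c + l₁) + (d + l₂). -/
theorem laurentWeight_mul (c d : ZMod 2) (x y : LaurentSeries (ZMod 2)) :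
    laurentWeight (c + d) (x * y) = laurentWeight c x * y + x * laurentWeight d y := by
  ext l
  rw [coeff_laurentWeight, HahnSeries.coeff_add, HahnSeries.coeff_mul,
    HahnSeries.coeff_mul_left' x.isPWO_support (support_laurentWeight c x),
    HahnSeries.coeff_mul_right' y.isPWO_support (support_laurentWeight d y),
    Finset.mul_sum, ← Finset.sum_add_distrib]
  refine Finset.sum_congr rfl fun p hp => ?_
  rw [Finset.mem_antidiagonal] at hp
  rw [← hp.2.2]
  simp only [coeff_laurentWeight]
  push_cast
  ring

/-- The extension of the derivation `U * ∂_U + V * ∂_V` to the completion. -/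
def eulerHat : RHat →+ RHat where
  toFun x := PowerSeries.mk fun i => laurentWeight i (PowerSeries.coeff i x)
  map_zero' := by ext; simp
  map_add' x y := by ext; simp

@[simp] theorem coeff_eulerHat (x : RHat) (i : ℕ) :
    PowerSeries.coeff i (eulerHat x) = laurentWeight i (PowerSeries.coeff i x) := by
  simp [eulerHat]

theorem eulerHat_mul (x y : RHat) : eulerHat (x * y) = eulerHat x * y + x * eulerHat y := by
  ext1 i
  rw [coeff_eulerHat, map_add, PowerSeries.coeff_mul, PowerSeries.coeff_mul,
    PowerSeries.coeff_mul, map_sum, ← Finset.sum_add_distrib]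
  refine Finset.sum_congr rfl fun p hp => ?_
  rw [← Finset.HasAntidiagonal.mem_antidiagonal.1 hp, Nat.cast_add, laurentWeight_mul,
    coeff_eulerHat,
    coeff_eulerHat]

/-- The monomial UⁱVʲ has weight i + j, and j = 2i − l gives 3i − l, which is i + l modulo two. -/
theorem eulerHat_hat (a : R1) : eulerHat (hat a) = hat (opEuler a) := by
  refine hcoeff_ext fun i l => ?_
  have h : hcoeff (eulerHat (hat a)) i l = (i + l) * hcoeff (hat a) i l := by simp [hcoeff]
  rw [h, hcoeff_hat, hcoeff_hat]
  clear h
  induction a using AddMonoidAlgebra.induction_linear with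
  | zero => simp
  | add x y hx hy => simp [mul_add, hx, hy]
  | single p c =>
    rw [opEuler_single]
    by_cases hp : p = (i, 2 * i - l)
    · subst hp
      have : (2 : ZMod 2) = 0 := rfl
      simp only [AddMonoidAlgebra.coeff_single, Finsupp.single_eq_same]
      push_cast
      rw [this, zero_mul, zero_sub, CharTwo.neg_eq]
      ring
    · simp [hp]

/-- A nonzero `x` is a power of U times a unit, as the coefficients form a field. The derivation
acts on each U-coefficient separately, so its value is divisible by the same power of U. -/
theorem dvd_eulerHat (x : RHat) : x ∣ eulerHat x := by
  by_cases hx : x = 0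
  · simp [hx]
  have h : x = PowerSeries.X ^ x.order.toNat * PowerSeries.divXPowOrder x :=
    PowerSeries.X_pow_order_mul_divXPowOrder.symm
  have hu := PowerSeries.isUnit_divided_by_X_pow_order hx
  have hdvd : PowerSeries.X ^ x.order.toNat ∣ eulerHat x := by
    rw [PowerSeries.X_pow_dvd_iff]
    intro i hi
    have := PowerSeries.X_pow_dvd_iff.1 ⟨_, h⟩ i hi
    rw [coeff_eulerHat, this, map_zero]
  exact (dvd_of_eq h).trans ((hu.mul_right_dvd).2 hdvd)

/-- The filtration of the completion. -/
def filHat (m : ℕ) : AddSubgroup RHat where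
  carrier := {x | ∀ (i : ℕ) (l : ℤ), i < m → l < m → hcoeff x i l = 0}
  zero_mem' := by simp [hcoeff]
  add_mem' ha hb i l hi hl := by rw [hcoeff_add, ha i l hi hl, hb i l hi hl, add_zero]
  neg_mem' {x} ha i l hi hl := by
    have := ha i l hi hl
    simpa [hcoeff] using this

theorem filHat_anti : Antitone filHat := fun m m' h _ hx i l hi hl =>
  hx i l (by omega) (by omega)

/-- With l = 2i − j, the inequalities i < m and l < m together are the negation of the condition
defining `filT m`. -/
theorem hat_mem_filHat {a : R1} {m : ℕ} : hat a ∈ filHat m ↔ a ∈ filT m := by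
  constructor
  · rintro h ⟨i, j⟩ hp
    have := h i (2 * i - j) (by simp at hp; omega) (by simp at hp; omega)
    rwa [hcoeff_hat, sub_sub_cancel] at this
  · intro h i l hi hl
    rw [hcoeff_hat]
    exact h _ (by simp; omega)

theorem mem_filHat_of_dvd {x : RHat} {m : ℕ} (h : PowerSeries.X ^ m ∣ x) : x ∈ filHat m :=
  fun i l hi _ => by rw [hcoeff, PowerSeries.X_pow_dvd_iff.1 h i hi, HahnSeries.coeff_zero]

theorem X_pow_dvd_hat {a : R1} {m : ℕ} (h : a ∈ filG m) : PowerSeries.X ^ m ∣ hat a := by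
  rw [PowerSeries.X_pow_dvd_iff]
  intro i hi
  ext l
  exact (hcoeff_hat a i l).trans (h _ (by simpa using hi))

/-- Each of the finitely many Laurent coefficients below U^m has a lowest power of B. -/
theorem exists_hcoeff_eq_zero (x : RHat) (m : ℕ) :
    ∃ B : ℕ, ∀ (i : ℕ) (l : ℤ), i < m → l < -B → hcoeff x i l = 0 := by
  refine ⟨(Finset.range m).sup fun i => (PowerSeries.coeff i x).order.natAbs, fun i l hi hl => ?_⟩
  refine HahnSeries.coeff_eq_zero_of_lt_order ?_
  have : (PowerSeries.coeff i x).order.natAbs ≤ _ :=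
    Finset.le_sup (f := fun i => (PowerSeries.coeff i x).order.natAbs) (Finset.mem_range.2 hi)
  omega

theorem exists_mul_mem_filHat (x : RHat) (m : ℕ) : ∃ k, ∀ y ∈ filHat k, x * y ∈ filHat m := by
  obtain ⟨B, hB⟩ := exists_hcoeff_eq_zero x m
  refine ⟨m + B, fun y hy i l hi hl => ?_⟩
  rw [hcoeff, PowerSeries.coeff_mul, HahnSeries.coeff_sum]
  refine Finset.sum_eq_zero fun p hp => ?_
  have hp := Finset.HasAntidiagonal.mem_antidiagonal.1 hp
  rw [HahnSeries.coeff_mul]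
  refine Finset.sum_eq_zero fun q hq => ?_
  rw [Finset.mem_antidiagonal] at hq
  by_cases h : q.1 < -B
  · rw [show (PowerSeries.coeff p.1 x).coeff q.1 = 0 from hB _ _ (by omega) h, zero_mul]
  · rw [show (PowerSeries.coeff p.2 y).coeff q.2 = 0 from hy _ _ (by omega) (by omega), mul_zero]

theorem exists_hat_sub_mem (x : RHat) (m : ℕ) : ∃ a, hat a - x ∈ filHat m := by
  classical
  obtain ⟨B, hB⟩ := exists_hcoeff_eq_zero x m
  -- Truncate `x` to i < m and l < m. Then j = 2i − l exceeds −m, and l ≥ −B forces j ≤ 2m + B, so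
  -- finitely many monomials remain.
  refine ⟨.ofCoeff (Finsupp.onFinset
    (Finset.range m ×ˢ Finset.Ioc (-m : ℤ) (2 * m + B))
    (fun p => if p.1 < m ∧ 2 * p.1 - p.2 < m then hcoeff x p.1 (2 * p.1 - p.2) else 0) ?_), ?_⟩
  · rintro ⟨i, j⟩ h
    simp only [ne_eq, ite_eq_right_iff, Classical.not_imp] at h
    have : ¬ (2 * i - j < -(B : ℤ)) := fun h' => h.2 (hB _ _ h.1.1 h')
    simp
    omega
  · intro i l hi hl
    rw [hcoeff_sub, hcoeff_hat]
    simp [hi, hl]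

theorem exists_limit {a : ℕ → R1} (h : ∀ m, ∃ N, ∀ n ≥ N, ∀ n' ≥ N, a n - a n' ∈ filG m) :
    ∃ x : RHat, ∀ m, ∃ N, ∀ n ≥ N, PowerSeries.X ^ m ∣ hat (a n) - x := by
  choose N hN using h
  -- The coefficient of Uⁱ is constant from index `N (i + 1)` on, since later differences are
  -- divisible by U^(i+1).
  refine ⟨PowerSeries.mk fun i => PowerSeries.coeff i (hat (a (N (i + 1)))), fun m =>
    ⟨(Finset.range (m + 1)).sup N, fun n hn => ?_⟩⟩
  rw [PowerSeries.X_pow_dvd_iff]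
  intro i hi
  have := hN (i + 1) n ((Finset.le_sup (Finset.mem_range.2 (by omega))).trans hn) _ le_rfl
  have := PowerSeries.X_pow_dvd_iff.1 (X_pow_dvd_hat this) i (by omega)
  simpa using this

theorem two_eq_zero_RHat : (2 : RHat) = 0 := by
  rw [← one_add_one_eq_two, ← map_one hat, ← map_add, CharTwo.add_self_eq_zero, map_zero]

/-- Convergence in the completion. -/
def TendsHat (x : ℕ → RHat) (y : RHat) : Prop := ∀ m, ∃ N, ∀ n ≥ N, x n - y ∈ filHat m

theorem TendsHat.add {x x' : ℕ → RHat} {y y' : RHat} (h : TendsHat x y) (h' : TendsHat x' y') :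
    TendsHat (fun n => x n + x' n) (y + y') := by
  intro m
  obtain ⟨N, hN⟩ := h m
  obtain ⟨N', hN'⟩ := h' m
  refine ⟨max N N', fun n hn => ?_⟩
  rw [add_sub_add_comm]
  exact add_mem (hN n (le_of_max_le_left hn)) (hN' n (le_of_max_le_right hn))

theorem TendsHat.sum {ι : Type*} (s : Finset ι) {x : ι → ℕ → RHat} {y : ι → RHat}
    (h : ∀ i, TendsHat (x i) (y i)) : TendsHat (fun n => ∑ i ∈ s, x i n) (∑ i ∈ s, y i) := by
  classical
  induction s using Finset.induction_on with
  | empty => exact fun m => ⟨0, by simp [zero_mem]⟩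
  | insert i s hi ih => simpa [Finset.sum_insert hi] using (h i).add ih

/-- The first factor must converge U-adically: divisibility of `x n - y` by U^m survives
multiplication by the varying `x' n`, while mere membership in `filHat m` would not. -/
theorem TendsHat.mul {x x' : ℕ → RHat} {y y' : RHat}
    (h : ∀ m, ∃ N, ∀ n ≥ N, PowerSeries.X ^ m ∣ x n - y) (h' : TendsHat x' y') :
    TendsHat (fun n => x n * x' n) (y * y') := by
  intro m
  obtain ⟨N, hN⟩ := h m
  obtain ⟨k, hk⟩ := exists_mul_mem_filHat y m
  obtain ⟨N', hN'⟩ := h' k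
  refine ⟨max N N', fun n hn => ?_⟩
  have h1 : (x n - y) * x' n ∈ filHat m :=
    mem_filHat_of_dvd ((hN n (le_of_max_le_left hn)).mul_right _)
  have h2 := hk _ (hN' n (le_of_max_le_right hn))
  convert add_mem h1 h2 using 1
  ring

/-- Convergence in the `U`-adic topology. -/
def TendsAdic (x : ℕ → RHat) (y : RHat) : Prop :=
  ∀ m, ∃ N, ∀ n ≥ N, PowerSeries.X ^ m ∣ x n - y

theorem TendsAdic.mul {x x' : ℕ → RHat} {y y' : RHat} (h : TendsAdic x y) (h' : TendsAdic x' y') :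
    TendsAdic (fun n => x n * x' n) (y * y') := by
  intro m
  obtain ⟨N, hN⟩ := h m
  obtain ⟨N', hN'⟩ := h' m
  refine ⟨max N N', fun n hn => ?_⟩
  convert dvd_add ((hN n (le_of_max_le_left hn)).mul_right (x' n))
    ((hN' n (le_of_max_le_right hn)).mul_left y) using 1
  ring

theorem TendsAdic.sum {ι : Type*} (s : Finset ι) {x : ι → ℕ → RHat} {y : ι → RHat}
    (h : ∀ i, TendsAdic (x i) (y i)) : TendsAdic (fun n => ∑ i ∈ s, x i n) (∑ i ∈ s, y i) := by
  intro m
  choose N hN using fun i => h i m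
  refine ⟨s.sup N, fun n hn => ?_⟩
  rw [← Finset.sum_sub_distrib]
  exact Finset.dvd_sum fun i hi => hN i n ((Finset.le_sup hi).trans hn)

theorem TendsAdic.unique {x : ℕ → RHat} {y y' : RHat} (h : TendsAdic x y) (h' : TendsAdic x y') :
    y = y' := by
  ext1 i
  obtain ⟨N, hN⟩ := h (i + 1)
  obtain ⟨N', hN'⟩ := h' (i + 1)
  have h1 := PowerSeries.X_pow_dvd_iff.1 (hN _ (le_max_left N N')) i (by omega)
  have h2 := PowerSeries.X_pow_dvd_iff.1 (hN' _ (le_max_right N N')) i (by omega)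
  rw [map_sub, sub_eq_zero] at h1 h2
  rw [← h1, h2]

theorem hat_cmul_apply {Y : Type*} [Fintype Y] (ψ φ : Y → Y →₀ R1) (y z : Y) :
    hat (cmul ψ φ y z) = ∑ w, hat (ψ w z) * hat (φ y w) := by
  change hat (act ψ (φ y) z) = _
  rw [act_apply_of_subset _ _ _ (Finset.subset_univ _)]
  simp

/-- For a finitely generated complex over `𝔽₂[U, V, V⁻¹]`, completed in the `U`-adic topology,
the derivative of the differential is homotopic to zero over `𝔽₂((V⁻¹))[[U]]`. -/
theorem exists_null_com_add_euler {Y : Type*} [Finite Y] {G : ℕ → Y → Y →₀ R1}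
    (hG : Good filG G) (hsq : Null filG (fun n => cmul (G n) (G n))) :
    ∃ h : ℕ → Y → Y →₀ R1, Good filT h ∧
      Null filT (fun n => com (G n) (G n) (h n) + mmap (opEuler : R1 →+ R1) (G n)) := by
  classical
  have := Fintype.ofFinite Y
  choose D hD using fun z y => exists_limit (a := fun n => G n y z) fun m =>
    (hG.cauchy z m).imp fun N hN n hn n' hn' => hN n hn n' hn' y
  have hDD : Matrix.of D * Matrix.of D = 0 := by
    ext1 z y
    have h1 : TendsAdic (fun n => ∑ w, hat (G n w z) * hat (G n y w)) (∑ w, D z w * D w y) :=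
      TendsAdic.sum _ fun w => TendsAdic.mul (hD z w) (hD w y)
    refine TendsAdic.unique (y := ∑ w, D z w * D w y) h1 fun m => ?_
    refine (hsq z m).imp fun N hN n hn => ?_
    rw [Matrix.zero_apply, sub_zero, ← hat_cmul_apply]
    exact X_pow_dvd_hat (hN n hn y)
  -- The U-adic limit of the matrices squares to zero exactly, so the algebra over the principal
  -- ideal domain applies to it.
  obtain ⟨h, hh⟩ := exists_commutator_eq_map eulerHat eulerHat_mul dvd_eulerHat _ hDD
  -- The n-th approximation of `h` is accurate modulo `filHat n`; it is Cauchy for `filT`, which is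
  -- all the conclusion asks.
  choose a ha using fun (n : ℕ) (y z : Y) => exists_hat_sub_mem (h z y) n
  have hlim : ∀ y z, TendsHat (fun n => hat (a n y z)) (h z y) := fun y z m =>
    ⟨m, fun n hn => filHat_anti hn (ha n y z)⟩
  refine ⟨fun n y => Finsupp.equivFunOnFinite.symm (a n y), ⟨fun n y m => Set.toFinite _,
    fun z m => ⟨m, fun n hn n' hn' y => ?_⟩⟩, fun z m => ?_⟩
  · rw [← hat_mem_filHat, map_sub]
    have := sub_mem (filHat_anti hn (ha n y z)) (filHat_anti hn' (ha n' y z))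
    simpa using this
  · have key : ∀ y, TendsHat (fun n => hat ((com (G n) (G n)
        (fun y => Finsupp.equivFunOnFinite.symm (a n y)) + mmap (opEuler : R1 →+ R1) (G n)) y z))
        0 := fun y => by
      have h1 : TendsHat (fun n => ∑ w, hat (G n w z) * hat (a n y w)) (∑ w, D z w * h w y) :=
        TendsHat.sum _ fun w => TendsHat.mul (hD z w) (hlim y w)
      have h2 : TendsHat (fun n => ∑ w, hat (G n y w) * hat (a n w z)) (∑ w, D w y * h z w) :=
        TendsHat.sum _ fun w => TendsHat.mul (hD w y) (hlim w z)
      have h3 : TendsHat (fun n => eulerHat (hat (G n y z))) (eulerHat (D z y)) := fun m =>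
        (hD z y m).imp fun N hN n hn => by
          rw [← map_sub]
          exact mem_filHat_of_dvd ((hN n hn).trans (dvd_eulerHat _))
      have hE : eulerHat (D z y) = ∑ w, D z w * h w y - ∑ w, D w y * h z w := by
        have := congrFun (congrFun hh z) y
        simpa [Matrix.mul_apply, mul_comm] using this
      have h0 : (∑ w, D z w * h w y + ∑ w, D w y * h z w) + eulerHat (D z y) = 0 := by
        have h2 : (2 : RHat) = 0 := two_eq_zero_RHat
        rw [hE]
        linear_combination (∑ w, D z w * h w y) * h2
      rw [← h0]
      have e : ∀ n, hat ((com (G n) (G n)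
          (fun y => Finsupp.equivFunOnFinite.symm (a n y)) + mmap (opEuler : R1 →+ R1) (G n)) y z)
          = (∑ w, hat (G n w z) * hat (a n y w) + ∑ w, hat (G n y w) * hat (a n w z)) +
            eulerHat (hat (G n y z)) := fun n => by
        rw [Pi.add_apply, Finsupp.add_apply, map_add, com, Pi.add_apply, Finsupp.add_apply, map_add,
          hat_cmul_apply, hat_cmul_apply, mmap_apply, eulerHat_hat]
        simp only [Finsupp.equivFunOnFinite_symm_apply_apply, mul_comm (hat (a n _ z))]
        rfl
      simp only [e]
      exact (h1.add h2).add h3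
    choose N hN using fun y => key y m
    refine ⟨Finset.univ.sup N, fun n hn y => ?_⟩
    have := hN y n ((Finset.le_sup (Finset.mem_univ y)).trans hn)
    rwa [sub_zero, hat_mem_filHat] at this

/-! ### Components of matrices over `𝒦` -/

section Components

variable {α β γ : Type*}

/-- The components in `I₀ 𝒦 I₀` of the entries. -/
def compF (φ : α → β →₀ K) : α → β →₀ R0 := mmap K.projF.toAddMonoidHom φ

/-- The components in `I₁ 𝒦 I₁` of the entries. -/
def compG (φ : α → β →₀ K) : α → β →₀ R1 := mmap K.projG.toAddMonoidHom φ

/-- The coefficients of `σ` of the entries. -/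
def compS (φ : α → β →₀ K) : α → β →₀ R1 := mmap K.projS.toAddMonoidHom φ

/-- The coefficients of `τ` of the entries. -/
def compT (φ : α → β →₀ K) : α → β →₀ R1 := mmap K.projT.toAddMonoidHom φ

/-- Entrywise application of `I`. -/
def mI (φ : α → β →₀ R0) : α → β →₀ R1 := mmap (mapI : R0 →+ R1) φ

/-- Entrywise application of `T`. -/
def mT (φ : α → β →₀ R0) : α → β →₀ R1 := mmap (mapT : R0 →+ R1) φ

/-- Entrywise application of `U * ∂_U + V * ∂_V`. -/
def mE (φ : α → β →₀ R1) : α → β →₀ R1 := mmap (opEuler : R1 →+ R1) φ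

/-- Entrywise application of `V⁻¹ * ∂_U`. -/
def mD (φ : α → β →₀ R1) : α → β →₀ R1 := mmap (opVinvPartialU : R1 →+ R1) φ

@[simp] theorem compF_apply (φ : α → β →₀ K) (x : α) (y : β) : compF φ x y = (φ x y).f := rfl
@[simp] theorem compG_apply (φ : α → β →₀ K) (x : α) (y : β) : compG φ x y = (φ x y).g := rfl
@[simp] theorem compS_apply (φ : α → β →₀ K) (x : α) (y : β) : compS φ x y = (φ x y).s := rfl
@[simp] theorem compT_apply (φ : α → β →₀ K) (x : α) (y : β) : compT φ x y = (φ x y).t := rfl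
@[simp] theorem mI_apply (φ : α → β →₀ R0) (x : α) (y : β) : mI φ x y = mapI (φ x y) := rfl
@[simp] theorem mT_apply (φ : α → β →₀ R0) (x : α) (y : β) : mT φ x y = mapT (φ x y) := rfl
@[simp] theorem mE_apply (φ : α → β →₀ R1) (x : α) (y : β) : mE φ x y = opEuler (φ x y) := rfl
@[simp] theorem mD_apply (φ : α → β →₀ R1) (x : α) (y : β) :
    mD φ x y = opVinvPartialU (φ x y) := rfl

theorem matrix_ext {φ ψ : α → β →₀ K} (hf : compF φ = compF ψ) (hg : compG φ = compG ψ)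
    (hs : compS φ = compS ψ) (ht : compT φ = compT ψ) : φ = ψ := by
  funext x; ext1 y
  exact K.ext (DFunLike.congr_fun (congrFun hf x) y) (DFunLike.congr_fun (congrFun hg x) y)
    (DFunLike.congr_fun (congrFun hs x) y) (DFunLike.congr_fun (congrFun ht x) y)

theorem compF_cmul (ψ : β → γ →₀ K) (φ : α → β →₀ K) :
    compF (cmul ψ φ) = cmul (compF ψ) (compF φ) := mmap_cmul _ (fun _ _ => rfl) ψ φ

theorem compG_cmul (ψ : β → γ →₀ K) (φ : α → β →₀ K) :
    compG (cmul ψ φ) = cmul (compG ψ) (compG φ) := mmap_cmul _ (fun _ _ => rfl) ψ φ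

theorem cmul_apply_of_subset {A : Type*} [NonUnitalNonAssocSemiring A] (ψ : β → γ →₀ A)
    (φ : α → β →₀ A) (x : α) (z : γ) {s : Finset β} (hs : (φ x).support ⊆ s) :
    cmul ψ φ x z = ∑ y ∈ s, ψ y z * φ x y := act_apply_of_subset ψ (φ x) z hs

theorem compF_add (φ ψ : α → β →₀ K) : compF (φ + ψ) = compF φ + compF ψ := mmap_add ..
theorem compG_add (φ ψ : α → β →₀ K) : compG (φ + ψ) = compG φ + compG ψ := mmap_add ..
theorem compS_add (φ ψ : α → β →₀ K) : compS (φ + ψ) = compS φ + compS ψ := mmap_add ..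
theorem compT_add (φ ψ : α → β →₀ K) : compT (φ + ψ) = compT φ + compT ψ := mmap_add ..

instance : Nontrivial K := ⟨0, 1, fun h => zero_ne_one (congrArg K.f h)⟩

instance : CharP K 2 :=
  charP_of_injective_algebraMap (algebraMap (ZMod 2) K).injective 2

theorem sub_eq_add_matrix {A : Type*} [Ring A] [CharP A 2] (a b : α → β →₀ A) : a - b = a + b := by
  funext x; ext1 y; exact CharTwo.sub_eq_add _ _

theorem support_mmap_subset {A B : Type*} [AddZeroClass A] [AddZeroClass B] (f : A →+ B)
    (φ : α → β →₀ A) (x : α) : (mmap f φ x).support ⊆ (φ x).support := Finsupp.support_mapRange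

theorem compS_cmul (ψ : β → γ →₀ K) (φ : α → β →₀ K) :
    compS (cmul ψ φ) = cmul (compG ψ) (compS φ) + cmul (compS ψ) (mI (compF φ)) := by
  funext x; ext1 z
  rw [compS_apply, cmul_apply_of_subset ψ φ x z subset_rfl, Pi.add_apply, Finsupp.add_apply,
    cmul_apply_of_subset _ (compS φ) x z (support_mmap_subset _ φ x),
    cmul_apply_of_subset _ (mI (compF φ)) x z
      ((support_mmap_subset _ _ x).trans (support_mmap_subset _ φ x)), ← Finset.sum_add_distrib]
  exact map_sum K.projS _ _

theorem compT_cmul (ψ : β → γ →₀ K) (φ : α → β →₀ K) :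
    compT (cmul ψ φ) = cmul (compG ψ) (compT φ) + cmul (compT ψ) (mT (compF φ)) := by
  funext x; ext1 z
  rw [compT_apply, cmul_apply_of_subset ψ φ x z subset_rfl, Pi.add_apply, Finsupp.add_apply,
    cmul_apply_of_subset _ (compT φ) x z (support_mmap_subset _ φ x),
    cmul_apply_of_subset _ (mT (compF φ)) x z
      ((support_mmap_subset _ _ x).trans (support_mmap_subset _ φ x)), ← Finset.sum_add_distrib]
  exact map_sum K.projT _ _

theorem mE_cmul (ψ : β → γ →₀ R1) (φ : α → β →₀ R1) :
    mE (cmul ψ φ) = cmul (mE ψ) φ + cmul ψ (mE φ) := mmap_cmul_deriv _ opEuler_mul ψ φ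

theorem mD_cmul (ψ : β → γ →₀ R1) (φ : α → β →₀ R1) :
    mD (cmul ψ φ) = cmul (mD ψ) φ + cmul ψ (mD φ) := mmap_cmul_deriv _ opVinvPartialU_mul ψ φ

theorem mE_add (ψ φ : α → β →₀ R1) : mE (ψ + φ) = mE ψ + mE φ := mmap_add ..

theorem exists_of_cmul_ne_zero {A : Type*} [NonUnitalNonAssocSemiring A] {ψ : β → γ →₀ A}
    {φ : α → β →₀ A} {x : α} {z : γ} (h : cmul ψ φ x z ≠ 0) : ∃ y, ψ y z ≠ 0 ∧ φ x y ≠ 0 := by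
  by_contra! hc
  refine h ?_
  rw [cmul_apply]
  refine Finset.sum_eq_zero fun y _ => ?_
  change ψ y z * φ x y = 0
  by_cases hy : ψ y z = 0
  · rw [hy, zero_mul]
  · rw [hc y hy, mul_zero]

theorem two_zsmul_matrix {A : Type*} [Ring A] [CharP A 2] (a : α → β →₀ A) :
    (2 : ℤ) • a = 0 := by
  rw [two_zsmul, add_self_matrix]

/-- All entries lie in the correct idempotents. -/
def Idempotented (i : α → Fin 2) (j : β → Fin 2) (φ : α → β →₀ K) : Prop :=
  ∀ x y, K.e (j y) * φ x y * K.e (i x) = φ x y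

theorem fin2_cases (i : Fin 2) : i = 0 ∨ i = 1 := by omega

/-- Multiplying by idempotents on both sides keeps exactly the components starting and ending in the
prescribed idempotents. -/
theorem idempotented_iff {i : α → Fin 2} {j : β → Fin 2} {φ : α → β →₀ K} :
    Idempotented i j φ ↔ (∀ x y, compF φ x y ≠ 0 → i x = 0 ∧ j y = 0) ∧
      (∀ x y, compG φ x y ≠ 0 → i x = 1 ∧ j y = 1) ∧
      (∀ x y, compS φ x y ≠ 0 → i x = 0 ∧ j y = 1) ∧
      (∀ x y, compT φ x y ≠ 0 → i x = 0 ∧ j y = 1) := by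
  simp only [Idempotented, ← forall_and]
  refine forall_congr' fun x => forall_congr' fun y => ?_
  simp only [compF_apply, compG_apply, compS_apply, compT_apply]
  generalize φ x y = a
  rcases fin2_cases (i x) with hi | hi <;> rcases fin2_cases (j y) with hj | hj <;>
    simp [hi, hj, K.ext_iff, K.e, eq_comm]

end Components

/-! ### Cauchy sequences over `𝒦` in terms of components -/

section KTopology

variable {X : TypeDSeq.{u} (Fin 2) K} {Y : TypeDSeq.{v} (Fin 2) K} {Z : TypeDSeq.{w} (Fin 2) K}

/-- The subspaces `J_n` of `𝒦`. -/
def filK (m : ℕ) : AddSubgroup K := (K.J m).toAddSubgroup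

/-- A basic neighbourhood constrains finitely many rows, so all topological conditions may be
checked one row at a time. -/
theorem isMorphism_iff_good {φ : MapSeq X Y} :
    IsMorphism φ ↔ (∀ n, Idempotented X.idem Y.idem (φ n)) ∧ Good filK φ := by
  constructor
  · rintro ⟨h1, h2, h3⟩
    refine ⟨h1, fun n y m => ?_, fun y m => ?_⟩
    · obtain ⟨F, hF⟩ := h2 n {y} m
      refine F.finite_toSet.subset fun x hx => ?_
      by_contra hxF
      exact hx (hF x hxF y (by simp))
    · exact (h3 {y} m).imp fun N hN n hn n' hn' x => hN n hn n' hn' x y (by simp)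
  · rintro ⟨h1, h2, h3⟩
    refine ⟨h1, fun n S m => ?_, fun S m => ?_⟩
    · refine ⟨(S.finite_toSet.biUnion fun y _ => h2 n y m).toFinset, fun x hx y hy => ?_⟩
      by_contra hc
      exact hx (by simpa using ⟨y, hy, hc⟩)
    · choose N hN using fun y => h3 y m
      exact ⟨S.sup N, fun n hn n' hn' x y hy => hN y n ((Finset.le_sup hy).trans hn) n'
        ((Finset.le_sup hy).trans hn') x⟩

theorem cauchyEquiv_iff_null {φ ψ : MapSeq X Y} :
    CauchyEquiv φ ψ ↔ Null filK (fun n => φ n - ψ n) := by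
  constructor
  · intro h y m
    exact (h {y} m).imp fun N hN n hn x => hN n hn x y (by simp)
  · intro h S m
    choose N hN using fun y => h y m
    exact ⟨S.sup N, fun n hn x y hy => hN y n ((Finset.le_sup hy).trans hn) x⟩

variable {α β : Type*}

theorem good_iff_components {φ : ℕ → α → β →₀ K} :
    Good filK φ ↔ Good filF (fun n => compF (φ n)) ∧ Good filG (fun n => compG (φ n)) ∧
      Good filS (fun n => compS (φ n)) ∧ Good filT (fun n => compT (φ n)) := by
  constructor
  · intro h
    exact ⟨h.map _ fun m => ⟨m, fun a ha => (K.mem_J.1 ha).1⟩,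
      h.map _ fun m => ⟨m, fun a ha => (K.mem_J.1 ha).2.2.2⟩,
      h.map _ fun m => ⟨m, fun a ha => (K.mem_J.1 ha).2.1⟩,
      h.map _ fun m => ⟨m, fun a ha => (K.mem_J.1 ha).2.2.1⟩⟩
  · rintro ⟨hf, hg, hs, ht⟩
    refine ⟨fun n y m => ?_, fun y m => ?_⟩
    · refine ((((hf.finite n y m).union (hg.finite n y m)).union (hs.finite n y m)).union
        (ht.finite n y m)).subset fun x hx => ?_
      by_contra hc
      simp only [Set.mem_union, Set.mem_ofPred_eq, not_or, not_not] at hc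
      exact hx (K.mem_J.2 ⟨hc.1.1.1, hc.1.2, hc.2, hc.1.1.2⟩)
    · obtain ⟨N1, h1⟩ := hf.cauchy y m
      obtain ⟨N2, h2⟩ := hg.cauchy y m
      obtain ⟨N3, h3⟩ := hs.cauchy y m
      obtain ⟨N4, h4⟩ := ht.cauchy y m
      refine ⟨max (max N1 N2) (max N3 N4), fun n hn n' hn' x => ?_⟩
      simp only [ge_iff_le, max_le_iff] at hn hn'
      have e : ∀ a b : K, a - b ∈ filK m ↔ a.f - b.f ∈ filF m ∧ a.s - b.s ∈ filS m ∧
          a.t - b.t ∈ filT m ∧ a.g - b.g ∈ filG m := fun a b => by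
        simp only [sub_eq_add_neg]
        exact K.mem_J
      exact (e _ _).2 ⟨h1 n hn.1.1 n' hn'.1.1 x, h3 n hn.2.1 n' hn'.2.1 x,
        h4 n hn.2.2 n' hn'.2.2 x, h2 n hn.1.2 n' hn'.1.2 x⟩

theorem null_iff_components {φ : ℕ → α → β →₀ K} :
    Null filK φ ↔ Null filF (fun n => compF (φ n)) ∧ Null filG (fun n => compG (φ n)) ∧
      Null filS (fun n => compS (φ n)) ∧ Null filT (fun n => compT (φ n)) := by
  constructor
  · intro h
    exact ⟨h.map _ fun m => ⟨m, fun a ha => (K.mem_J.1 ha).1⟩,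
      h.map _ fun m => ⟨m, fun a ha => (K.mem_J.1 ha).2.2.2⟩,
      h.map _ fun m => ⟨m, fun a ha => (K.mem_J.1 ha).2.1⟩,
      h.map _ fun m => ⟨m, fun a ha => (K.mem_J.1 ha).2.2.1⟩⟩
  · rintro ⟨hf, hg, hs, ht⟩ y m
    obtain ⟨N1, h1⟩ := hf y m
    obtain ⟨N2, h2⟩ := hg y m
    obtain ⟨N3, h3⟩ := hs y m
    obtain ⟨N4, h4⟩ := ht y m
    refine ⟨max (max N1 N2) (max N3 N4), fun n hn x => ?_⟩
    simp only [ge_iff_le, max_le_iff] at hn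
    exact K.mem_J.2 ⟨h1 n hn.1.1 x, h3 n hn.2.1 x, h4 n hn.2.2 x, h2 n hn.1.2 x⟩

end KTopology

/-! ### The derivative of the differential acts trivially after `τ` -/

section Theta

variable {α β γ : Type*}

theorem Good.mE {P : ℕ → ℕ × ℤ → Prop} {φ : ℕ → α → β →₀ R1}
    (h : Good (fun m => suppIn (P m)) φ) : Good (fun m => suppIn (P m)) (fun n => mE (φ n)) :=
  h.map _ fun m => ⟨m, fun _ => opEuler_mem⟩

theorem Null.mE {P : ℕ → ℕ × ℤ → Prop} {φ : ℕ → α → β →₀ R1}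
    (h : Null (fun m => suppIn (P m)) φ) : Null (fun m => suppIn (P m)) (fun n => mE (φ n)) :=
  h.map _ fun m => ⟨m, fun _ => opEuler_mem⟩

theorem Good.mD {φ : ℕ → α → β →₀ R1} (h : Good filG φ) : Good filG (fun n => mD (φ n)) :=
  h.map _ fun m => ⟨m + 1, fun _ => opVinvPartialU_mem⟩

theorem Null.mD {φ : ℕ → α → β →₀ R1} (h : Null filG φ) : Null filG (fun n => mD (φ n)) :=
  h.map _ fun m => ⟨m + 1, fun _ => opVinvPartialU_mem⟩

/-- The contraction of `∂G ∘ T` transported along a homotopy equivalence. -/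
def theta (G : α → α →₀ R1) (Φ : α → β →₀ R1) (Ψ : β → α →₀ R1) (k : α → α →₀ R1)
    (h : β → β →₀ R1) (T : α → α →₀ R1) : α → α →₀ R1 :=
  cmul Ψ (cmul h (cmul Φ T)) + cmul (mE Ψ) (cmul Φ T) + cmul (mE G) (cmul k T)

/-- An exact identity in characteristic two whose right side collects every defect: each summand
contains one factor that tends to zero in the application. Modulo these defects the three terms of
`theta` contribute ΨE(H)ΦT, then ΨE(H)ΦT + E(G)ΨΦT, then E(G)[G, k]T, with sum E(G)T because ΨΦ +
[G, k] is the identity `p`, which fixes `T`. -/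
theorem com_theta (G : α → α →₀ R1) (H : β → β →₀ R1) (F : α → α →₀ R1) (Φ : α → β →₀ R1)
    (Ψ : β → α →₀ R1) (k : α → α →₀ R1) (h : β → β →₀ R1) (T p : α → α →₀ R1)
    (hp : cmul p T = T) :
    com G F (theta G Φ Ψ k h T) + cmul (mE G) T =
      cmul (com G H Ψ) (cmul h (cmul Φ T)) +
      cmul Ψ (cmul (com H H h + mE H) (cmul Φ T)) +
      cmul Ψ (cmul h (cmul (com H G Φ) T)) +
      cmul Ψ (cmul h (cmul Φ (com G F T))) +
      cmul (mE (com G H Ψ)) (cmul Φ T) +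
      cmul (mE Ψ) (cmul (com H G Φ) T) +
      cmul (mE Ψ) (cmul Φ (com G F T)) +
      cmul (mE (cmul G G)) (cmul k T) +
      cmul (mE G) (cmul (cmul Ψ Φ + (p + com G G k)) T) +
      cmul (mE G) (cmul k (com G F T)) := by
  rw [← sub_eq_zero]
  simp only [theta, com, mE_cmul, mE_add, cmul_add, add_cmul, cmul_assoc, hp]
  abel_nf
  simp only [two_zsmul_matrix, neg_zsmul, neg_zero, add_zero]

/-- The contraction exists on the finite model and is carried to `X` by the I₁-components of the
homotopy equivalence. -/
theorem exists_theta {X : TypeDSeq.{u} (Fin 2) K} (hX : IsAlexanderCobounded X)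
    (hf : IsHomotopyFinite X) :
    ∃ θ : ℕ → X.gen → X.gen →₀ R1, Good filT θ ∧
      (∀ n x y, θ n x y ≠ 0 → X.idem x = 0 ∧ X.idem y = 1) ∧
      Null filT (fun n => com (compG (X.δ n)) (mT (compF (X.δ n))) (θ n) +
        cmul (mE (compG (X.δ n))) (compT (X.δ n))) := by
  obtain ⟨Y, hfin, hY, φ, ψ, k, k', hφ, hψ, hk, -, dφ, dψ, hψφ, -⟩ := hf
  obtain ⟨hiX, hX'⟩ := isMorphism_iff_good.1 hX.morphism
  obtain ⟨-, hGX, -, hTX⟩ := good_iff_components.1 hX'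
  obtain ⟨-, hGY, -, -⟩ := good_iff_components.1 (isMorphism_iff_good.1 hY.morphism).2
  obtain ⟨hiφ, hφ'⟩ := isMorphism_iff_good.1 hφ
  obtain ⟨hiψ, hψ'⟩ := isMorphism_iff_good.1 hψ
  obtain ⟨-, hΦ, -, -⟩ := good_iff_components.1 hφ'
  obtain ⟨-, hΨ, -, -⟩ := good_iff_components.1 hψ'
  obtain ⟨-, hk', -, -⟩ := good_iff_components.1 (isMorphism_iff_good.1 hk).2
  obtain ⟨-, dΦ, -, -⟩ := null_iff_components.1 (cauchyEquiv_iff_null.1 dφ)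
  obtain ⟨-, dΨ, -, -⟩ := null_iff_components.1 (cauchyEquiv_iff_null.1 dψ)
  obtain ⟨-, hΨΦ, -, -⟩ := null_iff_components.1 (cauchyEquiv_iff_null.1 hψφ)
  obtain ⟨-, sqX, -, sqT⟩ := null_iff_components.1 (cauchyEquiv_iff_null.1 hX.square)
  obtain ⟨-, sqY, -, -⟩ := null_iff_components.1 (cauchyEquiv_iff_null.1 hY.square)
  let p : X.gen → X.gen →₀ R1 := diag fun x => (K.e (X.idem x)).g
  have dΦ' : Null filG (fun n => com (compG (Y.δ n)) (compG (X.δ n)) (compG (φ n))) := by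
    convert dΦ using 2 with n
    rw [Pi.zero_apply, sub_zero]
    exact ((compG_add _ _).trans (congrArg₂ _ (compG_cmul _ _) (compG_cmul _ _))).symm
  have dΨ' : Null filG (fun n => com (compG (X.δ n)) (compG (Y.δ n)) (compG (ψ n))) := by
    convert dΨ using 2 with n
    rw [Pi.zero_apply, sub_zero]
    exact ((compG_add _ _).trans (congrArg₂ _ (compG_cmul _ _) (compG_cmul _ _))).symm
  have hΨΦ' : Null filG (fun n => cmul (compG (ψ n)) (compG (φ n)) +
      (p + com (compG (X.δ n)) (compG (X.δ n)) (compG (k n)))) := by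
    convert hΨΦ using 2 with n
    rw [sub_eq_add_matrix, compG_add]
    refine congrArg₂ _ (compG_cmul _ _).symm ?_
    rw [Pi.add_apply, compG_add]
    refine congrArg₂ _ (mmap_diag K.projG.toAddMonoidHom fun x => K.e (X.idem x)).symm ?_
    exact ((compG_add _ _).trans (congrArg₂ _ (compG_cmul _ _) (compG_cmul _ _))).symm
  have sqX' : Null filG (fun n => cmul (compG (X.δ n)) (compG (X.δ n))) := by
    convert sqX using 2 with n
    rw [Pi.zero_apply, sub_zero]
    exact (compG_cmul _ _).symm
  have sqY' : Null filG (fun n => cmul (compG (Y.δ n)) (compG (Y.δ n))) := by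
    convert sqY using 2 with n
    rw [Pi.zero_apply, sub_zero]
    exact (compG_cmul _ _).symm
  have sqT' : Null filT (fun n => com (compG (X.δ n)) (mT (compF (X.δ n))) (compT (X.δ n))) := by
    convert sqT using 2 with n
    rw [Pi.zero_apply, sub_zero]
    exact (compT_cmul _ _).symm
  obtain ⟨h, hh, hnull⟩ := exists_null_com_add_euler hGY sqY'
  -- The matrix `p` is the identity on generators in I₁, where all coefficients of τ end.
  have hpT : ∀ n, cmul p (compT (X.δ n)) = compT (X.δ n) := fun n => by
    funext x; ext1 z
    rw [diag_cmul]
    by_cases hz : compT (X.δ n) x z = 0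
    · rw [hz, mul_zero]
    · rw [((idempotented_iff.1 (hiX n)).2.2.2 x z hz).2]
      simp [K.e]
  have gΦT : Good filT (fun n => cmul (compG (φ n)) (compT (X.δ n))) :=
    hΦ.cmul compat_filT hTX (by simp)
  -- Since `h` converges only for `filT`, the product rule with an absorbing left factor is
  -- unavailable; the finite basis of `Y` is used instead.
  have ghΦT : Good filT (fun n => cmul (h n) (cmul (compG (φ n)) (compT (X.δ n)))) :=
    (gΦT.tens isFiltration_filT hh).cmul_of_tens
  have gEΨ : Good filG (fun n => mE (compG (ψ n))) := Good.mE hΨ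
  have gEG : Good filG (fun n => mE (compG (X.δ n))) := Good.mE hGX
  have gkT : Good filT (fun n => cmul (compG (k n)) (compT (X.δ n))) :=
    hk'.cmul compat_filT hTX (by simp)
  refine ⟨fun n => theta (compG (X.δ n)) (compG (φ n)) (compG (ψ n)) (compG (k n)) (h n)
    (compT (X.δ n)), ?_, fun n x y hxy => ?_, ?_⟩
  · exact ((hΨ.cmul compat_filT ghΦT (by simp)).add (gEΨ.cmul compat_filT gΦT (by simp))).add
      (gEG.cmul compat_filT gkT (by simp))
  · have hT := fun y => (idempotented_iff.1 (hiX n)).2.2.2 x y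
    have hG := fun x => (idempotented_iff.1 (hiX n)).2.1 x y
    have hΨ := fun x => (idempotented_iff.1 (hiψ n)).2.1 x y
    have hE : ∀ {a : R1}, opEuler a ≠ 0 → a ≠ 0 := fun h h0 => h (by rw [h0, map_zero])
    have h3 : cmul (compG (ψ n)) (cmul (h n) (cmul (compG (φ n)) (compT (X.δ n)))) x y ≠ 0 ∨
        cmul (mE (compG (ψ n))) (cmul (compG (φ n)) (compT (X.δ n))) x y ≠ 0 ∨
        cmul (mE (compG (X.δ n))) (cmul (compG (k n)) (compT (X.δ n))) x y ≠ 0 := by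
      by_contra! hc
      exact hxy (by simp [theta, hc])
    rcases h3 with h3 | h3 | h3
    · obtain ⟨a, ha, h3⟩ := exists_of_cmul_ne_zero h3
      obtain ⟨b, -, h3⟩ := exists_of_cmul_ne_zero h3
      obtain ⟨c, -, h3⟩ := exists_of_cmul_ne_zero h3
      exact ⟨(hT c h3).1, (hΨ a ha).2⟩
    · obtain ⟨a, ha, h3⟩ := exists_of_cmul_ne_zero h3
      obtain ⟨b, -, h3⟩ := exists_of_cmul_ne_zero h3
      exact ⟨(hT b h3).1, (hΨ a (hE ha)).2⟩
    · obtain ⟨a, ha, h3⟩ := exists_of_cmul_ne_zero h3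
      obtain ⟨b, -, h3⟩ := exists_of_cmul_ne_zero h3
      exact ⟨(hT b h3).1, (hG a (hE ha)).2⟩
  · have hEq := fun n => com_theta (compG (X.δ n)) (compG (Y.δ n)) (mT (compF (X.δ n)))
      (compG (φ n)) (compG (ψ n)) (compG (k n)) (h n) (compT (X.δ n)) p (hpT n)
    simp only [hEq]
    have nΦT := dΦ'.cmul_left compat_filT (φ := fun n => compT (X.δ n)) (by simp)
    have nΦsq := hΦ.cmul_null compat_filT sqT' (by simp)
    refine ((((((((Null.add ?_ ?_).add ?_).add ?_).add ?_).add ?_).add ?_).add ?_).add ?_).add ?_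
    · exact dΨ'.cmul_left compat_filT (by simp)
    · exact hΨ.cmul_null compat_filT (gΦT.tens_null isFiltration_filT hnull).cmul_of_tens (by simp)
    · exact hΨ.cmul_null compat_filT (nΦT.tens_good isFiltration_filT hh).cmul_of_tens (by simp)
    · exact hΨ.cmul_null compat_filT (nΦsq.tens_good isFiltration_filT hh).cmul_of_tens (by simp)
    · exact (Null.mE dΨ').cmul_left compat_filT (by simp)
    · exact gEΨ.cmul_null compat_filT nΦT (by simp)
    · exact gEΨ.cmul_null compat_filT nΦsq (by simp)
    · exact (Null.mE sqX').cmul_left compat_filT (by simp)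
    · exact gEG.cmul_null compat_filT (hΨΦ'.cmul_left compat_filT (by simp)) (by simp)
    · exact gEG.cmul_null compat_filT (hk'.cmul_null compat_filT sqT' (by simp)) (by simp)

end Theta

/-! ### Supports of matrices -/

section Support

variable {α β γ α' β' ι ι' A : Type*}

/-- The nonzero entries lie in the columns of index type `a` and the rows of index type `b`. -/
def HasSupp [Zero A] (i : α → ι) (j : β → ι) (a b : ι) (φ : α → β →₀ A) : Prop :=
  ∀ x y, φ x y ≠ 0 → i x = a ∧ j y = b

variable {i : α → ι} {j : β → ι} {k : γ → ι} {a b c : ι}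

theorem HasSupp.add [AddZeroClass A] {φ ψ : α → β →₀ A} (h : HasSupp i j a b φ)
    (h' : HasSupp i j a b ψ) : HasSupp i j a b (φ + ψ) := fun x y hxy => by
  by_cases h0 : φ x y = 0
  · exact h' x y fun h1 => hxy (by simp [h0, h1])
  · exact h x y h0

theorem HasSupp.zero [AddZeroClass A] : HasSupp i j a b (0 : α → β →₀ A) :=
  fun _ _ h => (h rfl).elim

theorem HasSupp.mmap {B : Type*} [AddZeroClass A] [AddZeroClass B] {φ : α → β →₀ A}
    (h : HasSupp i j a b φ) (f : A →+ B) : HasSupp i j a b (mmap f φ) := fun x y hxy =>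
  h x y fun h0 => hxy (by rw [mmap_apply, h0, map_zero])

theorem HasSupp.cmul [NonUnitalNonAssocSemiring A] {ψ : β → γ →₀ A} {φ : α → β →₀ A} {b' : ι}
    (hψ : HasSupp j k b c ψ) (hφ : HasSupp i j a b' φ) : HasSupp i k a c (cmul ψ φ) :=
  fun x z hxz => by
    obtain ⟨y, h1, h2⟩ := exists_of_cmul_ne_zero hxz
    exact ⟨(hφ x y h2).1, (hψ y z h1).2⟩

theorem HasSupp.diag [Zero A] {d : α → A} (h : ∀ x, d x ≠ 0 → i x = a) :
    HasSupp i i a a (diag d) := fun x y hxy => by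
  classical
  by_cases hx : x = y
  · subst hx
    have : d x ≠ 0 := by simpa [KnotSurgery.diag] using hxy
    exact ⟨h x this, h x this⟩
  · exact (hxy (by simp [KnotSurgery.diag, hx])).elim

theorem HasSupp.tens [CommSemiring A] {i' : α' → ι'} {j' : β' → ι'} {a' b' : ι'}
    {φ : α → β →₀ A} {ψ : α' → β' →₀ A} (h : HasSupp i j a b φ) (h' : HasSupp i' j' a' b' ψ) :
    HasSupp (Prod.map i i') (Prod.map j j') (a, a') (b, b') (tens φ ψ) := fun x y hxy => by
  rw [tens_apply] at hxy
  obtain ⟨h1, h2⟩ := h _ _ (left_ne_zero_of_mul hxy)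
  obtain ⟨h3, h4⟩ := h' _ _ (right_ne_zero_of_mul hxy)
  exact ⟨Prod.ext h1 h3, Prod.ext h2 h4⟩

theorem HasSupp.cmul_diag [NonAssocSemiring A] {φ : α → β →₀ A} (h : HasSupp i j a b φ)
    {d : α → A} (hd : ∀ x, i x = a → d x = 1) :
    KnotSurgery.cmul φ (KnotSurgery.diag d) = φ := by
  funext x; ext1 y
  rw [KnotSurgery.cmul_diag]
  by_cases h0 : φ x y = 0
  · rw [h0, zero_mul]
  · rw [hd x (h x y h0).1, mul_one]

theorem HasSupp.diag_cmul [NonAssocSemiring A] {φ : α → β →₀ A} (h : HasSupp i j a b φ)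
    {d : β → A} (hd : ∀ y, j y = b → d y = 1) :
    KnotSurgery.cmul (KnotSurgery.diag d) φ = φ := by
  funext x; ext1 y
  rw [KnotSurgery.diag_cmul]
  by_cases h0 : φ x y = 0
  · rw [h0, mul_zero]
  · rw [hd y (h x y h0).2, one_mul]

end Support

/-! ### Assembling matrices over `𝒦` -/

section Assemble

variable {α β : Type*}

/-- The matrix over `𝒦` with given components. -/
def asm (F : α → β →₀ R0) (G S T : α → β →₀ R1) : α → β →₀ K := fun x =>
  (F x).mapRange (fun a => ⟨a, 0, 0, 0⟩) rfl + (G x).mapRange (fun a => ⟨0, a, 0, 0⟩) rfl +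
    (S x).mapRange (fun a => ⟨0, 0, a, 0⟩) rfl + (T x).mapRange (fun a => ⟨0, 0, 0, a⟩) rfl

theorem asm_apply (F : α → β →₀ R0) (G S T : α → β →₀ R1) (x : α) (y : β) :
    asm F G S T x y = ⟨F x y, G x y, S x y, T x y⟩ := by
  ext1 <;> simp [asm]

variable (F : α → β →₀ R0) (G S T : α → β →₀ R1)

@[simp] theorem compF_asm : compF (asm F G S T) = F := by
  funext x; ext1 y; simp [asm_apply]

@[simp] theorem compG_asm : compG (asm F G S T) = G := by
  funext x; ext1 y; simp [asm_apply]

@[simp] theorem compS_asm : compS (asm F G S T) = S := by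
  funext x; ext1 y; simp [asm_apply]

@[simp] theorem compT_asm : compT (asm F G S T) = T := by
  funext x; ext1 y; simp [asm_apply]

end Assemble

/-! ### The structure maps of box tensor products -/

section Iterate

variable {A M N B : Type*} [AddCommMonoid A] [AddCommMonoid M] [AddCommMonoid N]

theorem map_iterSum (f : M →+ N) (δ : B → B →₀ A) (c : B → List A → M) (j : ℕ) (as : List A)
    (x : B) : f (iterSum δ c j as x) = iterSum δ (fun y bs => f (c y bs)) j as x := by
  induction j generalizing as x with
  | zero => rfl
  | succ j ih =>
    simp only [iterSum, map_finsuppSum, ih]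

theorem iterSum_zero (δ : B → B →₀ A) (j : ℕ) (as : List A) (x : B) :
    iterSum δ (fun _ _ => (0 : M)) j as x = 0 := by
  induction j generalizing as x with
  | zero => rfl
  | succ j ih => simp only [iterSum, ih, Finsupp.sum_fun_zero]

theorem iterSum_congr (δ : B → B →₀ A) {c c' : B → List A → M} (j : ℕ) (as : List A) (x : B)
    (h : ∀ y bs, bs.length = as.length + j → c y bs = c' y bs) :
    iterSum δ c j as x = iterSum δ c' j as x := by
  induction j generalizing as x with
  | zero => exact h x as rfl
  | succ j ih =>
    simp only [iterSum]
    refine Finset.sum_congr rfl fun y _ => ih _ _ fun z bs hbs => h z bs ?_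
    rw [hbs, List.length_cons]
    omega

theorem sum_ite_eq_apply [DecidableEq B] (v : B →₀ A) (q : B) (f : A → M) (hf : f 0 = 0) :
    (v.sum fun z a => if z = q then f a else 0) = f (v q) := by
  rw [Finsupp.sum, Finset.sum_ite_eq']
  split_ifs with h
  · rfl
  · rw [Finsupp.notMem_support_iff.1 h, hf]

theorem cmul_mmap_apply {R : Type*} [CommSemiring R] {α β γ : Type*} (ψ : β → γ →₀ R) (l : A →+ R)
    (δ : α → β →₀ A) (x : α) (z : γ) :
    cmul ψ (mmap l δ) x z = (δ x).sum fun y a => ψ y z * l a := by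
  rw [cmul_apply]
  exact Finsupp.sum_mapRange_index (by simp)

variable {R : Type*} [CommSemiring R] [DecidableEq B] (δ : B → B →₀ A)

theorem iterSum_one (l : A →+ R) (c : List A → R) (hc : ∀ a, c [a] = l a) (x q : B) :
    iterSum δ (fun y as => if y = q then c as else 0) 1 [] x = mmap l δ x q := by
  simp only [iterSum, hc]
  exact sum_ite_eq_apply _ _ _ (map_zero l)

/-- An operation that is a product of functionals of its inputs turns iterates of `δ` into matrix
products; the head of the list is the latest input, hence the left factor. -/
theorem iterSum_two (l₂ l₁ : A →+ R) (c : List A → R) (hc : ∀ b a, c [b, a] = l₂ b * l₁ a)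
    (x q : B) :
    iterSum δ (fun y as => if y = q then c as else 0) 2 [] x =
      cmul (mmap l₂ δ) (mmap l₁ δ) x q := by
  simp only [iterSum, hc, cmul_mmap_apply]
  refine Finset.sum_congr rfl fun y _ => ?_
  exact sum_ite_eq_apply _ _ (fun b => l₂ b * _) (by simp)

theorem iterSum_four (l₄ l₃ l₂ l₁ : A →+ R) (c : List A → R)
    (hc : ∀ d c' b a, c [d, c', b, a] = l₄ d * l₃ c' * l₂ b * l₁ a) (x q : B) :
    iterSum δ (fun y as => if y = q then c as else 0) 4 [] x =
      cmul (cmul (cmul (mmap l₄ δ) (mmap l₃ δ)) (mmap l₂ δ)) (mmap l₁ δ) x q := by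
  simp only [iterSum, hc, cmul_mmap_apply]
  refine Finset.sum_congr rfl fun y _ => ?_
  simp only [Finsupp.sum, Finset.sum_mul]
  refine Finset.sum_congr rfl fun z _ => Finset.sum_congr rfl fun w _ => ?_
  exact sum_ite_eq_apply _ _ (fun b => l₄ b * _ * _ * _) (by simp)

end Iterate

/-- The basis of a box tensor product. -/
abbrev BoxGen (X : TypeDSeq.{u} (Fin 2 × Fin 2) KK) (M : DAOperations) : Type u :=
  {p : X.gen × M.gen // X.idem p.1 = M.left p.2}

/-- The structure maps of a box tensor product. -/
abbrev boxMap (X : TypeDSeq.{u} (Fin 2 × Fin 2) KK) (M : DAOperations) (n : ℕ) :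
    BoxGen X M → BoxGen X M →₀ K := (box X M).δ n

/-- Taking an entry is additive, so it passes through the iterates and leaves the test whether the
path ends at `q`. -/
theorem boxMap_apply {X : TypeDSeq.{u} (Fin 2 × Fin 2) KK} [DecidableEq X.gen]
    (M : DAOperations) (n : ℕ) (p q : BoxGen X M) :
    boxMap X M n p q = ∑ j ∈ Finset.range (M.maxInputs + 1),
      iterSum (X.δ n) (fun y as => if y = q.1.1 then M.op as p.1.2 q.1.2 else 0) j [] p.1.1 := by
  classical
  refine (map_sum (Finsupp.applyAddHom q : (BoxGen X M →₀ K) →+ K) _ _).trans ?_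
  refine Finset.sum_congr rfl fun j _ => ?_
  refine (map_iterSum (Finsupp.applyAddHom q : (BoxGen X M →₀ K) →+ K) ..).trans ?_
  congr 1
  funext y as
  rw [map_finsuppSum]
  by_cases hy : y = q.1.1
  · subst hy
    rw [if_pos rfl, Finsupp.sum, Finset.sum_eq_single q.1.2]
    · rw [dif_pos q.2]
      simp
    · intro m _ hm
      split_ifs
      · rw [Finsupp.applyAddHom_apply, Finsupp.single_eq_of_ne]
        exact fun h => hm (congrArg (fun r => r.1.2) h).symm
      · simp
    · intro h
      rw [dif_pos q.2, Finsupp.notMem_support_iff.1 h]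
      simp
  · rw [if_neg hy]
    refine Finset.sum_eq_zero fun m _ => ?_
    dsimp only
    split_ifs
    · rw [Finsupp.applyAddHom_apply, Finsupp.single_eq_of_ne]
      exact fun h => hy (congrArg (fun r => r.1.1) h).symm
    · simp

/-! ### Functionals applied to the external tensor product. -/

section External

variable {R : Type} [CommRing R] [Algebra (ZMod 2) R]

@[simp] theorem tensorMul_tmul (φ ψ : K →ₗ[ZMod 2] R) (a b : K) :
    tensorMul φ ψ (a ⊗ₜ b) = φ a * ψ b := by
  simp [tensorMul]

theorem mmap_extTensor (X : TypeDSeq.{u} (Fin 2) K) (Y : TypeDSeq.{v} (Fin 2) K) (n : ℕ)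
    (φ ψ : K →ₗ[ZMod 2] R) :
    mmap (tensorMul φ ψ).toAddMonoidHom ((extTensor X Y).δ n) =
      tens (mmap φ.toAddMonoidHom (X.δ n)) (diag fun y => ψ (K.e (Y.idem y))) +
      tens (diag fun x => φ (K.e (X.idem x))) (mmap ψ.toAddMonoidHom (Y.δ n)) := by
  classical
  funext p; ext1 q
  obtain ⟨p, p'⟩ := p
  obtain ⟨q, q'⟩ := q
  have h1 : ∀ v : X.gen →₀ K, tensorMul φ ψ ((v.sum fun x a =>
      Finsupp.single (x, p') (a ⊗ₜ[ZMod 2] K.e (Y.idem p'))) (q, q')) =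
      φ (v q) * diag (fun y => ψ (K.e (Y.idem y))) p' q' := fun v => by
    induction v using Finsupp.induction_linear with
    | zero => simp
    | add v w hv hw =>
      rw [Finsupp.sum_add_index' (by simp) (by simp [TensorProduct.add_tmul]), Finsupp.add_apply,
        map_add, hv, hw, Finsupp.add_apply, map_add, add_mul]
    | single x a =>
      rw [Finsupp.sum_single_index (by simp)]
      by_cases hx : x = q <;> by_cases hp : p' = q' <;>
        simp [diag, hx, hp]
  have h2 : ∀ v : Y.gen →₀ K, tensorMul φ ψ ((v.sum fun y b =>
      Finsupp.single (p, y) (K.e (X.idem p) ⊗ₜ[ZMod 2] b)) (q, q')) =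
      diag (fun x => φ (K.e (X.idem x))) p q * ψ (v q') := fun v => by
    induction v using Finsupp.induction_linear with
    | zero => simp
    | add v w hv hw =>
      rw [Finsupp.sum_add_index' (by simp) (by simp [TensorProduct.tmul_add]), Finsupp.add_apply,
        map_add, hv, hw, Finsupp.add_apply, map_add, mul_add]
    | single x a =>
      rw [Finsupp.sum_single_index (by simp)]
      by_cases hx : x = q' <;> by_cases hp : p = q <;>
        simp [diag, hx, hp]
  change tensorMul φ ψ (_ + _) = _
  refine (map_add _ _ _).trans ?_
  exact congrArg₂ (· + ·) ((h1 (X.δ n p)).trans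
    (tens_apply (mmap φ.toAddMonoidHom (X.δ n)) (diag fun y => ψ (K.e (Y.idem y))) (p, p')
      (q, q')).symm) ((h2 (Y.δ n p')).trans
    (tens_apply (diag fun x => φ (K.e (X.idem x))) (mmap ψ.toAddMonoidHom (Y.δ n)) (p, p')
      (q, q')).symm)

end External

/-! ### The merge and pair-of-pants tensor products in terms of components -/

section Total

variable {A B M N : Type*} [AddCommMonoid A] [AddCommMonoid M] [AddCommMonoid N]

/-- The entry at `(x, q)` of the sum over the iterates of `δ`, up to the fourth one, contracted
with the multilinear operations `c`. -/
def iterTotal [DecidableEq B] (δ : B → B →₀ A) (c : List A → M) (x q : B) : M :=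
  ∑ j ∈ Finset.range 5, iterSum δ (fun y as => if y = q then c as else 0) j [] x

variable (δ : B → B →₀ A)

theorem iterSum_add (c c' : B → List A → M) (j : ℕ) (as : List A) (x : B) :
    iterSum δ (fun y bs => c y bs + c' y bs) j as x = iterSum δ c j as x + iterSum δ c' j as x := by
  induction j generalizing as x with
  | zero => rfl
  | succ j ih => simp only [iterSum, ih, Finsupp.sum_add]

variable [DecidableEq B]

theorem map_iterTotal (f : M →+ N) (c : List A → M) (x q : B) :
    f (iterTotal δ c x q) = iterTotal δ (fun as => f (c as)) x q := by
  simp only [iterTotal, map_sum, map_iterSum, apply_ite f, map_zero]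

theorem iterTotal_add (c c' : List A → M) (x q : B) :
    iterTotal δ (fun as => c as + c' as) x q = iterTotal δ c x q + iterTotal δ c' x q := by
  rw [iterTotal, iterTotal, iterTotal, ← Finset.sum_add_distrib]
  refine Finset.sum_congr rfl fun j _ => ?_
  rw [← iterSum_add]
  congr 1
  funext y as
  split_ifs <;> simp

theorem iterTotal_eq_zero {c : List A → M} (h : ∀ as, c as = 0) (x q : B) :
    iterTotal δ c x q = 0 := by
  simp only [iterTotal, h, ite_self, iterSum_zero, Finset.sum_const_zero]

theorem iterSum_eq_zero_of_length {c : List A → M} (j : ℕ) (h : ∀ as, as.length = j → c as = 0)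
    (x q : B) : iterSum δ (fun y as => if y = q then c as else 0) j [] x = 0 := by
  rw [iterSum_congr δ (c' := fun _ _ => 0), iterSum_zero]
  intro y bs hbs
  rw [h bs (by simpa using hbs), ite_self]

variable {R : Type*} [CommSemiring R]

theorem iterTotal_one (l : A →+ R) (c : List A → R) (hc : ∀ a, c [a] = l a)
    (h0 : ∀ as, as.length ≠ 1 → c as = 0) (x q : B) : iterTotal δ c x q = mmap l δ x q := by
  rw [iterTotal, Finset.sum_eq_single 1, iterSum_one δ l c hc]
  · intro j _ hj
    exact iterSum_eq_zero_of_length δ j (fun as has => h0 as (has.trans_ne hj)) x q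
  · simp

theorem iterTotal_two (l₂ l₁ : A →+ R) (c : List A → R) (hc : ∀ b a, c [b, a] = l₂ b * l₁ a)
    (h0 : ∀ as, as.length ≠ 2 → c as = 0) (x q : B) :
    iterTotal δ c x q = cmul (mmap l₂ δ) (mmap l₁ δ) x q := by
  rw [iterTotal, Finset.sum_eq_single 2, iterSum_two δ l₂ l₁ c hc]
  · intro j _ hj
    exact iterSum_eq_zero_of_length δ j (fun as has => h0 as (has.trans_ne hj)) x q
  · simp

theorem iterTotal_four (l₄ l₃ l₂ l₁ : A →+ R) (c : List A → R)
    (hc : ∀ d c' b a, c [d, c', b, a] = l₄ d * l₃ c' * l₂ b * l₁ a)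
    (h0 : ∀ as, as.length ≠ 4 → c as = 0) (x q : B) :
    iterTotal δ c x q =
      cmul (cmul (cmul (mmap l₄ δ) (mmap l₃ δ)) (mmap l₂ δ)) (mmap l₁ δ) x q := by
  rw [iterTotal, Finset.sum_eq_single 4, iterSum_four δ l₄ l₃ l₂ l₁ c hc]
  · intro j _ hj
    exact iterSum_eq_zero_of_length δ j (fun as has => h0 as (has.trans_ne hj)) x q
  · simp

end Total

/-! ### The matrices entering the operations through each input. -/

section Slots

variable (X₁ : TypeDSeq.{u} (Fin 2) K) (X₂ : TypeDSeq.{v} (Fin 2) K) (n : ℕ)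

/-- The identity matrix of the generators in the idempotent `I₀`. -/
def one₀ (X : TypeDSeq.{u} (Fin 2) K) : X.gen → X.gen →₀ R0 := diag fun x => (K.e (X.idem x)).f

/-- The identity matrix of the generators in the idempotent `I₁`. -/
def one₁ (X : TypeDSeq.{u} (Fin 2) K) : X.gen → X.gen →₀ R1 := diag fun x => (K.e (X.idem x)).g

@[simp] theorem e_s (i : Fin 2) : (K.e i).s = 0 := by
  rcases fin2_cases i with h | h <;> simp [h, K.e]

@[simp] theorem e_t (i : Fin 2) : (K.e i).t = 0 := by
  rcases fin2_cases i with h | h <;> simp [h, K.e]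

theorem diag_zero {α A : Type*} [AddZeroClass A] : diag (fun _ : α => (0 : A)) = 0 := by
  funext x; simp [diag]

@[simp] theorem tens_zero {α β α' β' R : Type*} [CommSemiring R] (φ : α → β →₀ R) :
    tens φ (0 : α' → β' →₀ R) = 0 := by
  funext x; ext1 y; simp

@[simp] theorem zero_tens {α β α' β' R : Type*} [CommSemiring R] (φ : α' → β' →₀ R) :
    tens (0 : α → β →₀ R) φ = 0 := by
  funext x; ext1 y; simp

/-- The component in `I₀ 𝒦 I₀` of the differential of the tensor product. -/
def prodF : X₁.gen × X₂.gen → X₁.gen × X₂.gen →₀ R0 :=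
  tens (compF (X₁.δ n)) (one₀ X₂) + tens (one₀ X₁) (compF (X₂.δ n))

/-- The component in `I₁ 𝒦 I₁` of the differential of the tensor product. -/
def prodG : X₁.gen × X₂.gen → X₁.gen × X₂.gen →₀ R1 :=
  tens (compG (X₁.δ n)) (one₁ X₂) + tens (one₁ X₁) (compG (X₂.δ n))

/-- The coefficient of `σ` of the differential of the tensor product. -/
def prodS : X₁.gen × X₂.gen → X₁.gen × X₂.gen →₀ R1 :=
  tens (compS (X₁.δ n)) (compS (X₂.δ n))

/-- The coefficient of `τ` of the differential of the tensor product. -/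
def prodT : X₁.gen × X₂.gen → X₁.gen × X₂.gen →₀ R1 :=
  tens (compT (X₁.δ n)) (compT (X₂.δ n))

theorem mmap_prod0 :
    mmap prod0.toAddMonoidHom ((extTensor X₁ X₂).δ n) = prodF X₁ X₂ n :=
  mmap_extTensor X₁ X₂ n K.projF K.projF

theorem mmap_prod1 :
    mmap prod1.toAddMonoidHom ((extTensor X₁ X₂).δ n) = prodG X₁ X₂ n :=
  mmap_extTensor X₁ X₂ n K.projG K.projG

theorem mmap_opVinvPartialU_prod1 :
    mmap (opVinvPartialU ∘ₗ prod1).toAddMonoidHom ((extTensor X₁ X₂).δ n) =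
      mD (prodG X₁ X₂ n) := by
  rw [← mmap_prod1]
  funext x; ext1 y; rfl

theorem opEuler_e (i : Fin 2) : opEuler (K.e i).g = 0 := by
  rcases fin2_cases i with h | h <;> simp [h, K.e]

theorem mapI_one₀ (X : TypeDSeq.{u} (Fin 2) K) :
    (diag fun x => mapI (K.e (X.idem x)).f) = mI (one₀ X) := by
  classical
  funext x; ext1 y
  by_cases h : x = y <;> simp [one₀, diag, h]

theorem mapT_one₀ (X : TypeDSeq.{u} (Fin 2) K) :
    (diag fun x => mapT (K.e (X.idem x)).f) = mT (one₀ X) := by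
  classical
  funext x; ext1 y
  by_cases h : x = y <;> simp [one₀, diag, h]

/-- Idempotents have no coefficient of σ, so only one summand of δ⊗1 + 1⊗δ survives. The τ-inputs
below behave the same way. -/
theorem mmap_sigma₂ : mmap (tensorMul K.projS K.projG).toAddMonoidHom ((extTensor X₁ X₂).δ n) =
    tens (compS (X₁.δ n)) (one₁ X₂) := by
  refine (mmap_extTensor X₁ X₂ n K.projS K.projG).trans ?_
  simp only [show ∀ i, K.projS (K.e i) = 0 from e_s, diag_zero, zero_tens, add_zero]
  rfl

theorem mmap_sigma₁ :
    mmap (tensorMul (mapI.toLinearMap ∘ₗ K.projF) K.projS).toAddMonoidHom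
      ((extTensor X₁ X₂).δ n) = tens (mI (one₀ X₁)) (compS (X₂.δ n)) := by
  refine (mmap_extTensor X₁ X₂ n _ K.projS).trans ?_
  simp only [show ∀ i, K.projS (K.e i) = 0 from e_s, diag_zero, tens_zero, zero_add, ← mapI_one₀]
  rfl

theorem mmap_tau₂ : mmap (tensorMul K.projT K.projG).toAddMonoidHom ((extTensor X₁ X₂).δ n) =
    tens (compT (X₁.δ n)) (one₁ X₂) := by
  refine (mmap_extTensor X₁ X₂ n K.projT K.projG).trans ?_
  simp only [show ∀ i, K.projT (K.e i) = 0 from e_t, diag_zero, zero_tens, add_zero]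
  rfl

theorem mmap_tau₁ :
    mmap (tensorMul (mapT.toLinearMap ∘ₗ K.projF) K.projT).toAddMonoidHom
      ((extTensor X₁ X₂).δ n) = tens (mT (one₀ X₁)) (compT (X₂.δ n)) := by
  refine (mmap_extTensor X₁ X₂ n _ K.projT).trans ?_
  simp only [show ∀ i, K.projT (K.e i) = 0 from e_t, diag_zero, tens_zero, zero_add, ← mapT_one₀]
  rfl

theorem mmap_tauSwap₂ :
    mmap (tensorMul K.projG K.projT).toAddMonoidHom ((extTensor X₁ X₂).δ n) =
      tens (one₁ X₁) (compT (X₂.δ n)) := by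
  refine (mmap_extTensor X₁ X₂ n K.projG K.projT).trans ?_
  simp only [show ∀ i, K.projT (K.e i) = 0 from e_t, diag_zero, tens_zero, zero_add]
  rfl

theorem mmap_tauSwap₁ :
    mmap (tensorMul K.projT (mapT.toLinearMap ∘ₗ K.projF)).toAddMonoidHom
      ((extTensor X₁ X₂).δ n) = tens (compT (X₁.δ n)) (mT (one₀ X₂)) := by
  refine (mmap_extTensor X₁ X₂ n K.projT _).trans ?_
  simp only [show ∀ i, K.projT (K.e i) = 0 from e_t, diag_zero, zero_tens, add_zero, ← mapT_one₀]
  rfl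

/-- The derivation kills idempotents, so only the differential of the second factor remains. -/
theorem mmap_eulerRight : mmap eulerRight.toAddMonoidHom ((extTensor X₁ X₂).δ n) =
    tens (one₁ X₁) (mE (compG (X₂.δ n))) := by
  refine (mmap_extTensor X₁ X₂ n K.projG (opEuler ∘ₗ K.projG)).trans ?_
  simp only [show ∀ i, (opEuler ∘ₗ K.projG) (K.e i) = 0 from opEuler_e, diag_zero, tens_zero,
    zero_add]
  congr 1
  funext x; ext1 y; rfl

theorem mmap_eulerLeft : mmap eulerLeft.toAddMonoidHom ((extTensor X₁ X₂).δ n) =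
    tens (mE (compG (X₁.δ n))) (one₁ X₂) := by
  refine (mmap_extTensor X₁ X₂ n (opEuler ∘ₗ K.projG) K.projG).trans ?_
  simp only [show ∀ i, (opEuler ∘ₗ K.projG) (K.e i) = 0 from opEuler_e, diag_zero, zero_tens,
    add_zero]
  congr 1
  funext x; ext1 y; rfl

end Slots

/-! ### Supports and products of the components -/

section Idempotents

/-- All structure maps are compatible with the idempotents. -/
def IsIdem (X : TypeDSeq.{u} (Fin 2) K) : Prop := ∀ n, Idempotented X.idem X.idem (X.δ n)

variable {X : TypeDSeq.{u} (Fin 2) K} {Y : TypeDSeq.{v} (Fin 2) K}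

theorem IsIdem.suppF (h : IsIdem X) (n : ℕ) : HasSupp X.idem X.idem 0 0 (compF (X.δ n)) :=
  (idempotented_iff.1 (h n)).1

theorem IsIdem.suppG (h : IsIdem X) (n : ℕ) : HasSupp X.idem X.idem 1 1 (compG (X.δ n)) :=
  (idempotented_iff.1 (h n)).2.1

theorem IsIdem.suppS (h : IsIdem X) (n : ℕ) : HasSupp X.idem X.idem 0 1 (compS (X.δ n)) :=
  (idempotented_iff.1 (h n)).2.2.1

theorem IsIdem.suppT (h : IsIdem X) (n : ℕ) : HasSupp X.idem X.idem 0 1 (compT (X.δ n)) :=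
  (idempotented_iff.1 (h n)).2.2.2

theorem supp_one₀ (X : TypeDSeq.{u} (Fin 2) K) : HasSupp X.idem X.idem 0 0 (one₀ X) :=
  HasSupp.diag fun x hx => by
    rcases fin2_cases (X.idem x) with h | h
    · exact h
    · simp [h, K.e] at hx

theorem supp_one₁ (X : TypeDSeq.{u} (Fin 2) K) : HasSupp X.idem X.idem 1 1 (one₁ X) :=
  HasSupp.diag fun x hx => by
    rcases fin2_cases (X.idem x) with h | h
    · simp [h, K.e] at hx
    · exact h

theorem cmul_one₀ {α : Type*} {j : α → Fin 2} {b : Fin 2} {φ : X.gen → α →₀ R0}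
    (h : HasSupp X.idem j 0 b φ) : cmul φ (one₀ X) = φ :=
  h.cmul_diag fun x hx => by simp [hx, K.e]

theorem one₀_cmul {α : Type*} {j : α → Fin 2} {b : Fin 2} {φ : α → X.gen →₀ R0}
    (h : HasSupp j X.idem b 0 φ) : cmul (one₀ X) φ = φ :=
  h.diag_cmul fun x hx => by simp [hx, K.e]

theorem cmul_one₁ {α : Type*} {j : α → Fin 2} {b : Fin 2} {φ : X.gen → α →₀ R1}
    (h : HasSupp X.idem j 1 b φ) : cmul φ (one₁ X) = φ :=
  h.cmul_diag fun x hx => by simp [hx, K.e]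

theorem one₁_cmul {α : Type*} {j : α → Fin 2} {b : Fin 2} {φ : α → X.gen →₀ R1}
    (h : HasSupp j X.idem b 1 φ) : cmul (one₁ X) φ = φ :=
  h.diag_cmul fun x hx => by simp [hx, K.e]

theorem cmul_mI_one₀ {α : Type*} {j : α → Fin 2} {b : Fin 2} {φ : X.gen → α →₀ R1}
    (h : HasSupp X.idem j 0 b φ) : cmul φ (mI (one₀ X)) = φ := by
  rw [← mapI_one₀]
  exact h.cmul_diag fun x hx => by simp [hx, K.e]

theorem cmul_mT_one₀ {α : Type*} {j : α → Fin 2} {b : Fin 2} {φ : X.gen → α →₀ R1}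
    (h : HasSupp X.idem j 0 b φ) : cmul φ (mT (one₀ X)) = φ := by
  rw [← mapT_one₀]
  exact h.cmul_diag fun x hx => by simp [hx, K.e]

variable {X₁ : TypeDSeq.{u} (Fin 2) K} {X₂ : TypeDSeq.{v} (Fin 2) K}

theorem sigma_product (h₁ : IsIdem X₁) (h₂ : IsIdem X₂) (n : ℕ) :
    cmul (tens (compS (X₁.δ n)) (one₁ X₂)) (tens (mI (one₀ X₁)) (compS (X₂.δ n))) =
      prodS X₁ X₂ n := by
  rw [cmul_tens, cmul_mI_one₀ (h₁.suppS n), one₁_cmul (h₂.suppS n), prodS]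

theorem tau_product (h₁ : IsIdem X₁) (h₂ : IsIdem X₂) (n : ℕ) :
    cmul (tens (compT (X₁.δ n)) (one₁ X₂)) (tens (mT (one₀ X₁)) (compT (X₂.δ n))) =
      prodT X₁ X₂ n := by
  rw [cmul_tens, cmul_mT_one₀ (h₁.suppT n), one₁_cmul (h₂.suppT n), prodT]

/-- Crossing τ in the first factor before the second gives the same Kronecker product as the other
order. -/
theorem tauSwap_product (h₁ : IsIdem X₁) (h₂ : IsIdem X₂) (n : ℕ) :
    cmul (tens (one₁ X₁) (compT (X₂.δ n))) (tens (compT (X₁.δ n)) (mT (one₀ X₂))) =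
      prodT X₁ X₂ n := by
  rw [cmul_tens, cmul_mT_one₀ (h₂.suppT n), one₁_cmul (h₁.suppT n), prodT]

/-- The factor `(1 ⊗ E(G)) ∘ (T ⊗ T)` of the additional operation of `W_r`. -/
def pantsR (X₁ : TypeDSeq.{u} (Fin 2) K) (X₂ : TypeDSeq.{v} (Fin 2) K) (n : ℕ) :
    X₁.gen × X₂.gen → X₁.gen × X₂.gen →₀ R1 :=
  tens (compT (X₁.δ n)) (cmul (mE (compG (X₂.δ n))) (compT (X₂.δ n)))

/-- The factor `(E(G) ⊗ 1) ∘ (T ⊗ T)` of the additional operation of `W_l`. -/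
def pantsL (X₁ : TypeDSeq.{u} (Fin 2) K) (X₂ : TypeDSeq.{v} (Fin 2) K) (n : ℕ) :
    X₁.gen × X₂.gen → X₁.gen × X₂.gen →₀ R1 :=
  tens (cmul (mE (compG (X₁.δ n))) (compT (X₁.δ n))) (compT (X₂.δ n))

theorem pantsR_product (h₁ : IsIdem X₁) (n : ℕ) :
    cmul (tens (one₁ X₁) (mE (compG (X₂.δ n)))) (prodT X₁ X₂ n) = pantsR X₁ X₂ n := by
  rw [prodT, cmul_tens, one₁_cmul (h₁.suppT n), pantsR]

theorem pantsL_product (h₂ : IsIdem X₂) (n : ℕ) :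
    cmul (tens (mE (compG (X₁.δ n))) (one₁ X₂)) (prodT X₁ X₂ n) = pantsL X₁ X₂ n := by
  rw [prodT, cmul_tens, one₁_cmul (h₂.suppT n), pantsL]

end Idempotents

/-! ### The structure maps of the three tensor products -/

section Formulas

variable {X₁ : TypeDSeq.{u} (Fin 2) K} {X₂ : TypeDSeq.{v} (Fin 2) K}

theorem suppPF (h₁ : IsIdem X₁) (h₂ : IsIdem X₂) (n : ℕ) :
    HasSupp (Prod.map X₁.idem X₂.idem) (Prod.map X₁.idem X₂.idem) (0, 0) (0, 0)
      (prodF X₁ X₂ n) :=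
  ((h₁.suppF n).tens (supp_one₀ X₂)).add ((supp_one₀ X₁).tens (h₂.suppF n))

theorem suppPG (h₁ : IsIdem X₁) (h₂ : IsIdem X₂) (n : ℕ) :
    HasSupp (Prod.map X₁.idem X₂.idem) (Prod.map X₁.idem X₂.idem) (1, 1) (1, 1)
      (prodG X₁ X₂ n) :=
  ((h₁.suppG n).tens (supp_one₁ X₂)).add ((supp_one₁ X₁).tens (h₂.suppG n))

theorem suppPS (h₁ : IsIdem X₁) (h₂ : IsIdem X₂) (n : ℕ) :
    HasSupp (Prod.map X₁.idem X₂.idem) (Prod.map X₁.idem X₂.idem) (0, 0) (1, 1)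
      (prodS X₁ X₂ n) := (h₁.suppS n).tens (h₂.suppS n)

theorem suppPT (h₁ : IsIdem X₁) (h₂ : IsIdem X₂) (n : ℕ) :
    HasSupp (Prod.map X₁.idem X₂.idem) (Prod.map X₁.idem X₂.idem) (0, 0) (1, 1)
      (prodT X₁ X₂ n) := (h₁.suppT n).tens (h₂.suppT n)

theorem suppPR (h₁ : IsIdem X₁) (h₂ : IsIdem X₂) (n : ℕ) :
    HasSupp (Prod.map X₁.idem X₂.idem) (Prod.map X₁.idem X₂.idem) (0, 0) (1, 1)
      (pantsR X₁ X₂ n) := (h₁.suppT n).tens (((h₂.suppG n).mmap _).cmul (h₂.suppT n))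

theorem suppPL (h₁ : IsIdem X₁) (h₂ : IsIdem X₂) (n : ℕ) :
    HasSupp (Prod.map X₁.idem X₂.idem) (Prod.map X₁.idem X₂.idem) (0, 0) (1, 1)
      (pantsL X₁ X₂ n) := (((h₁.suppG n).mmap _).cmul (h₁.suppT n)).tens (h₂.suppT n)

/-- The pairs of generators in the same idempotent. -/
abbrev PairGen (X₁ : TypeDSeq.{u} (Fin 2) K) (X₂ : TypeDSeq.{v} (Fin 2) K) : Type (max u v) :=
  {p : (X₁.gen × X₂.gen) × Fin 2 // (X₁.idem p.1.1, X₂.idem p.1.2) = (p.2, p.2)}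

/-- The inclusion of the pairs of generators in the same idempotent into all pairs. -/
def pairEmb (X₁ : TypeDSeq.{u} (Fin 2) K) (X₂ : TypeDSeq.{v} (Fin 2) K) :
    PairGen X₁ X₂ ↪ X₁.gen × X₂.gen where
  toFun p := p.1.1
  inj' p q h := by
    refine Subtype.ext (Prod.ext h ?_)
    have hp := congrArg Prod.fst p.2
    have hq := congrArg Prod.fst q.2
    simp only at hp hq
    rw [← hp, ← hq]
    exact congrArg (fun r => X₁.idem r.1) h

theorem mem_range_pairEmb {q : X₁.gen × X₂.gen} (i : Fin 2)
    (h : Prod.map X₁.idem X₂.idem q = (i, i)) : q ∈ Set.range (pairEmb X₁ X₂) :=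
  ⟨⟨(q, i), h⟩, rfl⟩

theorem eq_zero_of_idem {A : Type*} [Zero A] {φ : X₁.gen × X₂.gen → X₁.gen × X₂.gen →₀ A}
    {a b : Fin 2}
    (h : HasSupp (Prod.map X₁.idem X₂.idem) (Prod.map X₁.idem X₂.idem) (a, a) (b, b) φ)
    (p q : PairGen X₁ X₂) (hpq : ¬ (p.1.2 = a ∧ q.1.2 = b)) : φ p.1.1 q.1.1 = 0 := by
  by_contra h0
  obtain ⟨h1, h2⟩ := h _ _ h0
  exact hpq ⟨congrArg Prod.fst (p.2.symm.trans h1), congrArg Prod.fst (q.2.symm.trans h2)⟩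

theorem mergeOp_f (as : List KK) (m m' : Fin 2) : (mergeOp as m m').f =
    if m = 0 ∧ m' = 0 then (match as with | [x] => prod0 x | _ => 0) else 0 := by
  rcases as with _ | ⟨a, _ | ⟨b, _ | ⟨c, as⟩⟩⟩ <;>
    rcases fin2_cases m with rfl | rfl <;> rcases fin2_cases m' with rfl | rfl <;>
    simp [mergeOp]

theorem mergeOp_g (as : List KK) (m m' : Fin 2) : (mergeOp as m m').g =
    if m = 1 ∧ m' = 1 then (match as with | [x] => prod1 x | _ => 0) else 0 := by
  rcases as with _ | ⟨a, _ | ⟨b, _ | ⟨c, as⟩⟩⟩ <;>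
    rcases fin2_cases m with rfl | rfl <;> rcases fin2_cases m' with rfl | rfl <;>
    simp [mergeOp]

theorem mergeOp_s (as : List KK) (m m' : Fin 2) : (mergeOp as m m').s =
    if m = 0 ∧ m' = 1 then (match as with | [x, y] => sigmaPair x y | _ => 0) else 0 := by
  rcases as with _ | ⟨a, _ | ⟨b, _ | ⟨c, as⟩⟩⟩ <;>
    rcases fin2_cases m with rfl | rfl <;> rcases fin2_cases m' with rfl | rfl <;>
    simp [mergeOp]

theorem mergeOp_t (as : List KK) (m m' : Fin 2) : (mergeOp as m m').t =
    if m = 0 ∧ m' = 1 then (match as with | [x, y] => tauPair x y | _ => 0) else 0 := by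
  rcases as with _ | ⟨a, _ | ⟨b, _ | ⟨c, as⟩⟩⟩ <;>
    rcases fin2_cases m with rfl | rfl <;> rcases fin2_cases m' with rfl | rfl <;>
    simp [mergeOp]

theorem pantsOpR_apply (as : List KK) (m m' : Fin 2) : pantsOpR as m m' =
    ⟨0, 0, 0, if m = 0 ∧ m' = 1 then (match as with
      | [x, y, z, w] => opVinvPartialU (prod1 x) * eulerRight y * tauPairSwap z w
      | _ => 0) else 0⟩ := by
  rcases as with _ | ⟨a, _ | ⟨b, _ | ⟨c, _ | ⟨d, _ | ⟨e, as⟩⟩⟩⟩⟩ <;>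
    rcases fin2_cases m with rfl | rfl <;> rcases fin2_cases m' with rfl | rfl <;>
    simp [pantsOpR] <;> rfl

theorem pantsOpL_apply (as : List KK) (m m' : Fin 2) : pantsOpL as m m' =
    ⟨0, 0, 0, if m = 0 ∧ m' = 1 then (match as with
      | [x, y, z, w] => opVinvPartialU (prod1 x) * eulerLeft y * tauPair z w
      | _ => 0) else 0⟩ := by
  rcases as with _ | ⟨a, _ | ⟨b, _ | ⟨c, _ | ⟨d, _ | ⟨e, as⟩⟩⟩⟩⟩ <;>
    rcases fin2_cases m with rfl | rfl <;> rcases fin2_cases m' with rfl | rfl <;>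
    simp [pantsOpL] <;> rfl

end Formulas

/-! ### Explicit structure matrices of the three box tensor products. -/

section BoxFormulas

theorem iterTotal_if {A B M : Type*} [AddCommMonoid A] [AddCommMonoid M] [DecidableEq B]
    (δ : B → B →₀ A) (P : Prop) [Decidable P] (c : List A → M) (x q : B) :
    iterTotal δ (fun as => if P then c as else 0) x q = if P then iterTotal δ c x q else 0 := by
  split_ifs
  · rfl
  · exact iterTotal_eq_zero δ (fun _ => rfl) x q

variable {B : Type*} [DecidableEq B] (δ : B → B →₀ KK)

theorem iterTotal_mergeOp (m m' : Fin 2) (x q : B) :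
    iterTotal δ (fun as => mergeOp as m m') x q =
      ⟨if m = 0 ∧ m' = 0 then mmap prod0.toAddMonoidHom δ x q else 0,
       if m = 1 ∧ m' = 1 then mmap prod1.toAddMonoidHom δ x q else 0,
       if m = 0 ∧ m' = 1 then cmul (mmap (tensorMul K.projS K.projG).toAddMonoidHom δ)
        (mmap (tensorMul (mapI.toLinearMap ∘ₗ K.projF) K.projS).toAddMonoidHom δ) x q else 0,
       if m = 0 ∧ m' = 1 then cmul (mmap (tensorMul K.projT K.projG).toAddMonoidHom δ)
        (mmap (tensorMul (mapT.toLinearMap ∘ₗ K.projF) K.projT).toAddMonoidHom δ) x q else 0⟩ := by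
  ext1
  · refine (map_iterTotal δ K.projF.toAddMonoidHom _ x q).trans ?_
    change iterTotal δ (fun as => (mergeOp as m m').f) x q = _
    simp only [mergeOp_f]
    rw [iterTotal_if]
    congr 1
    refine iterTotal_one δ prod0.toAddMonoidHom _ (fun _ => rfl) ?_ _ _
    rintro (_ | ⟨a, _ | ⟨b, as⟩⟩) has <;> first | rfl | simp at has
  · refine (map_iterTotal δ K.projG.toAddMonoidHom _ x q).trans ?_
    change iterTotal δ (fun as => (mergeOp as m m').g) x q = _
    simp only [mergeOp_g]
    rw [iterTotal_if]
    congr 1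
    refine iterTotal_one δ prod1.toAddMonoidHom _ (fun _ => rfl) ?_ _ _
    rintro (_ | ⟨a, _ | ⟨b, as⟩⟩) has <;> first | rfl | simp at has
  · refine (map_iterTotal δ K.projS.toAddMonoidHom _ x q).trans ?_
    change iterTotal δ (fun as => (mergeOp as m m').s) x q = _
    simp only [mergeOp_s]
    rw [iterTotal_if]
    congr 1
    refine iterTotal_two δ _ _ _ (fun _ _ => rfl) ?_ _ _
    rintro (_ | ⟨a, _ | ⟨b, _ | ⟨c, as⟩⟩⟩) has <;> first | rfl | simp at has
  · refine (map_iterTotal δ K.projT.toAddMonoidHom _ x q).trans ?_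
    change iterTotal δ (fun as => (mergeOp as m m').t) x q = _
    simp only [mergeOp_t]
    rw [iterTotal_if]
    congr 1
    refine iterTotal_two δ _ _ _ (fun _ _ => rfl) ?_ _ _
    rintro (_ | ⟨a, _ | ⟨b, _ | ⟨c, as⟩⟩⟩) has <;> first | rfl | simp at has

/-- The inclusion of the coefficients of `τ`. -/
def inT : R1 →+ K where
  toFun a := ⟨0, 0, 0, a⟩
  map_zero' := rfl
  map_add' a b := by ext1 <;> simp

theorem iterTotal_pantsOpR (m m' : Fin 2) (x q : B) :
    iterTotal δ (fun as => pantsOpR as m m') x q = ⟨0, 0, 0, if m = 0 ∧ m' = 1 then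
      cmul (cmul (cmul (mmap (opVinvPartialU ∘ₗ prod1).toAddMonoidHom δ)
        (mmap eulerRight.toAddMonoidHom δ))
        (mmap (tensorMul K.projG K.projT).toAddMonoidHom δ))
        (mmap (tensorMul K.projT (mapT.toLinearMap ∘ₗ K.projF)).toAddMonoidHom δ) x q else 0⟩ := by
  simp only [pantsOpR_apply]
  refine (map_iterTotal δ inT _ x q).symm.trans (congrArg inT ?_)
  rw [iterTotal_if]
  congr 1
  refine iterTotal_four δ _ _ _ _ _ (fun _ _ _ _ => (mul_assoc _ _ _).symm) ?_ _ _
  rintro (_ | ⟨a, _ | ⟨b, _ | ⟨c, _ | ⟨d, _ | ⟨e, as⟩⟩⟩⟩⟩) has <;> first | rfl | simp at has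

theorem iterTotal_pantsOpL (m m' : Fin 2) (x q : B) :
    iterTotal δ (fun as => pantsOpL as m m') x q = ⟨0, 0, 0, if m = 0 ∧ m' = 1 then
      cmul (cmul (cmul (mmap (opVinvPartialU ∘ₗ prod1).toAddMonoidHom δ)
        (mmap eulerLeft.toAddMonoidHom δ))
        (mmap (tensorMul K.projT K.projG).toAddMonoidHom δ))
        (mmap (tensorMul (mapT.toLinearMap ∘ₗ K.projF) K.projT).toAddMonoidHom δ) x q else 0⟩ := by
  simp only [pantsOpL_apply]
  refine (map_iterTotal δ inT _ x q).symm.trans (congrArg inT ?_)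
  rw [iterTotal_if]
  congr 1
  refine iterTotal_four δ _ _ _ _ _ (fun _ _ _ _ => (mul_assoc _ _ _).symm) ?_ _ _
  rintro (_ | ⟨a, _ | ⟨b, _ | ⟨c, _ | ⟨d, _ | ⟨e, as⟩⟩⟩⟩⟩) has <;> first | rfl | simp at has

variable {X₁ : TypeDSeq.{u} (Fin 2) K} {X₂ : TypeDSeq.{v} (Fin 2) K}

/-- The idempotent tests built into the operations are redundant: the matrices already vanish
elsewhere. -/
theorem ite_idem {A : Type*} [Zero A] {φ ψ : X₁.gen × X₂.gen → X₁.gen × X₂.gen →₀ A}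
    {a b : Fin 2}
    (h : HasSupp (Prod.map X₁.idem X₂.idem) (Prod.map X₁.idem X₂.idem) (a, a) (b, b) φ)
    (p q : PairGen X₁ X₂) (hψ : ψ = φ) :
    (if p.1.2 = a ∧ q.1.2 = b then ψ p.1.1 q.1.1 else 0) = φ p.1.1 q.1.1 := by
  split_ifs with hpq
  · rw [hψ]
  · exact (eq_zero_of_idem h p q hpq).symm

theorem suppDPR (h₁ : IsIdem X₁) (h₂ : IsIdem X₂) (n : ℕ) :
    HasSupp (Prod.map X₁.idem X₂.idem) (Prod.map X₁.idem X₂.idem) (0, 0) (1, 1)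
      (cmul (mD (prodG X₁ X₂ n)) (pantsR X₁ X₂ n)) :=
  ((suppPG h₁ h₂ n).mmap _).cmul (suppPR h₁ h₂ n)

theorem suppDPL (h₁ : IsIdem X₁) (h₂ : IsIdem X₂) (n : ℕ) :
    HasSupp (Prod.map X₁.idem X₂.idem) (Prod.map X₁.idem X₂.idem) (0, 0) (1, 1)
      (cmul (mD (prodG X₁ X₂ n)) (pantsL X₁ X₂ n)) :=
  ((suppPG h₁ h₂ n).mmap _).cmul (suppPL h₁ h₂ n)

theorem pantsR_cmul (h₁ : IsIdem X₁) (h₂ : IsIdem X₂) (n : ℕ) :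
    cmul (cmul (cmul (mD (prodG X₁ X₂ n)) (tens (one₁ X₁) (mE (compG (X₂.δ n)))))
      (tens (one₁ X₁) (compT (X₂.δ n)))) (tens (compT (X₁.δ n)) (mT (one₀ X₂))) =
      cmul (mD (prodG X₁ X₂ n)) (pantsR X₁ X₂ n) := by
  rw [cmul_assoc, cmul_assoc, tauSwap_product h₁ h₂, pantsR_product h₁]

theorem pantsL_cmul (h₁ : IsIdem X₁) (h₂ : IsIdem X₂) (n : ℕ) :
    cmul (cmul (cmul (mD (prodG X₁ X₂ n)) (tens (mE (compG (X₁.δ n))) (one₁ X₂)))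
      (tens (compT (X₁.δ n)) (one₁ X₂))) (tens (mT (one₀ X₁)) (compT (X₂.δ n))) =
      cmul (mD (prodG X₁ X₂ n)) (pantsL X₁ X₂ n) := by
  rw [cmul_assoc, cmul_assoc, tau_product h₁ h₂, pantsL_product h₂]

/-- The matrix of the merge tensor product. -/
def mergeMap (X₁ : TypeDSeq.{u} (Fin 2) K) (X₂ : TypeDSeq.{v} (Fin 2) K)
    (T : ℕ → X₁.gen × X₂.gen → X₁.gen × X₂.gen →₀ R1) (n : ℕ) :
    PairGen X₁ X₂ → PairGen X₁ X₂ →₀ K :=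
  asm (res (pairEmb X₁ X₂) (prodF X₁ X₂ n)) (res (pairEmb X₁ X₂) (prodG X₁ X₂ n))
    (res (pairEmb X₁ X₂) (prodS X₁ X₂ n)) (res (pairEmb X₁ X₂) (T n))

/-- Operations with more inputs than allowed vanish, so all three bimodules can be summed over up to
four inputs. -/
theorem box_eq {M : DAOperations} (hM : M.maxInputs ≤ 4) {X : TypeDSeq.{u} (Fin 2 × Fin 2) KK}
    [DecidableEq X.gen] {δ : ℕ → BoxGen X M → BoxGen X M →₀ K}
    (h : ∀ n p q, iterTotal (X.δ n) (fun as => M.op as p.1.2 q.1.2) p.1.1 q.1.1 = δ n p q) :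
    box X M = ⟨BoxGen X M, fun p => M.right p.1.2, δ⟩ := by
  refine congrArg (TypeDSeq.mk (ι := Fin 2) (A := K) (BoxGen X M) (fun p => M.right p.1.2)) ?_
  funext n p
  refine Finsupp.ext fun q => ?_
  refine (boxMap_apply M n p q).trans (Eq.trans ?_ (h n p q))
  refine Finset.sum_subset (Finset.range_mono (by omega)) fun j _ hj => ?_
  refine iterSum_eq_zero_of_length _ j (fun as has => ?_) _ _
  rw [M.op_eq_zero as _ (by simp at hj; omega)]
  rfl

theorem mergeMap_apply (n : ℕ) (p q : PairGen X₁ X₂)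
    (T : ℕ → X₁.gen × X₂.gen → X₁.gen × X₂.gen →₀ R1) :
    mergeMap X₁ X₂ T n p q = ⟨prodF X₁ X₂ n p.1.1 q.1.1, prodG X₁ X₂ n p.1.1 q.1.1,
      prodS X₁ X₂ n p.1.1 q.1.1, T n p.1.1 q.1.1⟩ := asm_apply ..

section Entries

variable [DecidableEq (X₁.gen × X₂.gen)] (n : ℕ) (p q : PairGen X₁ X₂)

theorem iterTotal_merge_box (h₁ : IsIdem X₁) (h₂ : IsIdem X₂) :
    iterTotal (B := X₁.gen × X₂.gen) ((extTensor X₁ X₂).δ n) (fun as => mergeOp as p.1.2 q.1.2)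
      p.1.1 q.1.1 = ⟨prodF X₁ X₂ n p.1.1 q.1.1, prodG X₁ X₂ n p.1.1 q.1.1,
        prodS X₁ X₂ n p.1.1 q.1.1, prodT X₁ X₂ n p.1.1 q.1.1⟩ := by
  refine (iterTotal_mergeOp _ _ _ _ _).trans (K.ext ?_ ?_ ?_ ?_)
  · exact ite_idem (suppPF h₁ h₂ n) p q (mmap_prod0 X₁ X₂ n)
  · exact ite_idem (suppPG h₁ h₂ n) p q (mmap_prod1 X₁ X₂ n)
  · exact ite_idem (suppPS h₁ h₂ n) p q ((congrArg₂ cmul (mmap_sigma₂ X₁ X₂ n)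
      (mmap_sigma₁ X₁ X₂ n)).trans (sigma_product h₁ h₂ n))
  · exact ite_idem (suppPT h₁ h₂ n) p q ((congrArg₂ cmul (mmap_tau₂ X₁ X₂ n)
      (mmap_tau₁ X₁ X₂ n)).trans (tau_product h₁ h₂ n))

theorem iterTotal_pantsR_box (h₁ : IsIdem X₁) (h₂ : IsIdem X₂) :
    iterTotal (B := X₁.gen × X₂.gen) ((extTensor X₁ X₂).δ n) (fun as => pantsOpR as p.1.2 q.1.2)
      p.1.1 q.1.1 = ⟨0, 0, 0, cmul (mD (prodG X₁ X₂ n)) (pantsR X₁ X₂ n) p.1.1 q.1.1⟩ := by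
  refine (iterTotal_pantsOpR _ _ _ _ _).trans (congrArg inT ?_)
  refine ite_idem (suppDPR h₁ h₂ n) p q ?_
  refine (congrArg₂ cmul (congrArg₂ cmul (congrArg₂ cmul (mmap_opVinvPartialU_prod1 X₁ X₂ n)
    (mmap_eulerRight X₁ X₂ n)) (mmap_tauSwap₂ X₁ X₂ n)) (mmap_tauSwap₁ X₁ X₂ n)).trans
    (pantsR_cmul h₁ h₂ n)

theorem iterTotal_pantsL_box (h₁ : IsIdem X₁) (h₂ : IsIdem X₂) :
    iterTotal (B := X₁.gen × X₂.gen) ((extTensor X₁ X₂).δ n) (fun as => pantsOpL as p.1.2 q.1.2)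
      p.1.1 q.1.1 = ⟨0, 0, 0, cmul (mD (prodG X₁ X₂ n)) (pantsL X₁ X₂ n) p.1.1 q.1.1⟩ := by
  refine (iterTotal_pantsOpL _ _ _ _ _).trans (congrArg inT ?_)
  refine ite_idem (suppDPL h₁ h₂ n) p q ?_
  refine (congrArg₂ cmul (congrArg₂ cmul (congrArg₂ cmul (mmap_opVinvPartialU_prod1 X₁ X₂ n)
    (mmap_eulerLeft X₁ X₂ n)) (mmap_tau₂ X₁ X₂ n)) (mmap_tau₁ X₁ X₂ n)).trans
    (pantsL_cmul h₁ h₂ n)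

end Entries

theorem box_mergeM2 (h₁ : IsIdem X₁) (h₂ : IsIdem X₂) :
    box (extTensor X₁ X₂) mergeM2 =
      ⟨PairGen X₁ X₂, fun p => p.1.2, mergeMap X₁ X₂ (prodT X₁ X₂)⟩ := by
  have inst : DecidableEq (X₁.gen × X₂.gen) := fun _ _ => Classical.propDecidable _
  refine @box_eq mergeM2 (by decide) (extTensor X₁ X₂) inst (mergeMap X₁ X₂ (prodT X₁ X₂)) ?_
  intro n p q
  exact (iterTotal_merge_box n p q h₁ h₂).trans (mergeMap_apply n p q _).symm

theorem box_pantsWr (h₁ : IsIdem X₁) (h₂ : IsIdem X₂) :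
    box (extTensor X₁ X₂) pantsWr = ⟨PairGen X₁ X₂, fun p => p.1.2, mergeMap X₁ X₂
      fun n => prodT X₁ X₂ n + cmul (mD (prodG X₁ X₂ n)) (pantsR X₁ X₂ n)⟩ := by
  have inst : DecidableEq (X₁.gen × X₂.gen) := fun _ _ => Classical.propDecidable _
  refine @box_eq pantsWr (by decide) (extTensor X₁ X₂) inst (mergeMap X₁ X₂ _) ?_
  intro n p q
  refine Eq.trans (iterTotal_add (B := X₁.gen × X₂.gen) ((extTensor X₁ X₂).δ n)
    (fun as => mergeOp as p.1.2 q.1.2) (fun as => pantsOpR as p.1.2 q.1.2) _ _) ?_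
  refine (congrArg₂ (· + ·) (iterTotal_merge_box n p q h₁ h₂)
    (iterTotal_pantsR_box n p q h₁ h₂)).trans (Eq.trans ?_ (mergeMap_apply n p q _).symm)
  ext1 <;> simp

theorem box_pantsWl (h₁ : IsIdem X₁) (h₂ : IsIdem X₂) :
    box (extTensor X₁ X₂) pantsWl = ⟨PairGen X₁ X₂, fun p => p.1.2, mergeMap X₁ X₂
      fun n => prodT X₁ X₂ n + cmul (mD (prodG X₁ X₂ n)) (pantsL X₁ X₂ n)⟩ := by
  have inst : DecidableEq (X₁.gen × X₂.gen) := fun _ _ => Classical.propDecidable _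
  refine @box_eq pantsWl (by decide) (extTensor X₁ X₂) inst (mergeMap X₁ X₂ _) ?_
  intro n p q
  refine Eq.trans (iterTotal_add (B := X₁.gen × X₂.gen) ((extTensor X₁ X₂).δ n)
    (fun as => mergeOp as p.1.2 q.1.2) (fun as => pantsOpL as p.1.2 q.1.2) _ _) ?_
  refine (congrArg₂ (· + ·) (iterTotal_merge_box n p q h₁ h₂)
    (iterTotal_pantsL_box n p q h₁ h₂)).trans (Eq.trans ?_ (mergeMap_apply n p q _).symm)
  ext1 <;> simp

end BoxFormulas

/-! ### Alexander cobounded structures in terms of components -/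

section Cobounded

variable {β : Type*}

/-- The conditions on the components of an Alexander cobounded structure, apart from the
idempotents. -/
structure CoboundedData (F : ℕ → β → β →₀ R0) (G S T : ℕ → β → β →₀ R1) : Prop where
  goodF : Good filF F
  goodG : Good filG G
  goodS : Good filS S
  goodT : Good filT T
  sqF : Null filF fun n => cmul (F n) (F n)
  sqG : Null filG fun n => cmul (G n) (G n)
  sqS : Null filS fun n => com (G n) (mI (F n)) (S n)
  sqT : Null filT fun n => com (G n) (mT (F n)) (T n)

theorem IsAlexanderCobounded.isIdem {X : TypeDSeq.{u} (Fin 2) K} (hX : IsAlexanderCobounded X) :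
    IsIdem X := (isMorphism_iff_good.1 hX.morphism).1

theorem IsAlexanderCobounded.coboundedData {X : TypeDSeq.{u} (Fin 2) K}
    (hX : IsAlexanderCobounded X) :
    CoboundedData (fun n => compF (X.δ n)) (fun n => compG (X.δ n)) (fun n => compS (X.δ n))
      (fun n => compT (X.δ n)) := by
  obtain ⟨hF, hG, hS, hT⟩ := good_iff_components.1 (isMorphism_iff_good.1 hX.morphism).2
  obtain ⟨sF, sG, sS, sT⟩ := null_iff_components.1 (cauchyEquiv_iff_null.1 hX.square)
  refine ⟨hF, hG, hS, hT, ?_, ?_, ?_, ?_⟩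
  · convert sF using 2 with n
    rw [Pi.zero_apply, sub_zero]
    exact (compF_cmul _ _).symm
  · convert sG using 2 with n
    rw [Pi.zero_apply, sub_zero]
    exact (compG_cmul _ _).symm
  · convert sS using 2 with n
    rw [Pi.zero_apply, sub_zero]
    exact (compS_cmul _ _).symm
  · convert sT using 2 with n
    rw [Pi.zero_apply, sub_zero]
    exact (compT_cmul _ _).symm

variable {B : Type u} {i : B → Fin 2} {F : ℕ → B → B →₀ R0} {G S T T' η : ℕ → B → B →₀ R1}

/-- By the multiplication of `K`, the four components of the squared assembled matrix are exactly
the four expressions assumed null. -/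
theorem CoboundedData.isAlexanderCobounded (h : CoboundedData F G S T)
    (hF : ∀ n, HasSupp i i 0 0 (F n)) (hG : ∀ n, HasSupp i i 1 1 (G n))
    (hS : ∀ n, HasSupp i i 0 1 (S n)) (hT : ∀ n, HasSupp i i 0 1 (T n)) :
    IsAlexanderCobounded ⟨B, i, fun n => asm (F n) (G n) (S n) (T n)⟩ := by
  refine ⟨isMorphism_iff_good.2 ⟨fun n => idempotented_iff.2 ?_, good_iff_components.2 ?_⟩,
    cauchyEquiv_iff_null.2 (null_iff_components.2 ?_)⟩
  · simp only [compF_asm, compG_asm, compS_asm, compT_asm]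
    exact ⟨hF n, hG n, hS n, hT n⟩
  · simp only [compF_asm, compG_asm, compS_asm, compT_asm]
    exact ⟨h.goodF, h.goodG, h.goodS, h.goodT⟩
  · have e : ∀ n, compSeq (X := ⟨B, i, fun n => asm (F n) (G n) (S n) (T n)⟩)
        (Y := ⟨B, i, fun n => asm (F n) (G n) (S n) (T n)⟩)
        (Z := ⟨B, i, fun n => asm (F n) (G n) (S n) (T n)⟩)
        (fun n => asm (F n) (G n) (S n) (T n)) (fun n => asm (F n) (G n) (S n) (T n)) n -
          (0 : ℕ → B → B →₀ K) n =
        cmul (asm (F n) (G n) (S n) (T n)) (asm (F n) (G n) (S n) (T n)) := fun n => by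
      rw [Pi.zero_apply, sub_zero]; rfl
    refine ⟨?_, ?_, ?_, ?_⟩
    · convert h.sqF using 2 with n
      exact (congrArg compF (e n)).trans (by rw [compF_cmul, compF_asm])
    · convert h.sqG using 2 with n
      exact (congrArg compG (e n)).trans (by rw [compG_cmul, compG_asm])
    · convert h.sqS using 2 with n
      exact (congrArg compS (e n)).trans (by
        rw [compS_cmul, compF_asm, compG_asm, compS_asm, com])
    · convert h.sqT using 2 with n
      exact (congrArg compT (e n)).trans (by
        rw [compT_cmul, compF_asm, compG_asm, compT_asm, com])

theorem CoboundedData.res {A : Type*} (h : CoboundedData F G S T) (π : A ↪ B)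
    (hF : ∀ n p y, F n (π p) y ≠ 0 → y ∈ Set.range π)
    (hG : ∀ n p y, G n (π p) y ≠ 0 → y ∈ Set.range π)
    (hS : ∀ n p y, S n (π p) y ≠ 0 → y ∈ Set.range π)
    (hT : ∀ n p y, T n (π p) y ≠ 0 → y ∈ Set.range π) :
    CoboundedData (fun n => res π (F n)) (fun n => res π (G n)) (fun n => res π (S n))
      (fun n => res π (T n)) := by
  have hFI : ∀ n p y, mI (F n) (π p) y ≠ 0 → y ∈ Set.range π := fun n p y h0 =>
    hF n p y fun h1 => h0 (by simp [h1])
  have hFT : ∀ n p y, mT (F n) (π p) y ≠ 0 → y ∈ Set.range π := fun n p y h0 =>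
    hF n p y fun h1 => h0 (by simp [h1])
  refine ⟨h.goodF.res π, h.goodG.res π, h.goodS.res π, h.goodT.res π, ?_, ?_, ?_, ?_⟩
  · simpa only [cmul_res π _ _ (hF _)] using h.sqF.res π
  · simpa only [cmul_res π _ _ (hG _)] using h.sqG.res π
  · convert h.sqS.res π using 2 with n
    rw [com, com, res_add, ← cmul_res π _ _ (hS n), ← cmul_res π _ _ (hFI n), mI, mI, mmap_res]
  · convert h.sqT.res π using 2 with n
    rw [com, com, res_add, ← cmul_res π _ _ (hT n), ← cmul_res π _ _ (hFT n), mT, mT, mmap_res]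

/-- The matrix `1 + η * τ`. -/
def shear (i : B → Fin 2) (η : B → B →₀ R1) : B → B →₀ K :=
  asm (diag fun x => (K.e (i x)).f) (diag fun x => (K.e (i x)).g) 0 η

theorem com_diag {A : Type*} [Ring A] [CharP A 2] {φ : B → B →₀ A} {a b : Fin 2}
    (h : HasSupp i i a b φ) {d d' : B → A} (hd : ∀ x, i x = a → d x = 1)
    (hd' : ∀ x, i x = b → d' x = 1) : cmul φ (diag d) + cmul (diag d') φ = 0 := by
  rw [h.cmul_diag hd, h.diag_cmul hd', add_self_matrix]

theorem e_zero_f {x : B} (h : i x = 0) : (K.e (i x)).f = 1 := by simp [h, K.e]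

theorem e_one_g {x : B} (h : i x = 1) : (K.e (i x)).g = 1 := by simp [h, K.e]

theorem mI_diag (d : B → R0) : mI (diag d) = diag fun x => mapI (d x) := by
  classical
  funext x; ext1 y
  by_cases h : x = y <;> simp [diag, h]

theorem mT_diag (d : B → R0) : mT (diag d) = diag fun x => mapT (d x) := by
  classical
  funext x; ext1 y
  by_cases h : x = y <;> simp [diag, h]

/-- The identity parts of the shear commute with `F`, `G`, `S` and cancel in characteristic two,
leaving only the coefficient of τ. -/
theorem cmul_shear {F : B → B →₀ R0} {G S T T' η : B → B →₀ R1}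
    (hF : HasSupp i i 0 0 F) (hG : HasSupp i i 1 1 G)
    (hS : HasSupp i i 0 1 S) (hT : HasSupp i i 0 1 T) (hT' : HasSupp i i 0 1 T') :
    cmul (asm F G S T') (shear i η) + cmul (shear i η) (asm F G S T) =
      asm 0 0 0 (com G (mT F) η + (T + T')) := by
  refine matrix_ext ?_ ?_ ?_ ?_
  · rw [compF_add, compF_cmul, compF_cmul, shear]
    simp only [compF_asm]
    exact com_diag hF (fun _ => e_zero_f) (fun _ => e_zero_f)
  · rw [compG_add, compG_cmul, compG_cmul, shear]
    simp only [compG_asm]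
    exact com_diag hG (fun _ => e_one_g) (fun _ => e_one_g)
  · rw [compS_add, compS_cmul, compS_cmul, shear]
    simp only [compG_asm, compF_asm, compS_asm, cmul_zero, zero_cmul, add_zero, zero_add, mI_diag]
    exact com_diag hS (fun x hx => by simp [e_zero_f hx]) (fun _ => e_one_g)
  · rw [compT_add, compT_cmul, compT_cmul, shear]
    simp only [compG_asm, compF_asm, compT_asm, mT_diag]
    rw [hT'.cmul_diag (fun x hx => by simp [e_zero_f hx]), hT.diag_cmul fun _ => e_one_g, com]
    abel

/-- Products of two τ-terms vanish, and the two cross terms are equal, hence cancel. -/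
theorem shear_cmul_shear {η : B → B →₀ R1} (hη : HasSupp i i 0 1 η) :
    cmul (shear i η) (shear i η) = diag fun x => K.e (i x) := by
  have he : ∀ x, K.e (i x) = ⟨(K.e (i x)).f, (K.e (i x)).g, 0, 0⟩ := fun x => by
    rcases fin2_cases (i x) with h | h <;> simp [h, K.e]
  have hd : (diag fun x => K.e (i x)) =
      asm (diag fun x => (K.e (i x)).f) (diag fun x => (K.e (i x)).g) 0 0 := by
    classical
    funext x; ext1 y
    rw [asm_apply]
    by_cases h : x = y
    · subst h
      simpa [diag] using he x
    · simp only [diag, Finsupp.single_eq_of_ne' h]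
      rfl
  have hf : HasSupp i i 0 0 (diag fun x => (K.e (i x)).f) := HasSupp.diag fun x hx => by
    rcases fin2_cases (i x) with h | h
    · exact h
    · simp [h, K.e] at hx
  have hg : HasSupp i i 1 1 (diag fun x => (K.e (i x)).g) := HasSupp.diag fun x hx => by
    rcases fin2_cases (i x) with h | h
    · simp [h, K.e] at hx
    · exact h
  rw [hd]
  refine matrix_ext ?_ ?_ ?_ ?_
  · rw [compF_cmul, shear, compF_asm, compF_asm]
    exact hf.cmul_diag fun _ => e_zero_f
  · rw [compG_cmul, shear, compG_asm, compG_asm]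
    exact hg.cmul_diag fun _ => e_one_g
  · rw [compS_cmul, shear, compS_asm, compS_asm, cmul_zero, zero_cmul, add_zero]
  · rw [compT_cmul, shear, compT_asm, compT_asm, compF_asm, compG_asm, mT_diag, add_comm]
    exact com_diag hη (fun x hx => by simp [e_zero_f hx]) (fun _ => e_one_g)

theorem isMorphism_shear {δ δ' : ℕ → B → B →₀ K} (hη : Good filT η)
    (hη' : ∀ n, HasSupp i i 0 1 (η n)) :
    IsMorphism (X := ⟨B, i, δ⟩) (Y := ⟨B, i, δ'⟩) (fun n => shear i (η n)) := by
  refine isMorphism_iff_good.2 ⟨fun n => idempotented_iff.2 ?_, good_iff_components.2 ?_⟩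
  · simp only [shear, compF_asm, compG_asm, compS_asm, compT_asm]
    exact ⟨supp_one₀ ⟨B, i, δ⟩, supp_one₁ ⟨B, i, δ⟩, HasSupp.zero, hη' n⟩
  · simp only [shear, compF_asm, compG_asm, compS_asm, compT_asm]
    exact ⟨Good.diag _, Good.diag _, Good.zero, hη⟩

theorem isMorphism_zero {X : TypeDSeq.{u} (Fin 2) K} {Y : TypeDSeq.{v} (Fin 2) K} :
    IsMorphism (X := X) (Y := Y) 0 :=
  isMorphism_iff_good.2 ⟨fun n x y => by simp, Good.zero⟩

theorem null_asm {T : ℕ → B → B →₀ R1} (hT : Null filT T) :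
    Null filK fun n => asm 0 0 0 (T n) := by
  refine null_iff_components.2 ?_
  simp only [compF_asm, compG_asm, compS_asm, compT_asm]
  exact ⟨Null.zero, Null.zero, Null.zero, hT⟩

theorem homotopyEquivalent_shear (hF : ∀ n, HasSupp i i 0 0 (F n))
    (hG : ∀ n, HasSupp i i 1 1 (G n)) (hS : ∀ n, HasSupp i i 0 1 (S n))
    (hT : ∀ n, HasSupp i i 0 1 (T n)) (hT' : ∀ n, HasSupp i i 0 1 (T' n)) (hη : Good filT η)
    (hη' : ∀ n, HasSupp i i 0 1 (η n))
    (h : Null filT fun n => com (G n) (mT (F n)) (η n) + (T n + T' n)) :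
    HomotopyEquivalent ⟨B, i, fun n => asm (F n) (G n) (S n) (T n)⟩
      ⟨B, i, fun n => asm (F n) (G n) (S n) (T' n)⟩ := by
  have hd : ∀ {δ : ℕ → B → B →₀ K} {φ : ℕ → B → B →₀ K},
      (∀ n, φ n = diag fun x => K.e (i x)) →
      CauchyEquiv (X := ⟨B, i, δ⟩) (Y := ⟨B, i, δ⟩) φ (idSeq ⟨B, i, δ⟩ + dMor 0) :=
    fun {δ φ} hφ => cauchyEquiv_iff_null.2 fun y m => ⟨0, fun n _ x => by
      have : (φ n - (idSeq ⟨B, i, δ⟩ + dMor 0 : MapSeq ⟨B, i, δ⟩ ⟨B, i, δ⟩) n) = 0 := by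
        rw [hφ n, sub_eq_zero]
        change _ = (diag fun x => K.e (i x)) + (cmul (δ n) 0 + cmul 0 (δ n))
        rw [cmul_zero, zero_cmul, add_zero, add_zero]
      exact Eq.mpr (congrArg (fun r : B → B →₀ K => r x y ∈ filK m) this) (filK m).zero_mem⟩
  refine ⟨fun n => shear i (η n), fun n => shear i (η n), 0, 0, isMorphism_shear hη hη',
    isMorphism_shear hη hη', isMorphism_zero, isMorphism_zero, ?_, ?_,
    hd fun n => shear_cmul_shear (hη' n), hd fun n => shear_cmul_shear (hη' n)⟩
  · refine cauchyEquiv_iff_null.2 ?_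
    convert null_asm h using 2 with n
    rw [Pi.zero_apply, sub_zero]
    exact cmul_shear (hF n) (hG n) (hS n) (hT n) (hT' n)
  · refine cauchyEquiv_iff_null.2 ?_
    convert null_asm h using 2 with n
    rw [Pi.zero_apply, sub_zero]
    refine (cmul_shear (hF n) (hG n) (hS n) (hT' n) (hT n)).trans ?_
    rw [add_comm (T' n)]

end Cobounded

/-! ### The components of the tensor products -/

section Products

variable {X₁ : TypeDSeq.{u} (Fin 2) K} {X₂ : TypeDSeq.{v} (Fin 2) K}

/-- The cross terms F₁⊗F₂ occur twice and cancel. -/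
theorem prodF_sq (h₁ : IsIdem X₁) (h₂ : IsIdem X₂) (n : ℕ) :
    cmul (prodF X₁ X₂ n) (prodF X₁ X₂ n) =
      tens (cmul (compF (X₁.δ n)) (compF (X₁.δ n))) (one₀ X₂) +
      tens (one₀ X₁) (cmul (compF (X₂.δ n)) (compF (X₂.δ n))) := by
  rw [← sub_eq_zero]
  simp only [prodF, cmul_add, add_cmul, cmul_tens, cmul_one₀ (h₁.suppF n),
    cmul_one₀ (h₂.suppF n), one₀_cmul (h₁.suppF n), one₀_cmul (h₂.suppF n),
    cmul_one₀ (supp_one₀ _)]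
  abel_nf
  simp only [two_zsmul_matrix]

theorem prodG_sq (h₁ : IsIdem X₁) (h₂ : IsIdem X₂) (n : ℕ) :
    cmul (prodG X₁ X₂ n) (prodG X₁ X₂ n) =
      tens (cmul (compG (X₁.δ n)) (compG (X₁.δ n))) (one₁ X₂) +
      tens (one₁ X₁) (cmul (compG (X₂.δ n)) (compG (X₂.δ n))) := by
  rw [← sub_eq_zero]
  simp only [prodG, cmul_add, add_cmul, cmul_tens, cmul_one₁ (h₁.suppG n),
    cmul_one₁ (h₂.suppG n), one₁_cmul (h₁.suppG n), one₁_cmul (h₂.suppG n),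
    cmul_one₁ (supp_one₁ _)]
  abel_nf
  simp only [two_zsmul_matrix]

theorem com_mI_tens {a : X₁.gen → X₁.gen →₀ R1} {b : X₂.gen → X₂.gen →₀ R1}
    (ha : HasSupp X₁.idem X₁.idem 0 1 a) (hb : HasSupp X₂.idem X₂.idem 0 1 b) (n : ℕ) :
    com (prodG X₁ X₂ n) (mI (prodF X₁ X₂ n)) (tens a b) =
      tens (com (compG (X₁.δ n)) (mI (compF (X₁.δ n))) a) b +
      tens a (com (compG (X₂.δ n)) (mI (compF (X₂.δ n))) b) := by
  have hm : mI (prodF X₁ X₂ n) = tens (mI (compF (X₁.δ n))) (mI (one₀ X₂)) +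
      tens (mI (one₀ X₁)) (mI (compF (X₂.δ n))) :=
    (mmap_add ..).trans (congrArg₂ _ (mmap_tens _ (map_mul mapI) ..)
      (mmap_tens _ (map_mul mapI) ..))
  simp only [hm, prodG, com, cmul_add, add_cmul, cmul_tens, tens_add, add_tens,
    cmul_mI_one₀ ha, cmul_mI_one₀ hb, one₁_cmul ha, one₁_cmul hb]
  abel

/-- The supports of `a` and `b` make the identity matrices in `prodG` and `prodF` act trivially,
which leaves the Leibniz rule. -/
theorem com_mT_tens {a : X₁.gen → X₁.gen →₀ R1} {b : X₂.gen → X₂.gen →₀ R1}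
    (ha : HasSupp X₁.idem X₁.idem 0 1 a) (hb : HasSupp X₂.idem X₂.idem 0 1 b) (n : ℕ) :
    com (prodG X₁ X₂ n) (mT (prodF X₁ X₂ n)) (tens a b) =
      tens (com (compG (X₁.δ n)) (mT (compF (X₁.δ n))) a) b +
      tens a (com (compG (X₂.δ n)) (mT (compF (X₂.δ n))) b) := by
  have hm : mT (prodF X₁ X₂ n) = tens (mT (compF (X₁.δ n))) (mT (one₀ X₂)) +
      tens (mT (one₀ X₁)) (mT (compF (X₂.δ n))) :=
    (mmap_add ..).trans (congrArg₂ _ (mmap_tens _ (map_mul mapT) ..)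
      (mmap_tens _ (map_mul mapT) ..))
  simp only [hm, prodG, com, cmul_add, add_cmul, cmul_tens, tens_add, add_tens,
    cmul_mT_one₀ ha, cmul_mT_one₀ hb, one₁_cmul ha, one₁_cmul hb]
  abel

theorem coboundedData_prod (hX₁ : IsAlexanderCobounded X₁) (hX₂ : IsAlexanderCobounded X₂) :
    CoboundedData (prodF X₁ X₂) (prodG X₁ X₂) (prodS X₁ X₂) (prodT X₁ X₂) := by
  have h₁ := hX₁.isIdem
  have h₂ := hX₂.isIdem
  have d₁ := hX₁.coboundedData
  have d₂ := hX₂.coboundedData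
  refine ⟨?_, ?_, ?_, ?_, ?_, ?_, ?_, ?_⟩
  · exact (d₁.goodF.tens isFiltration_filF (Good.diag _)).add
      (Good.tens isFiltration_filF (Good.diag _) d₂.goodF)
  · exact (d₁.goodG.tens isFiltration_filG (Good.diag _)).add
      (Good.tens isFiltration_filG (Good.diag _) d₂.goodG)
  · exact d₁.goodS.tens isFiltration_filS d₂.goodS
  · exact d₁.goodT.tens isFiltration_filT d₂.goodT
  · simp only [prodF_sq h₁ h₂]
    exact (d₁.sqF.tens_good isFiltration_filF (Good.diag _)).add
      (Good.tens_null isFiltration_filF (Good.diag _) d₂.sqF)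
  · simp only [prodG_sq h₁ h₂]
    exact (d₁.sqG.tens_good isFiltration_filG (Good.diag _)).add
      (Good.tens_null isFiltration_filG (Good.diag _) d₂.sqG)
  · simp only [prodS, com_mI_tens (h₁.suppS _) (h₂.suppS _)]
    exact (d₁.sqS.tens_good isFiltration_filS d₂.goodS).add
      (d₁.goodS.tens_null isFiltration_filS d₂.sqS)
  · simp only [prodT, com_mT_tens (h₁.suppT _) (h₂.suppT _)]
    exact (d₁.sqT.tens_good isFiltration_filT d₂.goodT).add
      (d₁.goodT.tens_null isFiltration_filT d₂.sqT)

/-- The conditions on `Y` under which adding `V⁻¹ ∂_U(G) * Y` to the coefficient of `τ` is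
undone by the automorphism given by `Θ`. -/
structure IsPants {β : Type*} (i : β → Fin 2 × Fin 2) (F : ℕ → β → β →₀ R0)
    (G Y Θ : ℕ → β → β →₀ R1) : Prop where
  goodY : Good filT Y
  suppY : ∀ n, HasSupp i i (0, 0) (1, 1) (Y n)
  nullY : Null filT fun n => com (G n) (mT (F n)) (Y n)
  goodΘ : Good filT Θ
  suppΘ : ∀ n, HasSupp i i (0, 0) (1, 1) (Θ n)
  nullΘ : Null filT fun n => com (G n) (mT (F n)) (Θ n) + Y n

/-- Differentiating G² gives the commutator of G with D(G); thus D(G) commutes with G as far as G²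
vanishes. -/
theorem com_mD_cmul {β : Type*} (F : β → β →₀ R0) (G Y : β → β →₀ R1) :
    com G (mT F) (cmul (mD G) Y) = cmul (mD (cmul G G)) Y + cmul (mD G) (com G (mT F) Y) := by
  rw [com_cmul G G, mD_cmul, com, add_comm (cmul G (mD G))]

theorem CoboundedData.add_pants {β : Type*} {i : β → Fin 2 × Fin 2} {F : ℕ → β → β →₀ R0}
    {G S T Y Θ : ℕ → β → β →₀ R1} (h : CoboundedData F G S T) (hY : IsPants i F G Y Θ) :
    CoboundedData F G S fun n => T n + cmul (mD (G n)) (Y n) := by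
  refine ⟨h.goodF, h.goodG, h.goodS, h.goodT.add (h.goodG.mD.cmul compat_filT hY.goodY (by simp)),
    h.sqF, h.sqG, h.sqS, ?_⟩
  simp only [com_add, com_mD_cmul]
  exact h.sqT.add ((h.sqG.mD.cmul_left compat_filT (by simp)).add
    (h.goodG.mD.cmul_null compat_filT hY.nullY (by simp)))

theorem IsPants.null_com {β : Type*} {i : β → Fin 2 × Fin 2} {F : ℕ → β → β →₀ R0}
    {G S T Y Θ : ℕ → β → β →₀ R1} (h : CoboundedData F G S T) (hY : IsPants i F G Y Θ) :
    Null filT fun n => com (G n) (mT (F n)) (cmul (mD (G n)) (Θ n)) +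
      (T n + cmul (mD (G n)) (Y n) + T n) := by
  have e : ∀ n, com (G n) (mT (F n)) (cmul (mD (G n)) (Θ n)) +
      (T n + cmul (mD (G n)) (Y n) + T n) = cmul (mD (cmul (G n) (G n))) (Θ n) +
        cmul (mD (G n)) (com (G n) (mT (F n)) (Θ n) + Y n) := fun n => by
    rw [com_mD_cmul, cmul_add, add_right_comm (T n), add_self_matrix, zero_add, add_assoc]
  simp only [e]
  exact (h.sqG.mD.cmul_left compat_filT (by simp)).add
    (h.goodG.mD.cmul_null compat_filT hY.nullΘ (by simp))

/-- E(G) commutes with G up to E(G²), and T is a cycle up to a null sequence. -/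
theorem null_com_euler {X : TypeDSeq.{u} (Fin 2) K} (hX : IsAlexanderCobounded X) :
    Null filT fun n => com (compG (X.δ n)) (mT (compF (X.δ n)))
      (cmul (mE (compG (X.δ n))) (compT (X.δ n))) := by
  have d := hX.coboundedData
  have e : ∀ n, com (compG (X.δ n)) (mT (compF (X.δ n)))
      (cmul (mE (compG (X.δ n))) (compT (X.δ n))) =
      cmul (mE (cmul (compG (X.δ n)) (compG (X.δ n)))) (compT (X.δ n)) +
      cmul (mE (compG (X.δ n))) (com (compG (X.δ n)) (mT (compF (X.δ n))) (compT (X.δ n))) :=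
    fun n => by
      rw [com_cmul _ (compG (X.δ n)), mE_cmul, com, add_comm (cmul (compG (X.δ n)) _)]
  simp only [e]
  exact ((Null.mE d.sqG).cmul_left compat_filT (by simp)).add
    (Good.cmul_null compat_filT (Good.mE d.goodG) d.sqT (by simp))

theorem exists_isPants_right (hX₁ : IsAlexanderCobounded X₁) (hX₂ : IsAlexanderCobounded X₂)
    (hf₂ : IsHomotopyFinite X₂) : ∃ Θ, IsPants (Prod.map X₁.idem X₂.idem) (prodF X₁ X₂)
      (prodG X₁ X₂) (pantsR X₁ X₂) Θ := by
  have h₁ := hX₁.isIdem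
  have h₂ := hX₂.isIdem
  have d₁ := hX₁.coboundedData
  have d₂ := hX₂.coboundedData
  obtain ⟨θ, hθ, sθ, nθ⟩ := exists_theta hX₂ hf₂
  have gE : Good filT fun n => cmul (mE (compG (X₂.δ n))) (compT (X₂.δ n)) :=
    Good.cmul compat_filT (Good.mE d₂.goodG) d₂.goodT (by simp)
  -- Tensoring θ with the cycle T₁ contracts T₁ ⊗ E(G₂)T₂, by the Leibniz rule.
  refine ⟨fun n => tens (compT (X₁.δ n)) (θ n), d₁.goodT.tens isFiltration_filT gE,
    suppPR h₁ h₂, ?_, d₁.goodT.tens isFiltration_filT hθ, fun n => (h₁.suppT n).tens (sθ n), ?_⟩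
  · have e := fun n => com_mT_tens (h₁.suppT n) (((h₂.suppG n).mmap opEuler.toAddMonoidHom).cmul
      (h₂.suppT n)) n
    refine Eq.mpr (congrArg (Null filT) (funext e)) ?_
    exact (d₁.sqT.tens_good isFiltration_filT gE).add
      (d₁.goodT.tens_null isFiltration_filT (null_com_euler hX₂))
  · simp only [com_mT_tens (h₁.suppT _) (sθ _), pantsR, add_assoc, ← tens_add]
    exact (d₁.sqT.tens_good isFiltration_filT hθ).add (d₁.goodT.tens_null isFiltration_filT nθ)

theorem exists_isPants_left (hX₁ : IsAlexanderCobounded X₁) (hX₂ : IsAlexanderCobounded X₂)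
    (hf₁ : IsHomotopyFinite X₁) : ∃ Θ, IsPants (Prod.map X₁.idem X₂.idem) (prodF X₁ X₂)
      (prodG X₁ X₂) (pantsL X₁ X₂) Θ := by
  have h₁ := hX₁.isIdem
  have h₂ := hX₂.isIdem
  have d₁ := hX₁.coboundedData
  have d₂ := hX₂.coboundedData
  obtain ⟨θ, hθ, sθ, nθ⟩ := exists_theta hX₁ hf₁
  have gE : Good filT fun n => cmul (mE (compG (X₁.δ n))) (compT (X₁.δ n)) :=
    Good.cmul compat_filT (Good.mE d₁.goodG) d₁.goodT (by simp)
  refine ⟨fun n => tens (θ n) (compT (X₂.δ n)), gE.tens isFiltration_filT d₂.goodT,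
    suppPL h₁ h₂, ?_, hθ.tens isFiltration_filT d₂.goodT,
    fun n => HasSupp.tens (sθ n) (h₂.suppT n), ?_⟩
  · have e := fun n => com_mT_tens (((h₁.suppG n).mmap opEuler.toAddMonoidHom).cmul
      (h₁.suppT n)) (h₂.suppT n) n
    refine Eq.mpr (congrArg (Null filT) (funext e)) ?_
    exact ((null_com_euler hX₁).tens_good isFiltration_filT d₂.goodT).add
      (gE.tens_null isFiltration_filT d₂.sqT)
  · refine Eq.mpr (congrArg (Null filT) (funext fun n => ?_))
      ((nθ.tens_good isFiltration_filT d₂.goodT).add (hθ.tens_null isFiltration_filT d₂.sqT))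
    rw [com_mT_tens (sθ n) (h₂.suppT n), pantsL, add_right_comm, ← add_tens]
    rfl

theorem HasSupp.mem_range {A : Type*} [Zero A] {φ : X₁.gen × X₂.gen → X₁.gen × X₂.gen →₀ A}
    {a : Fin 2 × Fin 2} {b : Fin 2}
    (h : HasSupp (Prod.map X₁.idem X₂.idem) (Prod.map X₁.idem X₂.idem) a (b, b) φ)
    (p : PairGen X₁ X₂) (y : X₁.gen × X₂.gen) (hy : φ (pairEmb X₁ X₂ p) y ≠ 0) :
    y ∈ Set.range (pairEmb X₁ X₂) := mem_range_pairEmb b (h _ _ hy).2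

theorem HasSupp.res {A : Type*} [Zero A] {φ : X₁.gen × X₂.gen → X₁.gen × X₂.gen →₀ A}
    {a b : Fin 2}
    (h : HasSupp (Prod.map X₁.idem X₂.idem) (Prod.map X₁.idem X₂.idem) (a, a) (b, b) φ) :
    HasSupp (fun p : PairGen X₁ X₂ => p.1.2) (fun p => p.1.2) a b
      (res (pairEmb X₁ X₂) φ) := fun p q hpq => by
  by_contra hc
  exact hpq (eq_zero_of_idem h p q hc)

theorem isAlexanderCobounded_mergeMap {T : ℕ → X₁.gen × X₂.gen → X₁.gen × X₂.gen →₀ R1}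
    (h₁ : IsIdem X₁) (h₂ : IsIdem X₂)
    (h : CoboundedData (prodF X₁ X₂) (prodG X₁ X₂) (prodS X₁ X₂) T)
    (hT : ∀ n, HasSupp (Prod.map X₁.idem X₂.idem) (Prod.map X₁.idem X₂.idem) (0, 0) (1, 1) (T n)) :
    IsAlexanderCobounded ⟨PairGen X₁ X₂, fun p => p.1.2, mergeMap X₁ X₂ T⟩ :=
  (h.res (pairEmb X₁ X₂) (fun n => (suppPF h₁ h₂ n).mem_range)
    (fun n => (suppPG h₁ h₂ n).mem_range) (fun n => (suppPS h₁ h₂ n).mem_range)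
    fun n => (hT n).mem_range).isAlexanderCobounded (fun n => (suppPF h₁ h₂ n).res)
    (fun n => (suppPG h₁ h₂ n).res) (fun n => (suppPS h₁ h₂ n).res) fun n => (hT n).res

theorem pants_equivalent {Y Θ : ℕ → X₁.gen × X₂.gen → X₁.gen × X₂.gen →₀ R1}
    (hX₁ : IsAlexanderCobounded X₁) (hX₂ : IsAlexanderCobounded X₂)
    (hY : IsPants (Prod.map X₁.idem X₂.idem) (prodF X₁ X₂) (prodG X₁ X₂) Y Θ) :
    IsAlexanderCobounded ⟨PairGen X₁ X₂, fun p => p.1.2, mergeMap X₁ X₂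
      fun n => prodT X₁ X₂ n + cmul (mD (prodG X₁ X₂ n)) (Y n)⟩ ∧
    HomotopyEquivalent ⟨PairGen X₁ X₂, fun p => p.1.2, mergeMap X₁ X₂
      fun n => prodT X₁ X₂ n + cmul (mD (prodG X₁ X₂ n)) (Y n)⟩
      ⟨PairGen X₁ X₂, fun p => p.1.2, mergeMap X₁ X₂ (prodT X₁ X₂)⟩ := by
  have h₁ := hX₁.isIdem
  have h₂ := hX₂.isIdem
  have hd := coboundedData_prod hX₁ hX₂
  have sD : ∀ n {Z : X₁.gen × X₂.gen → X₁.gen × X₂.gen →₀ R1},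
      HasSupp (Prod.map X₁.idem X₂.idem) (Prod.map X₁.idem X₂.idem) (0, 0) (1, 1) Z →
      HasSupp (Prod.map X₁.idem X₂.idem) (Prod.map X₁.idem X₂.idem) (0, 0) (1, 1)
        (cmul (mD (prodG X₁ X₂ n)) Z) := fun n Z hZ => ((suppPG h₁ h₂ n).mmap _).cmul hZ
  have sT := fun n => (suppPT h₁ h₂ n).add (sD n (hY.suppY n))
  have hF : ∀ n p y, mT (prodF X₁ X₂ n) (pairEmb X₁ X₂ p) y ≠ 0 → y ∈ Set.range (pairEmb X₁ X₂) :=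
    fun n => ((suppPF h₁ h₂ n).mmap _).mem_range
  refine ⟨isAlexanderCobounded_mergeMap h₁ h₂ (hd.add_pants hY) sT, ?_⟩
  refine homotopyEquivalent_shear (fun n => (suppPF h₁ h₂ n).res)
    (fun n => (suppPG h₁ h₂ n).res) (fun n => (suppPS h₁ h₂ n).res) (fun n => (sT n).res)
    (fun n => (suppPT h₁ h₂ n).res)
    -- The shear uses η = D(G)Θ, restricted to the pairs in equal idempotents.
    ((hd.goodG.mD.cmul compat_filT hY.goodΘ (by simp)).res (pairEmb X₁ X₂))
    (fun n => (sD n (hY.suppΘ n)).res) ?_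
  convert (hY.null_com hd).res (pairEmb X₁ X₂) using 2 with n
  simp only [com, res_add]
  rw [← cmul_res _ _ _ (sD n (hY.suppΘ n)).mem_range, ← cmul_res _ _ _ (hF n), mT, mT, mmap_res]

end Products

end KnotSurgery

end

theorem mainTheorem3
    (X₁ : KnotSurgery.TypeDSeq.{u} (Fin 2) KnotSurgery.K)
    (X₂ : KnotSurgery.TypeDSeq.{v} (Fin 2) KnotSurgery.K)
    (hX₁ : KnotSurgery.IsAlexanderCobounded X₁)
    (hX₂ : KnotSurgery.IsAlexanderCobounded X₂)
    (hf₁ : KnotSurgery.IsHomotopyFinite X₁)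
    (hf₂ : KnotSurgery.IsHomotopyFinite X₂) :
    KnotSurgery.IsAlexanderCobounded
      (KnotSurgery.box (KnotSurgery.extTensor X₁ X₂) KnotSurgery.mergeM2) ∧
    KnotSurgery.IsAlexanderCobounded
      (KnotSurgery.box (KnotSurgery.extTensor X₁ X₂) KnotSurgery.pantsWl) ∧
    KnotSurgery.IsAlexanderCobounded
      (KnotSurgery.box (KnotSurgery.extTensor X₁ X₂) KnotSurgery.pantsWr) ∧
    KnotSurgery.HomotopyEquivalent
      (KnotSurgery.box (KnotSurgery.extTensor X₁ X₂) KnotSurgery.pantsWl)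
      (KnotSurgery.box (KnotSurgery.extTensor X₁ X₂) KnotSurgery.mergeM2) ∧
    KnotSurgery.HomotopyEquivalent
      (KnotSurgery.box (KnotSurgery.extTensor X₁ X₂) KnotSurgery.pantsWr)
      (KnotSurgery.box (KnotSurgery.extTensor X₁ X₂) KnotSurgery.mergeM2) := by
  have h₁ := hX₁.isIdem
  have h₂ := hX₂.isIdem
  obtain ⟨Θr, hr⟩ := KnotSurgery.exists_isPants_right hX₁ hX₂ hf₂
  obtain ⟨Θl, hl⟩ := KnotSurgery.exists_isPants_left hX₁ hX₂ hf₁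
  rw [KnotSurgery.box_mergeM2 h₁ h₂, KnotSurgery.box_pantsWl h₁ h₂, KnotSurgery.box_pantsWr h₁ h₂]
  have er := KnotSurgery.pants_equivalent hX₁ hX₂ hr
  have el := KnotSurgery.pants_equivalent hX₁ hX₂ hl
  exact ⟨KnotSurgery.isAlexanderCobounded_mergeMap h₁ h₂
    (KnotSurgery.coboundedData_prod hX₁ hX₂) (KnotSurgery.suppPT h₁ h₂), el.1, er.1, el.2, er.2⟩
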